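/- Let $k$ be a field and let $H$ be a finite-dimensional quasitriangular Hopf algebra over $k$ with coproduct $\Delta h=h_{(1)}\otimes h_{(2)}$, antipode $S$ and universal R-matrix $R\in H\otimes H$; that is, $R$ is invertible, $(\Delta\otimes\mathrm{id})R=R_{13}R_{23}$, $(\mathrm{id}\otimes\Delta)R=R_{13}R_{12}$ and $\Delta^{\mathrm{op}}(h)=R\,\Delta(h)\,R^{-1}$ for all $h\in H$. Write $R^{-1}=R^{-(1)}\otimes R^{-(2)}$ (summation understood). The dual $H^*$ has the product $\langle ab,h\rangle=\langle a,h_{(1)}\rangle\langle b,h_{(2)}\rangle$ and the coproduct $\langle a,hg\rangle=\langle a_{(1)},h\rangle\langle a_{(2)},g\rangle$. The quantum double $D(H)$ is the Hopf algebra on the vector space $H^*\otimes H$ with product $$(a\otimes h)(b\otimes g)=b_{(2)}a\otimes h_{(2)}g\,\langle Sh_{(1)},b_{(1)}\rangle\langle h_{(3)},b_{(3)}\rangle$$ and tensor product unit, counit and coproduct. The twisted square $D^*(H,H,R)$ is the Hopf algebra which as an algebra and with its counit is $H\otimes H$, and which has coproduct $x\mapsto R_{23}^{-1}\,\Delta_{H\otimes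 H}(x)\,R_{23}$ and antipode $x\mapsto R_{21}\,((S\otimes S)x)\,R_{21}^{-1}$. Assume that $Q=R^{-1}R_{21}^{-1}\in H\otimes H$ is invertible when it is regarded as a linear map $H^*\to H$, $a\mapsto(a\otimes\mathrm{id})(Q)$. Then $$D(H)\to D^*(H,H,R),\qquad a\otimes h\mapsto\big((\mathrm{id}\otimes\mathrm{id}\otimes a)(R_{31}^{-1}R_{23})\big)\,\Delta h$$ (where $a$ is evaluated on the third tensor factor and the product is that of $H\otimes H$) is an isomorphism of Hopf algebras, and its inverse is $$h\otimes g\mapsto \big(Q^{-1}(h\,Sg_{(1)})\big)_{(1)}\,\big\langle R^{-(2)},\big(Q^{-1}(h\,Sg_{(1)})\big)_{(2)}\big\rangle\otimes R^{-(1)}g_{(2)} .$$ -/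

import Mathlib

open scoped TensorProduct
open Coalgebra HopfAlgebra

noncomputable section

namespace QuantumDouble

section Shortcuts

variable {k M N A B : Type*} [Field k] [AddCommMonoid M] [AddCommMonoid N] [Module k M] [Module k N]
  [Semiring A] [Semiring B] [Algebra k A] [Algebra k B]

lemma linearMap_zeroHomClass : ZeroHomClass (M →ₗ[k] N) M N := inferInstance
lemma linearMap_addHomClass : AddHomClass (M →ₗ[k] N) M N := inferInstance
lemma linearEquiv_zeroHomClass : ZeroHomClass (M ≃ₗ[k] N) M N := inferInstance
lemma linearEquiv_addHomClass : AddHomClass (M ≃ₗ[k] N) M N := inferInstance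
lemma algHom_zeroHomClass : ZeroHomClass (A →ₐ[k] B) A B := inferInstance
lemma algHom_addHomClass : AddHomClass (A →ₐ[k] B) A B := inferInstance

end Shortcuts

attribute [local instance] linearMap_zeroHomClass linearMap_addHomClass linearEquiv_zeroHomClass
  linearEquiv_addHomClass algHom_zeroHomClass algHom_addHomClass

section DualCoalgebra

variable (k : Type*) (H : Type*) [Field k] [Ring H] [HopfAlgebra k H]

/-- The dual `H*`. As an algebra it carries the convolution product `(a b)(x) = a(x₁) b(x₂)`, with
the counit of `H` as unit. -/
abbrev HDual : Type _ := WithConv (H →ₗ[k] k)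

variable {k H}

/-- Evaluation of the `H*` leg at `x`: `a ⊗ w ↦ a(x) w`. -/
def evalLeft {W : Type*} [AddCommMonoid W] [Module k W] (x : H) : HDual k H ⊗[k] W →ₗ[k] W :=
  (TensorProduct.lid k W).toLinearMap ∘ₗ
    LinearMap.rTensor W (LinearMap.applyₗ x ∘ₗ (WithConv.linearEquiv k (H →ₗ[k] k)).toLinearMap)

@[simp] lemma evalLeft_tmul {W : Type*} [AddCommMonoid W] [Module k W] (x : H) (a : HDual k H)
    (w : W) : evalLeft x (a ⊗ₜ[k] w) = a x • w := by
  simp [evalLeft]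

lemma evalLeft_ext {W : Type*} [AddCommMonoid W] [Module k W] [FiniteDimensional k H]
    {s t : HDual k H ⊗[k] W} (h : ∀ x : H, evalLeft x s = evalLeft x t) : s = t := by
  classical
  let e := (TensorProduct.congr (WithConv.linearEquiv k (H →ₗ[k] k)) (LinearEquiv.refl k W))
  have key : ∀ s : HDual k H ⊗[k] W, ∀ x, dualTensorHom k H W (e s) x = evalLeft x s := by
    intro s x
    induction s with
    | zero => simp
    | tmul a w => simp [e]
    | add s t hs ht => simp [hs, ht]
  have inj : Function.Injective (dualTensorHom k H W) :=
    (dualTensorHomEquiv k H W).injective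
  apply e.injective
  apply inj
  ext x
  rw [key, key, h]

lemma evalLeft_lTensor {V W : Type*} [AddCommMonoid W] [Module k W] [AddCommMonoid V] [Module k V]
   (f : V →ₗ[k] W) (x : H) (t : HDual k H ⊗[k] V) :
    evalLeft x (f.lTensor (HDual k H) t) = f (evalLeft x t) := by
  induction t with
  | zero => simp
  | tmul a w => simp
  | add s t hs ht => simp [hs, ht]

variable [FiniteDimensional k H]

/-- The coproduct of `H*` is dual to the product of `H`, `a(x y) = a₁(x) a₂(y)`, and the counit is
`a ↦ a(1)`. -/
instance : CoalgebraStruct k (HDual k H) where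
  comul := TensorProduct.map (WithConv.linearEquiv k (H →ₗ[k] k)).symm.toLinearMap
      (WithConv.linearEquiv k (H →ₗ[k] k)).symm.toLinearMap ∘ₗ
    (TensorProduct.dualDistribEquiv k H H).symm.toLinearMap ∘ₗ
    (LinearMap.mul' k H).dualMap ∘ₗ (WithConv.linearEquiv k (H →ₗ[k] k)).toLinearMap
  counit := LinearMap.applyₗ (1 : H) ∘ₗ (WithConv.linearEquiv k (H →ₗ[k] k)).toLinearMap

lemma counit_dual (a : HDual k H) : counit (R := k) a = a 1 := rfl

lemma evalLeft_comul (a : HDual k H) (x : H) :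
    evalLeft x (comul (R := k) a) = WithConv.toConv (a.ofConv ∘ₗ LinearMap.mulLeft k x) := by
  have key : ∀ t : (H →ₗ[k] k) ⊗[k] (H →ₗ[k] k), ∀ y,
      evalLeft x (TensorProduct.map (WithConv.linearEquiv k (H →ₗ[k] k)).symm.toLinearMap
      (WithConv.linearEquiv k (H →ₗ[k] k)).symm.toLinearMap t) y =
      TensorProduct.dualDistrib k H H t (x ⊗ₜ y) := by
    intro t y
    induction t with
    | zero => simp
    | tmul a w => simp
    | add s t hs ht => simp [hs, ht]
  ext y
  have h1 := key ((TensorProduct.dualDistribEquiv k H H).symm ((LinearMap.mul' k H).dualMap a.ofConv)) y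
  have h2 : ∀ t, TensorProduct.dualDistrib k H H t = TensorProduct.dualDistribEquiv k H H t := fun _ => rfl
  rw [h2, LinearEquiv.apply_symm_apply] at h1
  refine Eq.trans h1 ?_
  simp

lemma comul_dual_apply (a : HDual k H) (x y : H) :
    evalLeft y (evalLeft x (comul (R := k) a) ⊗ₜ[k] (1:k)) = a (x * y) := by
  rw [evalLeft_comul]; simp

lemma evalLeft_evalLeft_assoc {W : Type*} [AddCommMonoid W] [Module k W] (x y : H)
  (t : HDual k H ⊗[k] W) :
    evalLeft y (evalLeft x (TensorProduct.assoc k _ _ _ (comul.rTensor W t))) =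
      evalLeft (x * y) t := by
  induction t with
  | zero => simp
  | add s t hs ht => simp [hs, ht]
  | tmul a w =>
    have : ∀ s : HDual k H ⊗[k] HDual k H,
       evalLeft x (TensorProduct.assoc k _ _ _ (s ⊗ₜ[k] w)) = evalLeft x s ⊗ₜ w := by
      intro s
      induction s with
      | zero => simp
      | add s t hs ht => simp [hs, ht, TensorProduct.add_tmul]
      | tmul a w => simp [TensorProduct.smul_tmul']
    simp [this, evalLeft_comul]

instance : Coalgebra k (HDual k H) where
  coassoc := by
    ext1 a
    refine evalLeft_ext fun x => evalLeft_ext fun y => ?_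
    simp only [LinearMap.coe_comp, LinearEquiv.coe_coe, Function.comp_apply]
    rw [evalLeft_evalLeft_assoc, evalLeft_lTensor, evalLeft_comul, evalLeft_comul, evalLeft_comul]
    ext z
    simp [mul_assoc]
  rTensor_counit_comp_comul := by
    ext1 a
    have : ∀ s : HDual k H ⊗[k] HDual k H, counit.rTensor (HDual k H) s = 1 ⊗ₜ evalLeft 1 s := by
      intro s
      induction s with
      | zero => simp
      | add s t hs ht => simp [hs, ht, TensorProduct.tmul_add]
      | tmul a w => simp [counit_dual, TensorProduct.tmul_smul, TensorProduct.smul_tmul']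
    simp only [LinearMap.coe_comp, Function.comp_apply, this, evalLeft_comul]
    congr 1
    ext y; simp
  lTensor_counit_comp_comul := by
    ext1 a
    refine evalLeft_ext fun x => ?_
    simp only [LinearMap.coe_comp, Function.comp_apply]
    rw [evalLeft_lTensor, evalLeft_comul]
    simp [counit_dual]

end DualCoalgebra

section Sweedler

variable (k H : Type*) [Field k] [Ring H] [HopfAlgebra k H]

/-- The iterated coproduct `h ↦ h₁ ⊗ h₂ ⊗ h₃`. -/
def comul₃ : H →ₗ[k] H ⊗[k] (H ⊗[k] H) := (comul (R := k)).lTensor H ∘ₗ comul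

def comul₃Alg : H →ₐ[k] H ⊗[k] (H ⊗[k] H) :=
  (Algebra.TensorProduct.map (AlgHom.id k H) (Bialgebra.comulAlgHom k H)).comp
    (Bialgebra.comulAlgHom k H)

lemma comul₃Alg_apply (h : H) : comul₃Alg k H h = comul₃ k H h := rfl

lemma comul₃_mul (h g : H) : comul₃ k H (h * g) = comul₃ k H h * comul₃ k H g := by
  simp only [← comul₃Alg_apply, map_mul]

lemma comul₃_one : comul₃ k H 1 = 1 := by
  simp only [← comul₃Alg_apply, map_one]

lemma comul_comul :
    TensorProduct.map comul comul ∘ₗ comul (R := k) (A := H) =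
    (TensorProduct.assoc k H H (H ⊗[k] H)).symm.toLinearMap ∘ₗ
    LinearMap.lTensor H (TensorProduct.assoc k H H H).toLinearMap ∘ₗ
    LinearMap.lTensor H (comul.rTensor H) ∘ₗ comul₃ k H := by
  simp only [comul₃, coassoc_simps]

lemma comul₅ :
    TensorProduct.map comul ((comul (R := k)).lTensor H) ∘ₗ comul₃ k H =
    (TensorProduct.assoc k H H (H ⊗[k] (H ⊗[k] H))).symm.toLinearMap ∘ₗ
    LinearMap.lTensor H (LinearMap.lTensor H (TensorProduct.assoc k H H H).toLinearMap) ∘ₗ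
    LinearMap.lTensor H (TensorProduct.assoc k H (H ⊗[k] H) H).toLinearMap ∘ₗ
    LinearMap.lTensor H ((comul₃ k H).rTensor H) ∘ₗ comul₃ k H := by
  simp only [comul₃, coassoc_simps]

lemma comul₆ :
    TensorProduct.map (comul₃ k H) (comul₃ k H) ∘ₗ comul (R := k) (A := H) =
    (TensorProduct.assoc k H (H ⊗[k] H) (H ⊗[k] (H ⊗[k] H))).symm.toLinearMap ∘ₗ
    LinearMap.lTensor H ((TensorProduct.assoc k H H _).symm.toLinearMap) ∘ₗ
    LinearMap.lTensor H (LinearMap.lTensor H (TensorProduct.assoc k H H (H ⊗[k] H)).toLinearMap) ∘ₗ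
    LinearMap.lTensor H (LinearMap.lTensor H (TensorProduct.assoc k (H ⊗[k] H) H H).toLinearMap) ∘ₗ
    LinearMap.lTensor H (TensorProduct.assoc k H ((H ⊗[k] H) ⊗[k] H) H).toLinearMap ∘ₗ
    LinearMap.lTensor H ((LinearMap.lTensor H (comul.rTensor H) ∘ₗ comul₃ k H).rTensor H) ∘ₗ comul₃ k H := by
  simp only [comul₃, coassoc_simps]

open WithConv in
/-- The antipode is an anti-coalgebra map. -/
lemma comul_antipode (h : H) : comul (R := k) (antipode k h) =
    TensorProduct.comm k H H (TensorProduct.map (antipode k) (antipode k) (comul h)) := by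
  let F : WithConv (H →ₗ[k] H ⊗[k] H) := toConv (comul ∘ₗ antipode k)
  let G : WithConv (H →ₗ[k] H ⊗[k] H) := toConv ((TensorProduct.comm k H H).toLinearMap ∘ₗ
    (TensorProduct.map (antipode k) (antipode k)) ∘ₗ comul)
  have hF : F * toConv comul = 1 := by
    ext x
    have : ∀ t : H ⊗[k] H, LinearMap.mul' k (H ⊗[k] H) (TensorProduct.map (comul ∘ₗ antipode k)
        comul t) = comul (R := k) (LinearMap.mul' k H ((antipode k).rTensor H t)) := by
      intro t
      induction t with
      | zero => simp
      | add s t hs ht => simp [hs, ht]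
      | tmul a b => simp
    rw [LinearMap.convMul_apply]
    simp only [F, this, WithConv.ofConv_toConv, mul_antipode_rTensor_comul_apply]
    simp
  have hG : toConv comul * G = 1 := by
    ext x
    rw [LinearMap.convMul_apply]
    let M : (H ⊗[k] H) ⊗[k] (H ⊗[k] H) →ₗ[k] H ⊗[k] H :=
      LinearMap.mul' k (H ⊗[k] H) ∘ₗ LinearMap.lTensor _ ((TensorProduct.comm k H H).toLinearMap ∘ₗ
    (TensorProduct.map (antipode k) (antipode k)))
    have h1 : ∀ t : H ⊗[k] H, LinearMap.mul' k (H ⊗[k] H) (TensorProduct.map comul G.ofConv t)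
        = M (TensorProduct.map comul comul t) := by
      intro t
      induction t with
      | zero => simp
      | add s t hs ht => simp [hs, ht]
      | tmul a b => simp [M, G]
    have h2 := congr(M ($(comul_comul k H) x))
    simp only [LinearMap.comp_apply, LinearEquiv.coe_coe] at h2
    simp only [ofConv_toConv]
    rw [h1, h2]
    let N : H ⊗[k] (H ⊗[k] H) →ₗ[k] H ⊗[k] H :=
      (LinearMap.rTensor H (LinearMap.mul' k H ∘ₗ (antipode k).lTensor H)) ∘ₗ
      (TensorProduct.assoc k H H H).symm.toLinearMap ∘ₗ
      LinearMap.lTensor H ((TensorProduct.comm k H H).toLinearMap)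
    have h3 : ∀ t : H ⊗[k] (H ⊗[k] H), M ((TensorProduct.assoc k H H (H ⊗[k] H)).symm
        (LinearMap.lTensor H (TensorProduct.assoc k H H H).toLinearMap
        (LinearMap.lTensor H (comul.rTensor H) t))) =
         N (LinearMap.lTensor H (LinearMap.rTensor H (Algebra.linearMap k H ∘ₗ counit)) t) := by
      intro t
      induction t with
      | zero => simp
      | add s t hs ht => simp [hs, ht]
      | tmul p s =>
        induction s with
        | zero => simp
        | add s t hs ht => simp only [TensorProduct.tmul_add, map_add, hs, ht]
        | tmul q r =>
          simp only [LinearMap.lTensor_tmul, LinearMap.rTensor_tmul, LinearMap.comp_apply,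
            ← mul_antipode_lTensor_comul_apply, Algebra.linearMap_apply]
          generalize comul (R := k) q = s
          induction s with
          | zero => simp
          | add s t hs ht =>
            simp only [TensorProduct.tmul_add, TensorProduct.add_tmul, map_add, hs, ht]
          | tmul q q' => simp [M, N]
    rw [h3]
    have h4 : LinearMap.lTensor H (LinearMap.rTensor H (Algebra.linearMap k H ∘ₗ counit))
        (comul₃ k H x) = LinearMap.lTensor H (TensorProduct.mk k H H 1) (comul x) := by
      simp only [comul₃, LinearMap.comp_apply]
      rw [← LinearMap.comp_apply, ← LinearMap.lTensor_comp, LinearMap.rTensor_comp,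
        LinearMap.comp_assoc, Coalgebra.rTensor_counit_comp_comul]
      congr 2
      ext y
      simp
    rw [h4]
    have h5 : ∀ t : H ⊗[k] H, N (LinearMap.lTensor H (TensorProduct.mk k H H 1) t) =
        LinearMap.mul' k H ((antipode k).lTensor H t) ⊗ₜ 1 := by
      intro t
      induction t with
      | zero => simp
      | add s t hs ht => simp only [map_add, hs, ht, TensorProduct.add_tmul]
      | tmul a b => simp [N]
    rw [h5, mul_antipode_lTensor_comul_apply]
    simp [Algebra.TensorProduct.algebraMap_apply]
  have := left_inv_eq_right_inv hF hG
  exact congr(($this).ofConv h)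

end Sweedler

section Double

variable {k H : Type*} [Field k] [Ring H] [HopfAlgebra k H]

/-- `p ⊗ r ↦ (x ↦ b (S(p) x r))`, that is `p ⊗ r ↦ b₂ ⟨S p, b₁⟩ ⟨r, b₃⟩`. -/
def sandwich (b : HDual k H) : H ⊗[k] H →ₗ[k] HDual k H :=
  TensorProduct.lift (LinearMap.mk₂ k
    (fun p r => WithConv.toConv
      (b.ofConv ∘ₗ LinearMap.mulLeft k (antipode k p) ∘ₗ LinearMap.mulRight k r))
    (fun p p' r => by ext x; simp [add_mul])
    (fun c p r => by ext x; simp)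
    (fun p r r' => by ext x; simp [mul_add])
    (fun c p r => by ext x; simp))

lemma sandwich_apply (b : HDual k H) (p r x : H) :
    sandwich b (p ⊗ₜ[k] r) x = b (antipode k p * (x * r)) := rfl

lemma sandwich_eq [FiniteDimensional k H] (b : HDual k H) (p r : H) :
    sandwich b (p ⊗ₜ[k] r) = TensorProduct.rid k (HDual k H)
      ((LinearMap.applyₗ r ∘ₗ (WithConv.linearEquiv k (H →ₗ[k] k)).toLinearMap).lTensor (HDual k H)
        (comul (R := k) (evalLeft (antipode k p) (comul (R := k) b)))) := by
  have key : ∀ (t : HDual k H ⊗[k] HDual k H) (x : H), TensorProduct.rid k (HDual k H)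
      ((LinearMap.applyₗ r ∘ₗ (WithConv.linearEquiv k (H →ₗ[k] k)).toLinearMap).lTensor (HDual k H)
        t) x = evalLeft x t r := by
    intro t x
    induction t with
    | zero => simp
    | add s t hs ht => simp only [map_add, WithConv.ofConv_add, LinearMap.add_apply, hs, ht]
    | tmul c d => simp [mul_comm]
  ext x
  rw [key, evalLeft_comul, evalLeft_comul, sandwich_apply]
  rfl

/-- `p ⊗ q ⊗ r ↦ b₂ ⟨S p, b₁⟩ ⟨r, b₃⟩ ⊗ q`. -/
def crossAux (b : HDual k H) : H ⊗[k] (H ⊗[k] H) →ₗ[k] HDual k H ⊗[k] H :=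
  (sandwich b).rTensor H ∘ₗ (TensorProduct.assoc k H H H).symm.toLinearMap ∘ₗ
    LinearMap.lTensor H (TensorProduct.comm k H H).toLinearMap

lemma crossAux_tmul (b : HDual k H) (p q r : H) :
    crossAux b (p ⊗ₜ[k] (q ⊗ₜ[k] r)) = sandwich b (p ⊗ₜ[k] r) ⊗ₜ[k] q := rfl

lemma sandwich_add (b c : HDual k H) : sandwich (b + c) = sandwich b + sandwich c := by
  ext x y z; simp [sandwich_apply]

lemma sandwich_smul (r : k) (c : HDual k H) : sandwich (r • c) = r • sandwich c := by
  ext x y z; simp [sandwich_apply]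

variable (k H)

/-- `h ⊗ b ↦ b₂ ⟨S h₁, b₁⟩ ⟨h₃, b₃⟩ ⊗ h₂`. -/
def cross : H ⊗[k] HDual k H →ₗ[k] HDual k H ⊗[k] H :=
  TensorProduct.lift (LinearMap.mk₂ k
    (fun h b => crossAux b (comul₃ k H h))
    (fun h h' b => by simp)
    (fun c h b => by simp)
    (fun h b b' => by simp [crossAux, sandwich_add, LinearMap.rTensor_add])
    (fun c h b => by simp [crossAux, sandwich_smul, LinearMap.rTensor_smul]))

/-- The product of the quantum double,
`(a ⊗ h) ⊗ (b ⊗ g) ↦ b₂ a ⊗ h₂ g ⟨S h₁, b₁⟩ ⟨h₃, b₃⟩`. -/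
def doubleMul : (HDual k H ⊗[k] H) ⊗[k] (HDual k H ⊗[k] H) →ₗ[k] HDual k H ⊗[k] H :=
  TensorProduct.map (LinearMap.mul' k (HDual k H) ∘ₗ (TensorProduct.comm k _ _).toLinearMap)
      (LinearMap.mul' k H) ∘ₗ
    (TensorProduct.assoc k (HDual k H) (HDual k H) (H ⊗[k] H)).symm.toLinearMap ∘ₗ
    LinearMap.lTensor (HDual k H) ((TensorProduct.assoc k (HDual k H) H H).toLinearMap ∘ₗ
      LinearMap.rTensor H (cross k H) ∘ₗ
      (TensorProduct.assoc k H (HDual k H) H).symm.toLinearMap) ∘ₗ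
    (TensorProduct.assoc k (HDual k H) H (HDual k H ⊗[k] H)).toLinearMap

variable {k H}

lemma cross_tmul (h : H) (b : HDual k H) :
   cross k H (h ⊗ₜ[k] b) = crossAux b (comul₃ k H h) := rfl

lemma doubleMul_tmul (a b : HDual k H) (h g : H) :
    doubleMul k H ((a ⊗ₜ[k] h) ⊗ₜ[k] (b ⊗ₜ[k] g)) =
      TensorProduct.map (LinearMap.mulRight k a) (LinearMap.mulRight k g)
        (cross k H (h ⊗ₜ[k] b)) := by
  simp only [doubleMul, LinearMap.comp_apply, LinearEquiv.coe_coe, TensorProduct.assoc_tmul,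
    LinearMap.lTensor_tmul, TensorProduct.assoc_symm_tmul, LinearMap.rTensor_tmul]
  generalize cross k H (h ⊗ₜ[k] b) = t
  induction t with
  | zero => simp
  | add s t hs ht => simp only [map_add, hs, ht, TensorProduct.add_tmul, TensorProduct.tmul_add]
  | tmul p q => simp

/-! The regular representation used for associativity -/

def actL : H →ₐ[k] Module.End k (H →ₗ[k] H) :=
  AlgHom.ofLinearMap ((LinearMap.llcomp k H H H).flip ∘ₗ LinearMap.mul k H ∘ₗ antipode k)
    (by ext; simp) (fun x y => by ext; simp [antipode_mul_antidistrib, mul_assoc])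

def actM : H →ₐ[k] Module.End k (H →ₗ[k] H) :=
  AlgHom.ofLinearMap (LinearMap.llcomp k H H H ∘ₗ LinearMap.mul k H)
    (by ext; simp) (fun x y => by ext; simp [mul_assoc])

def actR : H →ₐ[k] Module.End k (H →ₗ[k] H) :=
  AlgHom.ofLinearMap ((LinearMap.llcomp k H H H).flip ∘ₗ (LinearMap.mul k H).flip)
    (by ext; simp) (fun x y => by ext; simp [mul_assoc])

def actE : H ⊗[k] (H ⊗[k] H) →ₐ[k] Module.End k (H →ₗ[k] H) :=
  Algebra.TensorProduct.lift actL (Algebra.TensorProduct.lift actM actR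
    (fun x y => by ext; simp [actM, actR])) (fun x y => by
      induction y with
      | zero => simp
      | add s t hs ht => rw [map_add]; exact hs.add_right ht
      | tmul y z => ext; simp [actL, actM, actR, mul_assoc])

lemma actE_apply (p q r x : H) (ξ : H →ₗ[k] H) :
    actE (p ⊗ₜ[k] (q ⊗ₜ[k] r)) ξ x = q * ξ (antipode k p * (x * r)) := by
  simp [actE, actL, actM, actR, mul_assoc]

def actA : HDual k H →ₗ[k] Module.End k (H →ₗ[k] H) :=
  LinearMap.mk₂ k (fun a ξ => (TensorProduct.rid k H).toLinearMap ∘ₗ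
      TensorProduct.map ξ a.ofConv ∘ₗ comul)
    (fun a a' ξ => by ext; simp [TensorProduct.map_add_right])
    (fun c a ξ => by ext; simp [TensorProduct.map_smul_right])
    (fun a ξ ξ' => by ext; simp [TensorProduct.map_add_left])
    (fun c a ξ => by ext; simp [TensorProduct.map_smul_left])

def contr (a : HDual k H) (ξ : H →ₗ[k] H) : H ⊗[k] H →ₗ[k] H :=
  (TensorProduct.rid k H).toLinearMap ∘ₗ TensorProduct.map ξ a.ofConv

lemma contr_tmul (a : HDual k H) (ξ : H →ₗ[k] H) (x y : H) :
    contr a ξ (x ⊗ₜ[k] y) = a y • ξ x := by simp [contr]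

lemma contr_add (a : HDual k H) (η η' : H →ₗ[k] H) : contr a (η + η') = contr a η + contr a η' := by
  ext; simp [contr]

lemma actA_apply (a : HDual k H) (ξ : H →ₗ[k] H) (x : H) :
    actA a ξ x = contr a ξ (comul x) := rfl

lemma actA_mul (a b : HDual k H) : actA (b * a) = actA a * actA b := by
  ext ξ x
  simp only [Module.End.mul_apply, actA_apply]
  have h1 : ∀ t : H ⊗[k] H, contr a (actA b ξ) t =
      (contr a LinearMap.id) ((contr b ξ).rTensor H (comul.rTensor H t)) := by
    intro t
    induction t with
    | zero => simp
    | add s t hs ht => simp only [map_add, hs, ht]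
    | tmul p q => simp [contr_tmul, actA_apply]
  have h2 : ∀ t : H ⊗[k] H, contr (b * a) ξ t =
      (contr a LinearMap.id) ((contr b ξ).rTensor H ((TensorProduct.assoc k H H H).symm
        (comul.lTensor H t))) := by
    intro t
    induction t with
    | zero => simp
    | add s t hs ht => simp only [map_add, hs, ht]
    | tmul p q =>
      simp only [contr_tmul, LinearMap.convMul_apply, LinearMap.lTensor_tmul]
      generalize comul (R := k) q = s
      induction s with
      | zero => simp
      | add s t hs ht => simp only [map_add, hs, ht, TensorProduct.tmul_add, add_smul]
      | tmul q r => simp [contr_tmul, smul_smul, mul_comm]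
  rw [h1, h2, Coalgebra.coassoc_symm_apply]

lemma actA_one : actA (1 : HDual k H) = 1 := by
  ext ξ x
  simp only [Module.End.one_apply, actA_apply]
  have h2 : ∀ t : H ⊗[k] H, contr 1 ξ t = ξ (TensorProduct.rid k H (counit.lTensor H t)) := by
    intro t
    induction t with
    | zero => simp
    | add s t hs ht => simp only [map_add, hs, ht]
    | tmul p q => simp [contr_tmul]
  simp [h2]

def act : HDual k H ⊗[k] H →ₗ[k] Module.End k (H →ₗ[k] H) :=
  TensorProduct.lift ((LinearMap.mul k (Module.End k (H →ₗ[k] H))).compl₁₂ actA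
    (actE.toLinearMap ∘ₗ comul₃ k H))

lemma act_tmul (a : HDual k H) (h : H) : act (a ⊗ₜ[k] h) = actA a * actE (comul₃ k H h) := rfl

/-- the exchange relation -/
lemma act_cross (b : HDual k H) (h : H) :
    act (cross k H (h ⊗ₜ[k] b)) = actE (comul₃ k H h) * actA b := by
  ext ξ x
  let M (X : H ⊗[k] H) : (H ⊗[k] H) ⊗[k] (H ⊗[k] (H ⊗[k] H)) →ₗ[k] H :=
    LinearMap.mul' k H ∘ₗ
      LinearMap.lTensor H (contr b ξ ∘ₗ LinearMap.mul' k (H ⊗[k] H) ∘ₗ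
        TensorProduct.map ((TensorProduct.comm k H H).toLinearMap ∘ₗ
          TensorProduct.map (antipode k) (antipode k)) (LinearMap.mulLeft k X)) ∘ₗ
      (TensorProduct.leftComm k (H ⊗[k] H) H (H ⊗[k] H)).toLinearMap
  have hr : ∀ t : H ⊗[k] (H ⊗[k] H), actE t (actA b ξ) x =
      M (comul x) (TensorProduct.map comul ((comul (R := k)).lTensor H) t) := by
    intro t
    induction t with
    | zero => simp
    | add s t hs ht => simp only [map_add, LinearMap.add_apply, hs, ht]
    | tmul p s =>
      induction s with
      | zero => simp
      | add s t hs ht =>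
        simp only [TensorProduct.tmul_add, map_add, LinearMap.add_apply, hs, ht]
      | tmul q r =>
        rw [actE_apply, actA_apply, Bialgebra.comul_mul, Bialgebra.comul_mul, comul_antipode]
        simp [M]
  have hl : ∀ t : H ⊗[k] (H ⊗[k] H), act (crossAux b t) ξ x =
      M (comul x) ((TensorProduct.assoc k H H (H ⊗[k] (H ⊗[k] H))).symm
        (LinearMap.lTensor H (LinearMap.lTensor H (TensorProduct.assoc k H H H).toLinearMap)
        (LinearMap.lTensor H (TensorProduct.assoc k H (H ⊗[k] H) H).toLinearMap
        (LinearMap.lTensor H ((comul₃ k H).rTensor H) t)))) := by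
    intro t
    induction t with
    | zero => simp
    | add s t hs ht => simp only [map_add, LinearMap.add_apply, hs, ht]
    | tmul p s =>
      induction s with
      | zero => simp
      | add s t hs ht =>
        simp only [TensorProduct.tmul_add, map_add, LinearMap.add_apply, hs, ht]
      | tmul q r =>
        rw [crossAux_tmul, act_tmul, Module.End.mul_apply, actA_apply]
        simp only [LinearMap.lTensor_tmul, LinearMap.rTensor_tmul]
        generalize comul (R := k) x = X
        generalize comul₃ k H q = Q
        induction Q with
        | zero => simp [contr]
        | add s t hs ht =>
          simp only [map_add, LinearMap.add_apply, contr_add, TensorProduct.add_tmul,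
            TensorProduct.tmul_add, hs, ht]
        | tmul q₁ s =>
          induction s with
          | zero => simp [contr]
          | add s t hs ht =>
            simp only [map_add, LinearMap.add_apply, contr_add, TensorProduct.add_tmul,
              TensorProduct.tmul_add, hs, ht]
          | tmul q₂ q₃ =>
            induction X with
            | zero => simp [M]
            | add s t hs ht =>
              have : ∀ s t, M (s + t) = M s + M t := by
                intro s t
                have : LinearMap.mulLeft k (s + t) = LinearMap.mulLeft k s + LinearMap.mulLeft k t := by
                  ext; simp [add_mul]
                simp only [M, this, TensorProduct.map_add_right, LinearMap.comp_add,
                  LinearMap.add_comp, LinearMap.lTensor_add]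
              simp only [map_add, this, LinearMap.add_apply, hs, ht]
            | tmul y z =>
              simp [M, contr_tmul, actE_apply, sandwich_apply]
  rw [cross_tmul, hl, Module.End.mul_apply, hr]
  exact congr(M (comul x) ($(comul₅ k H) h)).symm

lemma act_doubleMul (F G : HDual k H ⊗[k] H) :
    act (doubleMul k H (F ⊗ₜ[k] G)) = act F * act G := by
  induction F with
  | zero => simp
  | add s t hs ht => simp only [TensorProduct.add_tmul, map_add, hs, ht, add_mul]
  | tmul a h =>
    induction G with
    | zero => simp
    | add s t hs ht => simp only [TensorProduct.tmul_add, map_add, hs, ht, mul_add]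
    | tmul b g =>
      have key : ∀ t : HDual k H ⊗[k] H,
          act (TensorProduct.map (LinearMap.mulRight k a) (LinearMap.mulRight k g) t) =
            actA a * act t * actE (comul₃ k H g) := by
        intro t
        induction t with
        | zero => simp
        | add s t hs ht => simp only [map_add, hs, ht, mul_add, add_mul]
        | tmul c q => simp [act_tmul, actA_mul, comul₃_mul, mul_assoc]
      rw [doubleMul_tmul, key, act_cross, act_tmul, act_tmul]
      simp only [mul_assoc]

/-- An element of `H* ⊗ H` as a linear map `H → H`. -/
def toHom : HDual k H ⊗[k] H →ₗ[k] (H →ₗ[k] H) :=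
  TensorProduct.lift (LinearMap.mk₂ k (fun a h => LinearMap.toSpanSingleton k H h ∘ₗ a.ofConv)
    (fun a a' ξ => by ext; simp [add_smul])
    (fun c a ξ => by ext; simp [smul_smul])
    (fun a ξ ξ' => by ext; simp)
    (fun c a ξ => by ext; simp [smul_comm c]))

lemma toHom_apply (F : HDual k H ⊗[k] H) (x : H) : toHom F x = evalLeft x F := by
  induction F with
  | zero => simp
  | add s t hs ht => simp [hs, ht]
  | tmul a h => simp [toHom]

lemma toHom_doubleMul (F G : HDual k H ⊗[k] H) :
    toHom (doubleMul k H (F ⊗ₜ[k] G)) = act F (toHom G) := by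
  induction F with
  | zero => simp
  | add s t hs ht => simp only [TensorProduct.add_tmul, map_add, hs, ht, LinearMap.add_apply]
  | tmul a h =>
    induction G with
    | zero => simp
    | add s t hs ht => simp only [TensorProduct.tmul_add, map_add, hs, ht]
    | tmul b g =>
      rw [doubleMul_tmul, act_tmul, Module.End.mul_apply, cross_tmul]
      generalize comul₃ k H h = t
      ext x
      rw [actA_apply]
      induction t with
      | zero => simp [contr]
      | add s t hs ht =>
          simp only [map_add, LinearMap.add_apply, contr_add, hs, ht]
      | tmul p s =>
        induction s with
        | zero => simp [contr]
        | add s t hs ht =>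
          simp only [map_add, LinearMap.add_apply, contr_add, hs, ht, TensorProduct.tmul_add]
        | tmul q r =>
          rw [crossAux_tmul, TensorProduct.map_tmul, toHom_apply, evalLeft_tmul,
            LinearMap.mulRight_apply, LinearMap.convMul_apply]
          generalize comul (R := k) x = X
          induction X with
          | zero => simp
          | add s t hs ht => simp only [map_add, add_smul, hs, ht]
          | tmul y z =>
            simp [contr_tmul, actE_apply, sandwich_apply, toHom_apply, smul_smul, mul_comm]

lemma toHom_injective [FiniteDimensional k H] :
    Function.Injective (toHom : HDual k H ⊗[k] H →ₗ[k] (H →ₗ[k] H)) := by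
  intro s t h
  refine evalLeft_ext fun x => ?_
  rw [← toHom_apply, ← toHom_apply, h]

lemma doubleMul_assoc [FiniteDimensional k H] (F G K : HDual k H ⊗[k] H) :
    doubleMul k H (doubleMul k H (F ⊗ₜ[k] G) ⊗ₜ[k] K) =
      doubleMul k H (F ⊗ₜ[k] doubleMul k H (G ⊗ₜ[k] K)) := by
  apply toHom_injective
  rw [toHom_doubleMul, act_doubleMul, toHom_doubleMul, toHom_doubleMul, Module.End.mul_apply]

lemma act_one : act (1 ⊗ₜ[k] 1 : HDual k H ⊗[k] H) = 1 := by
  rw [act_tmul, actA_one, comul₃_one, map_one, one_mul]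

lemma doubleMul_one_left [FiniteDimensional k H] (F : HDual k H ⊗[k] H) :
    doubleMul k H ((1 ⊗ₜ[k] 1) ⊗ₜ[k] F) = F := by
  apply toHom_injective
  rw [toHom_doubleMul, act_one, Module.End.one_apply]

lemma cross_one_right (h : H) : cross k H (h ⊗ₜ[k] 1) = 1 ⊗ₜ[k] h := by
  rw [cross_tmul, comul₃, LinearMap.comp_apply]
  have : ∀ t : H ⊗[k] H, crossAux 1 (comul.lTensor H t) =
      1 ⊗ₜ[k] (TensorProduct.lid k H (counit.rTensor H t)) := by
    intro t
    induction t with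
    | zero => simp
    | add s t hs ht => simp only [map_add, TensorProduct.tmul_add, hs, ht]
    | tmul y z =>
      have : ∀ t : H ⊗[k] H, crossAux 1 (y ⊗ₜ t) =
         1 ⊗ₜ[k] (counit (R := k) y • (TensorProduct.rid k H (counit.lTensor H t))) := by
        intro t
        induction t with
        | zero => simp
        | add s t hs ht => simp only [map_add, TensorProduct.tmul_add, smul_add, hs, ht]
        | tmul q r =>
          rw [crossAux_tmul]
          have : sandwich 1 (y ⊗ₜ[k] r) = (counit (R := k) y * counit (R := k) r) • (1 : HDual k H) := by
            ext x
            simp [sandwich_apply]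
            ring
          simp [this, TensorProduct.smul_tmul, smul_smul]
      simp [this]
  simp [this]

lemma doubleMul_one_right (F : HDual k H ⊗[k] H) :
    doubleMul k H (F ⊗ₜ[k] (1 ⊗ₜ[k] 1)) = F := by
  induction F with
  | zero => simp
  | add s t hs ht => simp only [map_add, TensorProduct.add_tmul, hs, ht]
  | tmul a h => simp [doubleMul_tmul, cross_one_right]

end Double

section DoubleBialgebra

variable (k H : Type*) [Field k] [Ring H] [HopfAlgebra k H]

/-- The quantum double `D(H)` of a finite-dimensional Hopf algebra: the vector space `H* ⊗ H` with
the product `(a ⊗ h)(b ⊗ g) = b₂ a ⊗ h₂ g ⟨S h₁, b₁⟩ ⟨h₃, b₃⟩` and the tensor product unit, counit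
and coproduct. -/
def DrinfeldDouble : Type _ := HDual k H ⊗[k] H

namespace DrinfeldDouble

instance : AddCommGroup (DrinfeldDouble k H) := inferInstanceAs (AddCommGroup (HDual k H ⊗[k] H))
instance : Module k (DrinfeldDouble k H) := inferInstanceAs (Module k (HDual k H ⊗[k] H))

variable {k H} in
/-- The element `a ⊗ h`. -/
def tmul (a : HDual k H) (h : H) : DrinfeldDouble k H := a ⊗ₜ[k] h

/-- The identification with the underlying vector space. -/
def equiv : DrinfeldDouble k H ≃ₗ[k] HDual k H ⊗[k] H := LinearEquiv.refl k (HDual k H ⊗[k] H)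

instance : Mul (DrinfeldDouble k H) :=
  ⟨fun F G => (equiv k H).symm (doubleMul k H (equiv k H F ⊗ₜ[k] equiv k H G))⟩

instance : One (DrinfeldDouble k H) := ⟨tmul 1 1⟩

variable {k H}

lemma mul_def (F G : DrinfeldDouble k H) :
    F * G = (equiv k H).symm (doubleMul k H (equiv k H F ⊗ₜ[k] equiv k H G)) := rfl

lemma one_def : (1 : DrinfeldDouble k H) = (equiv k H).symm (1 ⊗ₜ[k] 1) := rfl

variable [FiniteDimensional k H]

instance : Ring (DrinfeldDouble k H) where
  __ := (inferInstance : AddCommGroup (DrinfeldDouble k H))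
  left_distrib F G K := by simp only [mul_def, map_add, TensorProduct.tmul_add]
  right_distrib F G K := by simp only [mul_def, map_add, TensorProduct.add_tmul]
  zero_mul F := by simp only [mul_def, map_zero, TensorProduct.zero_tmul]
  mul_zero F := by simp only [mul_def, map_zero, TensorProduct.tmul_zero]
  mul_assoc F G K := by
    simp only [mul_def, LinearEquiv.apply_symm_apply, doubleMul_assoc]
  one_mul F := by
    simp only [mul_def, one_def, LinearEquiv.apply_symm_apply, doubleMul_one_left,
      LinearEquiv.symm_apply_apply]
  mul_one F := by
    simp only [mul_def, one_def, LinearEquiv.apply_symm_apply, doubleMul_one_right,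
      LinearEquiv.symm_apply_apply]

instance : Algebra k (DrinfeldDouble k H) :=
  Algebra.ofModule
    (fun c F G => by simp only [mul_def, map_smul, ← TensorProduct.smul_tmul'])
    (fun c F G => by simp only [mul_def, map_smul, TensorProduct.tmul_smul])

instance : Coalgebra k (DrinfeldDouble k H) := inferInstanceAs (Coalgebra k (HDual k H ⊗[k] H))

/-- An element of the double as a linear map `H → H`. -/
def hom : DrinfeldDouble k H →ₗ[k] (H →ₗ[k] H) := toHom ∘ₗ (equiv k H).toLinearMap

lemma hom_mul (F G : DrinfeldDouble k H) : hom (F * G) = act (equiv k H F) (hom G) :=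
  toHom_doubleMul _ _

lemma hom_injective : Function.Injective (hom : DrinfeldDouble k H →ₗ[k] (H →ₗ[k] H)) :=
  toHom_injective.comp (equiv k H).injective

lemma hom_tmul (a : HDual k H) (h x : H) : hom (tmul a h) x = a x • h := by
  exact (toHom_apply _ _).trans (evalLeft_tmul x a h)

@[elab_as_elim]
lemma induction_on {P : DrinfeldDouble k H → Prop} (F : DrinfeldDouble k H)
  (zero : P 0) (tmul : ∀ a h, P (tmul a h)) (add : ∀ F G, P F → P G → P (F + G)) : P F :=
  TensorProduct.induction_on (motive := P) F zero tmul add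

lemma counit_eq (F : DrinfeldDouble k H) : counit (R := k) F = counit (hom F 1) := by
  induction F using induction_on with
  | zero => simp
  | add F G hF hG => simp only [map_add, LinearMap.add_apply, hF, hG]
  | tmul a h =>
    rw [hom_tmul]
    refine (TensorProduct.counit_tmul (R := k) (S := k) a h).trans ?_
    simp [counit_dual, mul_comm]

def hom₂ : DrinfeldDouble k H ⊗[k] DrinfeldDouble k H →ₗ[k] (H ⊗[k] H →ₗ[k] H ⊗[k] H) :=
  (homTensorHomEquiv k H H H H).toLinearMap ∘ₗ TensorProduct.map hom hom

lemma hom₂_tmul (F G : DrinfeldDouble k H) : hom₂ (F ⊗ₜ[k] G) = TensorProduct.map (hom F) (hom G) :=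
  by simp [hom₂]

lemma hom₂_injective : Function.Injective
    (hom₂ : DrinfeldDouble k H ⊗[k] DrinfeldDouble k H →ₗ[k] (H ⊗[k] H →ₗ[k] H ⊗[k] H)) := by
  have h2 : Function.Injective (TensorProduct.map (hom (k := k) (H := H)) (hom (k := k) (H := H))) :=
    TensorProduct.map_injective_of_flat_flat _ _ hom_injective hom_injective
  exact (homTensorHomEquiv k H H H H).injective.comp h2

lemma comul_eq (F : DrinfeldDouble k H) : comul (R := k) F =
    TensorProduct.map (equiv k H).symm.toLinearMap (equiv k H).symm.toLinearMap
      (comul (R := k) (equiv k H F)) :=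
  (LinearMap.congr_fun TensorProduct.map_id (comul (R := k) F)).symm

lemma hom₂_comul (F : DrinfeldDouble k H) :
    hom₂ (comul F) = comul ∘ₗ hom F ∘ₗ LinearMap.mul' k H := by
  induction F using induction_on with
  | zero => simp
  | add F G hF hG => simp only [map_add, hF, hG, LinearMap.comp_add, LinearMap.add_comp]
  | tmul a h =>
    ext x y
    simp only [TensorProduct.AlgebraTensorModule.curry_apply, TensorProduct.curry_apply,
      LinearMap.coe_restrictScalars, LinearMap.comp_apply, LinearMap.mul'_apply, hom_tmul, map_smul]
    rw [comul_eq]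
    have h2 : a (x * y) = evalLeft x (comul (R := k) a) y := by
      rw [evalLeft_comul]; rfl
    rw [h2]
    have h3 : comul (R := k) (equiv k H (tmul a h)) =
      TensorProduct.AlgebraTensorModule.tensorTensorTensorComm k k k k
        (HDual k H) (HDual k H) H H (comul a ⊗ₜ comul h) :=
      TensorProduct.comul_tmul (R := k) (S := k) a h
    rw [h3]
    generalize comul (R := k) h = t
    generalize comul (R := k) a = s
    induction s with
    | zero => simp
    | add s s' hs ht =>
      simp only [map_add, TensorProduct.add_tmul, LinearMap.add_apply, hs, ht,
         WithConv.ofConv_add, add_smul]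
    | tmul b c =>
      induction t with
      | zero => simp
      | add s s' hs ht =>
        simp only [map_add, TensorProduct.tmul_add, LinearMap.add_apply, hs, ht, smul_add]
      | tmul h g =>
         have : (TensorProduct.map (equiv k H).symm.toLinearMap (equiv k H).symm.toLinearMap
           (TensorProduct.AlgebraTensorModule.tensorTensorTensorComm k k k k
           (HDual k H) (HDual k H) H H ((b ⊗ₜ c) ⊗ₜ (h ⊗ₜ g)))) = tmul b h ⊗ₜ[k] tmul c g := rfl
         rw [this, hom₂_tmul]
         simp [hom_tmul, TensorProduct.smul_tmul', smul_smul, TensorProduct.tmul_smul, mul_comm]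

lemma tmul_mul_tmul (a b : HDual k H) (h g : H) :
    tmul a h * tmul b g = (equiv k H).symm (TensorProduct.map (LinearMap.mulRight k a)
      (LinearMap.mulRight k g) (cross k H (h ⊗ₜ[k] b))) :=
  congrArg (equiv k H).symm (doubleMul_tmul a b h g)

lemma tmul_eq (a : HDual k H) (h : H) : tmul a h = tmul a 1 * tmul 1 h := by
  rw [tmul_mul_tmul, cross_one_right]
  simp [tmul, equiv]
  rfl

lemma hom_dual_mul (a : HDual k H) (G : DrinfeldDouble k H) (x : H) :
    hom (tmul a 1 * G) x = contr a (hom G) (comul x) := by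
  rw [hom_mul]
  have : act (equiv k H (tmul a 1)) = actA a := by
    refine (act_tmul a 1).trans ?_
    rw [comul₃_one, map_one, mul_one]
  rw [this, actA_apply]

lemma hom_one_mul (h : H) (G : DrinfeldDouble k H) (x : H) :
    hom (tmul 1 h * G) x = actE (comul₃ k H h) (hom G) x := by
  rw [hom_mul]
  have : act (equiv k H (tmul 1 h)) = actE (comul₃ k H h) := by
    refine (act_tmul 1 h).trans ?_
    rw [actA_one, one_mul]
  rw [this]

def contrL (η : H →ₗ[k] H) : HDual k H →ₗ[k] (H ⊗[k] H →ₗ[k] H) where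
  toFun a := contr a η
  map_add' a b := by ext; simp [contr, add_smul]
  map_smul' c b := by ext; simp [contr, smul_smul]

lemma contrL_apply (η : H →ₗ[k] H) (a : HDual k H) : contrL η a = contr a η := rfl

def contr₂ (a : HDual k H) (W : H ⊗[k] H →ₗ[k] H ⊗[k] H) :
    (H ⊗[k] H) ⊗[k] (H ⊗[k] H) →ₗ[k] H ⊗[k] H :=
  (TensorProduct.rid k (H ⊗[k] H)).toLinearMap ∘ₗ
    TensorProduct.map W (a.ofConv ∘ₗ LinearMap.mul' k H) ∘ₗ
    (TensorProduct.tensorTensorTensorComm k H H H H).toLinearMap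

lemma hom₂_dual_mul (a : HDual k H) (t : DrinfeldDouble k H ⊗[k] DrinfeldDouble k H) (x y : H) :
    hom₂ (comul (R := k) (tmul a 1) * t) (x ⊗ₜ[k] y) =
      contr₂ a (hom₂ t) (comul x ⊗ₜ[k] comul y) := by
  let ι : HDual k H →ₗ[k] DrinfeldDouble k H := (equiv k H).symm.toLinearMap ∘ₗ
    (TensorProduct.mk k (HDual k H) H).flip 1
  have hι : ∀ b, ι b = tmul b 1 := fun b => rfl
  have h1 : comul (R := k) (tmul a 1) = TensorProduct.map ι ι (comul (R := k) a) := by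
    rw [comul_eq]
    have h3 : comul (R := k) (equiv k H (tmul a 1)) =
      TensorProduct.AlgebraTensorModule.tensorTensorTensorComm k k k k
        (HDual k H) (HDual k H) H H (comul a ⊗ₜ comul 1) :=
      TensorProduct.comul_tmul (R := k) (S := k) a 1
    rw [h3, Bialgebra.comul_one]
    generalize comul (R := k) a = s
    induction s with
    | zero => simp
    | add s s' hs ht => simp only [map_add, TensorProduct.add_tmul, hs, ht]
    | tmul b c => rfl
  have h2 : ∀ u v : H, a (u * v) = evalLeft u (comul (R := k) a) v := by
    intro u v
    rw [evalLeft_comul]; rfl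
  rw [h1]
  induction t with
  | zero => simp [contr₂]
  | add s s' hs ht =>
    simp only [mul_add, map_add, LinearMap.add_apply, hs, ht]
    simp [contr₂, TensorProduct.map_add_left]
  | tmul G₁ G₂ =>
    have h5 : contr₂ a (hom₂ (G₁ ⊗ₜ[k] G₂)) = homTensorHomEquiv k (H ⊗[k] H) (H ⊗[k] H) H H
        (TensorProduct.map (contrL (hom G₁)) (contrL (hom G₂)) (comul (R := k) a)) := by
      ext p q p' q'
      simp only [TensorProduct.AlgebraTensorModule.curry_apply, TensorProduct.curry_apply,
        LinearMap.coe_restrictScalars, contr₂, LinearMap.comp_apply, LinearEquiv.coe_coe,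
        TensorProduct.tensorTensorTensorComm_tmul, TensorProduct.map_tmul,
        LinearMap.mul'_apply, h2]
      generalize comul (R := k) a = s
      induction s with
      | zero => simp
      | add s s' hs ht =>
        simp only [map_add, TensorProduct.tmul_add, LinearMap.add_apply, hs, ht,
          WithConv.ofConv_add]
      | tmul b c =>
        simp [hom₂_tmul, contr_tmul, contrL_apply, TensorProduct.smul_tmul', smul_smul,
          TensorProduct.tmul_smul, mul_comm]
    rw [h5]
    generalize comul (R := k) a = s
    induction s with
    | zero => simp
    | add s s' hs ht =>
      simp only [map_add, add_mul, LinearMap.add_apply, hs, ht]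
    | tmul b c =>
      simp [hom₂_tmul, hι, hom_dual_mul, contrL_apply]

/-- the exchange -/
def sideMul (x : H) : H ⊗[k] H →ₗ[k] H :=
  LinearMap.mul' k H ∘ₗ TensorProduct.map (antipode k) (LinearMap.mulLeft k x)

lemma sideMul_tmul (x p r : H) : sideMul (k := k) x (p ⊗ₜ[k] r) = antipode k p * (x * r) := by
  simp [sideMul]

def actE₂ (W : H ⊗[k] H →ₗ[k] H ⊗[k] H) (x y : H) :
    (H ⊗[k] (H ⊗[k] H)) ⊗[k] (H ⊗[k] (H ⊗[k] H)) →ₗ[k] H ⊗[k] H :=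
  LinearMap.mul' k (H ⊗[k] H) ∘ₗ
    LinearMap.lTensor (H ⊗[k] H) (W ∘ₗ TensorProduct.map (sideMul x) (sideMul y)) ∘ₗ
    (TensorProduct.tensorTensorTensorComm k H (H ⊗[k] H) H (H ⊗[k] H)).toLinearMap ∘ₗ
    TensorProduct.map (TensorProduct.leftComm k H H H).toLinearMap
      (TensorProduct.leftComm k H H H).toLinearMap

lemma actE₂_tmul (W : H ⊗[k] H →ₗ[k] H ⊗[k] H) (x y p q r p' q' r' : H) :
    actE₂ W x y ((p ⊗ₜ[k] (q ⊗ₜ[k] r)) ⊗ₜ[k] (p' ⊗ₜ[k] (q' ⊗ₜ[k] r'))) =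
    (q ⊗ₜ[k] q') * W ((antipode k p * (x * r)) ⊗ₜ[k] (antipode k p' * (y * r'))) := by
  simp [actE₂, sideMul_tmul]

lemma hom₂_one_mul (h : H) (t : DrinfeldDouble k H ⊗[k] DrinfeldDouble k H) (x y : H) :
    hom₂ (comul (R := k) (tmul 1 h) * t) (x ⊗ₜ[k] y) =
      actE₂ (hom₂ t) x y (TensorProduct.map (comul₃ k H) (comul₃ k H) (comul (R := k) h)) := by
  let ι : H →ₗ[k] DrinfeldDouble k H := (equiv k H).symm.toLinearMap ∘ₗ
    (TensorProduct.mk k (HDual k H) H) 1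
  have hι : ∀ b, ι b = tmul 1 b := fun b => rfl
  have hone : comul (R := k) (1 : HDual k H) = 1 ⊗ₜ[k] 1 := by
    refine evalLeft_ext fun x => ?_
    rw [evalLeft_comul]
    ext y
    simp
  have h1 : comul (R := k) (tmul 1 h) = TensorProduct.map ι ι (comul (R := k) h) := by
    rw [comul_eq]
    have h3 : comul (R := k) (equiv k H (tmul 1 h)) =
      TensorProduct.AlgebraTensorModule.tensorTensorTensorComm k k k k
        (HDual k H) (HDual k H) H H (comul 1 ⊗ₜ comul h) :=
      TensorProduct.comul_tmul (R := k) (S := k) 1 h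
    rw [h3, hone]
    generalize comul (R := k) h = s
    induction s with
    | zero => simp
    | add s s' hs ht => simp only [map_add, TensorProduct.tmul_add, hs, ht]
    | tmul b c => rfl
  rw [h1]
  induction t with
  | zero => simp [actE₂]
  | add s s' hs ht =>
    simp only [mul_add, map_add, LinearMap.add_apply, hs, ht]
    simp only [actE₂, LinearMap.add_comp, LinearMap.lTensor_add, LinearMap.comp_add,
      LinearMap.add_apply]
  | tmul G₁ G₂ =>
    have h5 : actE₂ (hom₂ (G₁ ⊗ₜ[k] G₂)) x y =
        TensorProduct.map (LinearMap.applyₗ x ∘ₗ LinearMap.applyₗ (hom G₁) ∘ₗ actE.toLinearMap)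
        (LinearMap.applyₗ y ∘ₗ LinearMap.applyₗ (hom G₂) ∘ₗ actE.toLinearMap) := by
      ext p q r p' q' r'
      simp only [TensorProduct.AlgebraTensorModule.curry_apply, TensorProduct.curry_apply,
        LinearMap.coe_restrictScalars, actE₂_tmul, hom₂_tmul, TensorProduct.map_tmul,
        LinearMap.comp_apply, LinearMap.applyₗ_apply_apply, AlgHom.toLinearMap_apply, actE_apply]
      simp
    rw [h5]
    generalize comul (R := k) h = s
    induction s with
    | zero => simp
    | add s s' hs ht =>
      simp only [map_add, add_mul, LinearMap.add_apply, hs, ht]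
    | tmul b c =>
      simp [hom₂_tmul, hι, hom_one_mul]

lemma comul_dual_mul (a : HDual k H) (G : DrinfeldDouble k H) :
    comul (R := k) (tmul a 1 * G) = comul (R := k) (tmul a 1) * comul (R := k) G := by
  apply hom₂_injective
  ext x y
  simp only [TensorProduct.AlgebraTensorModule.curry_apply, TensorProduct.curry_apply,
        LinearMap.coe_restrictScalars]
  rw [hom₂_dual_mul, hom₂_comul, hom₂_comul, LinearMap.comp_apply, LinearMap.comp_apply,
    LinearMap.mul'_apply, hom_dual_mul, Bialgebra.comul_mul]
  generalize comul (R := k) x = X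
  generalize comul (R := k) y = Y
  induction X with
  | zero => simp
  | add s s' hs ht => simp only [map_add, add_mul, TensorProduct.add_tmul, hs, ht]
  | tmul b c =>
    induction Y with
    | zero => simp
    | add s s' hs ht => simp only [map_add, mul_add, TensorProduct.tmul_add, hs, ht]
    | tmul b c => simp [contr₂, contr_tmul]

lemma comul_one_mul (h : H) (G : DrinfeldDouble k H) :
    comul (R := k) (tmul 1 h * G) = comul (R := k) (tmul 1 h) * comul (R := k) G := by
  apply hom₂_injective
  ext x y
  simp only [TensorProduct.AlgebraTensorModule.curry_apply, TensorProduct.curry_apply,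
        LinearMap.coe_restrictScalars]
  rw [hom₂_one_mul, hom₂_comul, hom₂_comul, LinearMap.comp_apply, LinearMap.comp_apply,
    LinearMap.mul'_apply, hom_one_mul]
  have h6 := congr(actE₂ (comul (R := k) ∘ₗ hom G ∘ₗ LinearMap.mul' k H) x y ($(comul₆ k H) h))
  refine Eq.trans ?_ h6.symm
  simp only [LinearMap.comp_apply, LinearEquiv.coe_coe]
  generalize comul₃ k H h = t
  induction t with
  | zero => simp
  | add s s' hs ht => simp only [map_add, LinearMap.add_apply, hs, ht]
  | tmul p s =>
    induction s with
    | zero => simp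
    | add s s' hs ht =>
      simp only [TensorProduct.tmul_add, map_add, LinearMap.add_apply, hs, ht]
    | tmul q r =>
      have h7 : ∀ Q : H ⊗[k] (H ⊗[k] H), (actE₂ (comul (R := k) ∘ₗ hom G ∘ₗ LinearMap.mul' k H) x y)
          ((TensorProduct.assoc k H (H ⊗[k] H) (H ⊗[k] (H ⊗[k] H))).symm
          (LinearMap.lTensor H ((TensorProduct.assoc k H H _).symm.toLinearMap)
          (LinearMap.lTensor H (LinearMap.lTensor H (TensorProduct.assoc k H H (H ⊗[k] H)).toLinearMap)
          (LinearMap.lTensor H (LinearMap.lTensor H (TensorProduct.assoc k (H ⊗[k] H) H H).toLinearMap)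
          (LinearMap.lTensor H (TensorProduct.assoc k H ((H ⊗[k] H) ⊗[k] H) H).toLinearMap
          (p ⊗ₜ[k] (LinearMap.lTensor H (comul.rTensor H) Q ⊗ₜ[k] r))))))) =
        LinearMap.lTensor H (TensorProduct.lid k H ∘ₗ counit.rTensor H) Q *
          comul (R := k) (hom G (antipode k p * (x * y * r))) := by
        intro Q
        induction Q with
        | zero => simp
        | add s s' hs ht =>
          simp only [TensorProduct.add_tmul, TensorProduct.tmul_add, map_add, add_mul, hs, ht]
        | tmul q₁ s =>
          induction s with
          | zero => simp
          | add s s' hs ht =>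
            simp only [TensorProduct.add_tmul, TensorProduct.tmul_add, map_add, add_mul, hs, ht]
          | tmul z q₂ =>
            have h8 : ∀ Z : H ⊗[k] H, (actE₂ (comul (R := k) ∘ₗ hom G ∘ₗ LinearMap.mul' k H) x y)
              ((TensorProduct.assoc k H (H ⊗[k] H) (H ⊗[k] (H ⊗[k] H))).symm
              (LinearMap.lTensor H ((TensorProduct.assoc k H H _).symm.toLinearMap)
              (LinearMap.lTensor H (LinearMap.lTensor H (TensorProduct.assoc k H H (H ⊗[k] H)).toLinearMap)
              (LinearMap.lTensor H (LinearMap.lTensor H (TensorProduct.assoc k (H ⊗[k] H) H H).toLinearMap)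
              (LinearMap.lTensor H (TensorProduct.assoc k H ((H ⊗[k] H) ⊗[k] H) H).toLinearMap
              (p ⊗ₜ[k] ((q₁ ⊗ₜ[k] (Z ⊗ₜ[k] q₂)) ⊗ₜ[k] r))))))) =
                (q₁ ⊗ₜ[k] q₂) * comul (R := k) (hom G (antipode k p * (x *
                  (LinearMap.mul' k H ((antipode k).lTensor H Z) * (y * r))))) := by
              intro Z
              induction Z with
              | zero => simp
              | add s s' hs ht =>
                simp only [TensorProduct.add_tmul, TensorProduct.tmul_add, map_add, add_mul, mul_add, hs, ht]
              | tmul z z' => simp [actE₂_tmul, mul_assoc]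
            rw [show LinearMap.lTensor H (comul.rTensor H) (q₁ ⊗ₜ[k] (z ⊗ₜ[k] q₂)) =
              q₁ ⊗ₜ[k] (comul (R := k) z ⊗ₜ[k] q₂) from rfl, h8, mul_antipode_lTensor_comul_apply,
              Algebra.algebraMap_eq_smul_one]
            simp [mul_assoc]
      refine Eq.trans ?_ (h7 (comul₃ k H q)).symm
      rw [actE_apply, Bialgebra.comul_mul]
      congr 1
      have h9 : LinearMap.lTensor H (TensorProduct.lid k H ∘ₗ counit.rTensor H) ∘ₗ comul₃ k H = comul (R := k) := by
        rw [comul₃, ← LinearMap.comp_assoc, ← LinearMap.lTensor_comp, LinearMap.comp_assoc,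
          Coalgebra.rTensor_counit_comp_comul]
        have : (TensorProduct.lid k H).toLinearMap ∘ₗ TensorProduct.mk k k H 1 = LinearMap.id := by
          ext; simp
        rw [this]; simp
      exact (LinearMap.congr_fun h9 q).symm

lemma comul_mul (F G : DrinfeldDouble k H) :
    comul (R := k) (F * G) = comul (R := k) F * comul (R := k) G := by
  induction F using induction_on with
  | zero => simp
  | add F F' hF hF' => simp only [add_mul, map_add, hF, hF']
  | tmul a h =>
    rw [tmul_eq, mul_assoc, comul_dual_mul, comul_one_mul, comul_dual_mul, mul_assoc]

lemma hom_one (x : H) : hom (1 : DrinfeldDouble k H) x = counit (R := k) x • 1 := by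
  exact (hom_tmul _ _ _).trans rfl

lemma counit_mul (F G : DrinfeldDouble k H) :
    counit (R := k) (F * G) = counit (R := k) F * counit (R := k) G := by
  have h1 : ∀ (a : HDual k H) (G : DrinfeldDouble k H),
      counit (R := k) (tmul a 1 * G) = a 1 * counit (R := k) G := by
    intro a G
    simp [counit_eq, hom_dual_mul, Algebra.TensorProduct.one_def, contr_tmul]
  have h2 : ∀ (h : H) (G : DrinfeldDouble k H),
      counit (R := k) (tmul 1 h * G) = counit (R := k) h * counit (R := k) G := by
    intro h G
    have h3 : ∀ t : H ⊗[k] H, counit (R := k) (actE (comul.lTensor H t) (hom G) 1) =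
      counit (R := k) (hom G (LinearMap.mul' k H ((antipode k).rTensor H t))) := by
      intro t
      induction t with
      | zero => simp
      | add s s' hs ht => simp only [map_add, LinearMap.add_apply, hs, ht]
      | tmul p s =>
        have : ∀ Q : H ⊗[k] H, counit (R := k) (actE (p ⊗ₜ[k] Q) (hom G) 1) =
            counit (R := k) (hom G (antipode k p * (TensorProduct.lid k H (counit.rTensor H Q)))) := by
          intro Q
          induction Q with
          | zero => simp
          | add s s' hs ht => simp only [TensorProduct.tmul_add, map_add, LinearMap.add_apply, mul_add, hs, ht]
          | tmul q r => simp [actE_apply]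
        simp [this]
    simp only [counit_eq, hom_one_mul, comul₃, LinearMap.comp_apply, h3,
      mul_antipode_rTensor_comul_apply, Algebra.algebraMap_eq_smul_one, map_smul, smul_eq_mul]
  induction F using induction_on with
  | zero => simp
  | add F F' hF hF' => simp only [add_mul, map_add, hF, hF']
  | tmul a h =>
    rw [tmul_eq, mul_assoc, h1, h2, h1, counit_eq (tmul 1 h), hom_tmul]
    simp [mul_assoc]

instance : Bialgebra k (DrinfeldDouble k H) :=
  Bialgebra.mk' k (DrinfeldDouble k H)
    (by rw [counit_eq, hom_one]; simp)
    (fun {F G} => counit_mul F G)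
    (by
      apply hom₂_injective
      ext x y
      simp [hom₂_comul, hom_one, Algebra.TensorProduct.one_def, hom₂_tmul,
        TensorProduct.smul_tmul', smul_smul, TensorProduct.tmul_smul, mul_comm])
    (fun {F G} => comul_mul F G)

end DrinfeldDouble

end DoubleBialgebra

section Quasitriangular

variable (k H : Type*) [Field k] [Ring H] [HopfAlgebra k H]

/-- `x ⊗ y ↦ x ⊗ y ⊗ 1`. -/
def leg₁₂ : H ⊗[k] H →ₐ[k] (H ⊗[k] H) ⊗[k] H := Algebra.TensorProduct.includeLeft

/-- `x ⊗ y ↦ x ⊗ 1 ⊗ y`. -/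
def leg₁₃ : H ⊗[k] H →ₐ[k] (H ⊗[k] H) ⊗[k] H :=
  Algebra.TensorProduct.map Algebra.TensorProduct.includeLeft (AlgHom.id k H)

/-- `x ⊗ y ↦ 1 ⊗ x ⊗ y`. -/
def leg₂₃ : H ⊗[k] H →ₐ[k] (H ⊗[k] H) ⊗[k] H :=
  Algebra.TensorProduct.map Algebra.TensorProduct.includeRight (AlgHom.id k H)

/-- `x ⊗ y ↦ y ⊗ 1 ⊗ x`. -/
def leg₃₁ : H ⊗[k] H →ₐ[k] (H ⊗[k] H) ⊗[k] H :=
  (leg₁₃ k H).comp (Algebra.TensorProduct.comm k H H).toAlgHom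

/-- A quasitriangular structure on `H`: an invertible `R` in `H ⊗ H` with `(Δ ⊗ id) R = R₁₃ R₂₃`,
`(id ⊗ Δ) R = R₁₃ R₁₂` and `Δᵒᵖ h = R (Δ h) R⁻¹`. -/
class Quasitriangular (k H : Type*) [Field k] [Ring H] [HopfAlgebra k H] where
  /-- The universal R-matrix. -/
  R (k H) : (H ⊗[k] H)ˣ
  /-- `(Δ ⊗ id) R = R₁₃ R₂₃` -/
  comul_left : TensorProduct.map comul LinearMap.id (R : H ⊗[k] H) = leg₁₃ k H R * leg₂₃ k H R
  /-- `(id ⊗ Δ) R = R₁₃ R₁₂` -/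
  comul_right : (TensorProduct.assoc k H H H).symm (TensorProduct.map LinearMap.id comul
    (R : H ⊗[k] H)) = leg₁₃ k H R * leg₁₂ k H R
  /-- `Δᵒᵖ h = R (Δ h) R⁻¹` -/
  comul_op : ∀ h : H, TensorProduct.comm k H H (comul h) * R = R * comul (R := k) h

namespace Quasitriangular

variable [Quasitriangular k H]

lemma map_counit_left : Algebra.TensorProduct.map (Bialgebra.counitAlgHom k H) (AlgHom.id k H)
     (R k H : H ⊗[k] H) = 1 := by
  let π : (H ⊗[k] H) ⊗[k] H →ₐ[k] H ⊗[k] H :=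
    Algebra.TensorProduct.map ((Algebra.TensorProduct.lid k H).toAlgHom.comp
      (Algebra.TensorProduct.map (Bialgebra.counitAlgHom k H) (AlgHom.id k H))) (AlgHom.id k H)
  have h := congr(π $(comul_left (k := k) (H := H)))
  have h1 : ∀ t : H ⊗[k] H, π (TensorProduct.map comul LinearMap.id t) = t := by
    intro t
    induction t with
    | zero => simp
    | add s s' hs ht => simp only [map_add, hs, ht]
    | tmul x y =>
      have h2 : TensorProduct.lid k H (counit.rTensor H (comul (R := k) x)) = x := by simp
      have h3 : ∀ X : H ⊗[k] H, π (X ⊗ₜ[k] y) = TensorProduct.lid k H (counit.rTensor H X) ⊗ₜ y := by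
        intro X
        rfl
      rw [TensorProduct.map_tmul, LinearMap.id_apply, h3, h2]
  have h2 : π (leg₂₃ k H (R k H)) = R k H := by
    have : π.comp (leg₂₃ k H) = AlgHom.id k _ := by
      ext x <;> simp [π, leg₂₃]
    exact AlgHom.congr_fun this _
  rw [h1, map_mul, h2] at h
  have h4 : π (leg₁₃ k H (R k H)) = 1 := by
    have := congr($h * (((R k H)⁻¹ : (H ⊗[k] H)ˣ) : H ⊗[k] H))
    rw [mul_assoc, Units.mul_inv, mul_one] at this
    exact this.symm
  let κ : k ⊗[k] H →ₐ[k] H ⊗[k] H := Algebra.TensorProduct.map (Algebra.ofId k H) (AlgHom.id k H)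
  let e : H ⊗[k] H →ₐ[k] k ⊗[k] H :=
    Algebra.TensorProduct.map (Bialgebra.counitAlgHom k H) (AlgHom.id k H)
  let d : H ⊗[k] H →ₐ[k] k ⊗[k] H :=
    Algebra.TensorProduct.map (Bialgebra.counitAlgHom k H) (AlgHom.id k H)
  have h5 : e.comp (π.comp (leg₁₃ k H)) = e := by
    ext x
    · simp [e, π, leg₁₃, Algebra.algebraMap_eq_smul_one]
    · simp [e, π, leg₁₃]
  have h6 := AlgHom.congr_fun h5 (R k H : H ⊗[k] H)
  rw [AlgHom.comp_apply, AlgHom.comp_apply, h4, map_one] at h6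
  exact h6.symm

lemma map_counit_right : Algebra.TensorProduct.map (AlgHom.id k H) (Bialgebra.counitAlgHom k H)
     (R k H : H ⊗[k] H) = 1 := by
  let π : (H ⊗[k] H) ⊗[k] H →ₐ[k] H ⊗[k] H :=
    (Algebra.TensorProduct.rid k k (H ⊗[k] H)).toAlgHom.comp
      (Algebra.TensorProduct.map (AlgHom.id k (H ⊗[k] H)) (Bialgebra.counitAlgHom k H))
  have h := congr(π $(comul_right (k := k) (H := H)))
  have h1 : ∀ t : H ⊗[k] H,
      π ((TensorProduct.assoc k H H H).symm (TensorProduct.map LinearMap.id comul t)) = t := by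
    intro t
    induction t with
    | zero => simp
    | add s s' hs ht => simp only [map_add, hs, ht]
    | tmul x y =>
      have h2 : TensorProduct.rid k H (counit.lTensor H (comul (R := k) y)) = y := by simp
      have h3 : ∀ X : H ⊗[k] H, π ((TensorProduct.assoc k H H H).symm (x ⊗ₜ[k] X)) =
          x ⊗ₜ TensorProduct.rid k H (counit.lTensor H X) := by
        intro X
        induction X with
        | zero => simp
        | add s s' hs ht => simp only [map_add, TensorProduct.tmul_add, hs, ht]
        | tmul y z => simp [π]
      rw [TensorProduct.map_tmul, LinearMap.id_apply, h3, h2]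
  have h2 : π (leg₁₂ k H (R k H)) = R k H := by
    have : π.comp (leg₁₂ k H) = AlgHom.id k _ := by
      ext x <;> simp [π, leg₁₂]
    exact AlgHom.congr_fun this _
  rw [h1, map_mul, h2] at h
  have h4 : π (leg₁₃ k H (R k H)) = 1 := by
    have := congr($h * (((R k H)⁻¹ : (H ⊗[k] H)ˣ) : H ⊗[k] H))
    rw [mul_assoc, Units.mul_inv, mul_one] at this
    exact this.symm
  let e : H ⊗[k] H →ₐ[k] H ⊗[k] k :=
    Algebra.TensorProduct.map (AlgHom.id k H) (Bialgebra.counitAlgHom k H)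
  have h5 : e.comp (π.comp (leg₁₃ k H)) = e := by
    ext x
    · simp [e, π, leg₁₃]
    · simp [e, π, leg₁₃]
      rw [← TensorProduct.tmul_smul, smul_eq_mul, mul_one]
  have h6 := AlgHom.congr_fun h5 (R k H : H ⊗[k] H)
  rw [AlgHom.comp_apply, AlgHom.comp_apply, h4, map_one] at h6
  exact h6.symm

/-- `(S ⊗ id) R = R⁻¹`. -/
lemma antipode_left : (antipode k).rTensor H (R k H : H ⊗[k] H) = ((R k H)⁻¹ : (H ⊗[k] H)ˣ) := by
  let π : (H ⊗[k] H) ⊗[k] H →ₗ[k] H ⊗[k] H :=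
    LinearMap.rTensor H (LinearMap.mul' k H ∘ₗ (antipode k).rTensor H)
  have h := congr(π $(comul_left (k := k) (H := H)))
  have h1 : ∀ t : H ⊗[k] H, π (TensorProduct.map comul LinearMap.id t) =
      LinearMap.rTensor H (Algebra.linearMap k H) (Algebra.TensorProduct.map
        (Bialgebra.counitAlgHom k H) (AlgHom.id k H) t) := by
    intro t
    induction t with
    | zero => simp
    | add s s' hs ht => simp only [map_add, hs, ht]
    | tmul x y => simp [π]
  have h2 : ∀ s t : H ⊗[k] H, π (leg₁₃ k H s * leg₂₃ k H t) = (antipode k).rTensor H s * t := by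
    intro s t
    induction s with
    | zero => simp
    | add s s' hs ht => simp only [map_add, add_mul, hs, ht]
    | tmul x y =>
      induction t with
      | zero => simp
      | add s s' hs ht => simp only [map_add, mul_add, hs, ht]
      | tmul x' y' => simp [π, leg₁₃, leg₂₃]
  rw [h1, h2, map_counit_left] at h
  rw [Algebra.TensorProduct.one_def, LinearMap.rTensor_tmul] at h
  refine Units.eq_inv_of_mul_eq_one_right ?_
  rw [← h]
  simp [Algebra.TensorProduct.one_def]

/-- `(id ⊗ S) R⁻¹ = R`. -/
lemma antipode_right : (antipode k).lTensor H (((R k H)⁻¹ : (H ⊗[k] H)ˣ) : H ⊗[k] H) = R k H := by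
  let Δ₂ : H ⊗[k] H →ₐ[k] (H ⊗[k] H) ⊗[k] H :=
    (Algebra.TensorProduct.assoc k k k H H H).symm.toAlgHom.comp
      (Algebra.TensorProduct.map (AlgHom.id k H) (Bialgebra.comulAlgHom k H))
  have h0 : Δ₂ (R k H) = leg₁₃ k H (R k H) * leg₁₂ k H (R k H) := comul_right
  have h : Δ₂ (((R k H)⁻¹ : (H ⊗[k] H)ˣ) : H ⊗[k] H) =
      leg₁₂ k H ((R k H)⁻¹ : (H ⊗[k] H)ˣ) * leg₁₃ k H ((R k H)⁻¹ : (H ⊗[k] H)ˣ) := by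
    have hu : Units.map Δ₂.toMonoidHom (R k H) =
        Units.map (leg₁₃ k H).toMonoidHom (R k H) * Units.map (leg₁₂ k H).toMonoidHom (R k H) :=
      Units.ext h0
    have := congr((($hu)⁻¹ : ((H ⊗[k] H) ⊗[k] H)ˣ))
    rw [mul_inv_rev, ← map_inv, ← map_inv, ← map_inv] at this
    exact congr(($this : (H ⊗[k] H) ⊗[k] H))
  let π : (H ⊗[k] H) ⊗[k] H →ₗ[k] H ⊗[k] H :=
    LinearMap.lTensor H (LinearMap.mul' k H ∘ₗ (antipode k).lTensor H) ∘ₗ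
      (TensorProduct.assoc k H H H).toLinearMap
  replace h := congr(π $h)
  have h1 : ∀ t : H ⊗[k] H, π (Δ₂ t) =
      LinearMap.lTensor H (Algebra.linearMap k H) (Algebra.TensorProduct.map
        (AlgHom.id k H) (Bialgebra.counitAlgHom k H) t) := by
    intro t
    have : ∀ t, Δ₂ t = (TensorProduct.assoc k H H H).symm (LinearMap.lTensor H comul t) := fun _ => rfl
    rw [this]
    simp only [π, LinearMap.comp_apply, LinearEquiv.coe_coe, LinearEquiv.apply_symm_apply]
    induction t with
    | zero => simp
    | add s s' hs ht => simp only [map_add, hs, ht]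
    | tmul x y => simp
  have h2 : ∀ s t : H ⊗[k] H, π (leg₁₂ k H s * leg₁₃ k H t) = s * (antipode k).lTensor H t := by
    intro s t
    induction s with
    | zero => simp
    | add s s' hs ht => simp only [map_add, add_mul, hs, ht]
    | tmul x y =>
      induction t with
      | zero => simp
      | add s s' hs ht => simp only [map_add, mul_add, hs, ht]
      | tmul x' y' => simp [π, leg₁₃, leg₁₂]
  have h3 : Algebra.TensorProduct.map (AlgHom.id k H) (Bialgebra.counitAlgHom k H)
     (((R k H)⁻¹ : (H ⊗[k] H)ˣ) : H ⊗[k] H) = 1 := by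
    have := congr(Algebra.TensorProduct.map (AlgHom.id k H) (Bialgebra.counitAlgHom k H)
      $(Units.mul_inv (R k H)))
    rwa [map_mul, map_counit_right, one_mul, map_one] at this
  rw [h1, h2, h3] at h
  rw [Algebra.TensorProduct.one_def, LinearMap.lTensor_tmul] at h
  have h4 := congr((R k H : H ⊗[k] H) * $h)
  rw [← mul_assoc, Units.mul_inv, one_mul] at h4
  rw [← h4]
  simp [← Algebra.TensorProduct.one_def]

/-- `(S ⊗ S) R = R`. -/
lemma antipode_antipode :
    TensorProduct.map (antipode k) (antipode k) (R k H : H ⊗[k] H) = R k H := by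
  rw [← LinearMap.lTensor_comp_rTensor, LinearMap.comp_apply, antipode_left, antipode_right]

/-- `u = S(R⁽²⁾) R⁽¹⁾`. -/
def u : H := LinearMap.mul' k H ((antipode k).rTensor H (TensorProduct.comm k H H (R k H)))

/-- `R⁽²⁾ S²(R⁽¹⁾)`. -/
def uInv : H := LinearMap.mul' k H ((antipode k ∘ₗ antipode k).lTensor H
  (TensorProduct.comm k H H (R k H)))

lemma u_mul (h : H) : u k H * h = antipode k (antipode k h) * u k H := by
  let Φ : (H ⊗[k] H) ⊗[k] H →ₗ[k] H := LinearMap.mul' k H ∘ₗ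
    TensorProduct.map (antipode k) (LinearMap.id) ∘ₗ
    (LinearMap.rTensor H (LinearMap.mul' k H ∘ₗ (antipode k).lTensor H)) ∘ₗ
    (TensorProduct.assoc k H H H).symm.toLinearMap ∘ₗ
    LinearMap.lTensor H ((TensorProduct.comm k H H).toLinearMap) ∘ₗ
    (TensorProduct.leftComm k H H H).toLinearMap ∘ₗ (TensorProduct.assoc k H H H).toLinearMap
  have hΦ : ∀ x y z : H, Φ ((x ⊗ₜ y) ⊗ₜ z) = antipode k (y * antipode k z) * x := by
    intro x y z; simp [Φ]
  have h0 : ∀ t : H ⊗[k] H, Φ (LinearMap.rTensor H (LinearMap.mulLeft k (R k H : H ⊗[k] H) ∘ₗ comul) t) =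
     Φ (LinearMap.rTensor H (LinearMap.mulRight k (R k H : H ⊗[k] H) ∘ₗ
      (TensorProduct.comm k H H).toLinearMap ∘ₗ comul) t) := by
    intro t
    congr 2
    congr 1
    ext x
    simp [comul_op]
  have h1 : ∀ r : H ⊗[k] H, Φ (LinearMap.rTensor H (LinearMap.mulLeft k r)
      (comul.rTensor H (comul (R := k) h))) =
      LinearMap.mul' k H ((antipode k).rTensor H (TensorProduct.comm k H H r)) * h := by
    intro r
    rw [← Coalgebra.coassoc_symm_apply]
    induction r with
    | zero => simp
    | add s s' hs ht =>
      rw [show LinearMap.mulLeft k (s + s') = LinearMap.mulLeft k s + LinearMap.mulLeft k s' by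
        ext; simp [add_mul]]
      simp only [LinearMap.rTensor_add, LinearMap.add_apply, map_add, hs, ht, add_mul]
    | tmul x y =>
      have h2 : ∀ t : H ⊗[k] H, Φ (LinearMap.rTensor H (LinearMap.mulLeft k (x ⊗ₜ[k] y))
         ((TensorProduct.assoc k H H H).symm (comul.lTensor H t))) =
         antipode k y * x * (TensorProduct.rid k H (counit.lTensor H t)) := by
        intro t
        induction t with
        | zero => simp
        | add s s' hs ht => simp only [map_add, mul_add, hs, ht]
        | tmul p q =>
          have h3 : ∀ Q : H ⊗[k] H, Φ (LinearMap.rTensor H (LinearMap.mulLeft k (x ⊗ₜ[k] y))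
             ((TensorProduct.assoc k H H H).symm (p ⊗ₜ[k] Q))) =
             antipode k (y * LinearMap.mul' k H ((antipode k).lTensor H Q)) * x * p := by
            intro Q
            induction Q with
            | zero => simp
            | add s s' hs ht => simp only [TensorProduct.tmul_add, map_add, mul_add, add_mul, hs, ht]
            | tmul p q => simp [hΦ, mul_assoc]
          rw [LinearMap.lTensor_tmul, h3, mul_antipode_lTensor_comul_apply]
          simp [Algebra.algebraMap_eq_smul_one]
      rw [h2]
      simp
  have h1' : ∀ r : H ⊗[k] H, Φ (LinearMap.rTensor H (LinearMap.mulRight k r)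
      (LinearMap.rTensor H (TensorProduct.comm k H H).toLinearMap
      (comul.rTensor H (comul (R := k) h)))) =
      antipode k (antipode k h) *
        LinearMap.mul' k H ((antipode k).rTensor H (TensorProduct.comm k H H r)) := by
    intro r
    induction r with
    | zero => simp
    | add s s' hs ht =>
      rw [show LinearMap.mulRight k (s + s') = LinearMap.mulRight k s + LinearMap.mulRight k s' by
        ext; simp [mul_add]]
      simp only [LinearMap.rTensor_add, LinearMap.add_apply, map_add, hs, ht, mul_add]
    | tmul x y =>
      have h2 : ∀ t : H ⊗[k] H, Φ (LinearMap.rTensor H (LinearMap.mulRight k (x ⊗ₜ[k] y))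
         (LinearMap.rTensor H (TensorProduct.comm k H H).toLinearMap (comul.rTensor H t))) =
         antipode k (antipode k (TensorProduct.lid k H (counit.rTensor H t))) * (antipode k y * x) := by
        intro t
        induction t with
        | zero => simp
        | add s s' hs ht => simp only [map_add, add_mul, hs, ht]
        | tmul p q =>
          have h3 : ∀ Q : H ⊗[k] H, Φ (LinearMap.rTensor H (LinearMap.mulRight k (x ⊗ₜ[k] y))
             (LinearMap.rTensor H (TensorProduct.comm k H H).toLinearMap (Q ⊗ₜ[k] q))) =
             antipode k (antipode k q) * antipode k y *
              (LinearMap.mul' k H ((antipode k).rTensor H Q)) * x := by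
            intro Q
            induction Q with
            | zero => simp
            | add s s' hs ht => simp only [TensorProduct.add_tmul, map_add, mul_add, add_mul, hs, ht]
            | tmul p q => simp [hΦ, mul_assoc, antipode_mul_antidistrib]
          rw [LinearMap.rTensor_tmul, h3, mul_antipode_rTensor_comul_apply]
          simp [Algebra.algebraMap_eq_smul_one, mul_assoc]
      rw [h2]
      simp
  rw [u, ← h1, ← h1']
  have := h0 (comul h)
  simpa only [LinearMap.rTensor_comp, LinearMap.comp_apply] using this

lemma u_mul_uInv : u k H * uInv k H = 1 := by
  have h1 : ∀ t : H ⊗[k] H, u k H * LinearMap.mul' k H ((antipode k ∘ₗ antipode k).lTensor H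
     (TensorProduct.comm k H H t)) =
     LinearMap.mul' k H (LinearMap.lTensor H (LinearMap.mulLeft k (u k H))
     (TensorProduct.map (antipode k) (antipode k) (TensorProduct.comm k H H
      (TensorProduct.map (antipode k) (antipode k) t)))) := by
    intro t
    induction t with
    | zero => simp
    | add s s' hs ht => simp only [map_add, mul_add, hs, ht]
    | tmul p q => simp [← mul_assoc, u_mul k H q]
  rw [uInv, h1, antipode_antipode, u]
  have h2 : ∀ s t : H ⊗[k] H,
      LinearMap.mul' k H (LinearMap.lTensor H (LinearMap.mulLeft k
        (LinearMap.mul' k H ((antipode k).rTensor H (TensorProduct.comm k H H s))))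
        (TensorProduct.map (antipode k) (antipode k) (TensorProduct.comm k H H t))) =
      LinearMap.mul' k H ((antipode k).rTensor H (TensorProduct.comm k H H
        (s * (antipode k).rTensor H t))) := by
    intro s t
    induction t with
    | zero => simp
    | add t t' hs ht => simp only [map_add, mul_add, hs, ht]
    | tmul p q =>
      induction s with
      | zero => simp
      | add s s' hs ht =>
        rw [map_add, map_add, map_add, add_mul, map_add, map_add, map_add, ← hs, ← ht]
        simp [add_mul, mul_add]
      | tmul x y => simp [mul_assoc, antipode_mul_antidistrib]
  rw [h2, antipode_left, Units.mul_inv]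
  simp [Algebra.TensorProduct.one_def]

lemma uInv_mul_u [FiniteDimensional k H] : uInv k H * u k H = 1 := by
  have h1 : LinearMap.mulLeft k (u k H) * LinearMap.mulLeft k (uInv k H) = 1 := by
    ext x
    simp [← mul_assoc, u_mul_uInv]
  have h2 := LinearMap.congr_fun (mul_eq_one_comm.mp h1) 1
  simpa using h2

/-- The inverse of the antipode -/
def antipodeInv : H →ₗ[k] H :=
  LinearMap.mulRight k (u k H) ∘ₗ LinearMap.mulLeft k (uInv k H) ∘ₗ antipode k

lemma antipodeInv_apply (h : H) : antipodeInv k H h = uInv k H * antipode k h * u k H := rfl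

variable [FiniteDimensional k H]

lemma antipodeInv_left (h : H) : LinearMap.mul' k H ((antipodeInv k H).rTensor H
    (TensorProduct.comm k H H (comul h))) = algebraMap k H (counit h) := by
  have : ∀ t : H ⊗[k] H, LinearMap.mul' k H ((antipodeInv k H).rTensor H
      (TensorProduct.comm k H H t)) = uInv k H *
      antipode k (LinearMap.mul' k H ((antipode k).rTensor H t)) * u k H := by
    intro t
    induction t with
    | zero => simp
    | add t t' hs ht => simp only [map_add, mul_add, add_mul, hs, ht]
    | tmul p q => simp [antipodeInv_apply, antipode_mul_antidistrib, mul_assoc, u_mul]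
  rw [this]
  simp [Algebra.algebraMap_eq_smul_one, uInv_mul_u]

lemma antipodeInv_right (h : H) : LinearMap.mul' k H ((antipodeInv k H).lTensor H
    (TensorProduct.comm k H H (comul h))) = algebraMap k H (counit h) := by
  have h2 : ∀ x, x * uInv k H = uInv k H * antipode k (antipode k x) := by
    intro x
    calc x * uInv k H = (uInv k H * u k H) * x * uInv k H := by rw [uInv_mul_u, one_mul]
      _ = uInv k H * (u k H * x) * uInv k H := by simp only [mul_assoc]
      _ = _ := by rw [u_mul]; simp only [mul_assoc, u_mul_uInv, mul_one]
  have : ∀ t : H ⊗[k] H, LinearMap.mul' k H ((antipodeInv k H).lTensor H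
      (TensorProduct.comm k H H t)) = uInv k H *
      antipode k (LinearMap.mul' k H ((antipode k).lTensor H t)) * u k H := by
    intro t
    induction t with
    | zero => simp
    | add t t' hs ht => simp only [map_add, mul_add, add_mul, hs, ht]
    | tmul p q =>
      simp [antipodeInv_apply, antipode_mul_antidistrib, ← mul_assoc, h2]
  rw [this]
  simp [Algebra.algebraMap_eq_smul_one, uInv_mul_u]

end Quasitriangular

end Quasitriangular

section DoubleHopf

variable {k H : Type*} [Field k] [Ring H] [HopfAlgebra k H]

namespace DrinfeldDouble

open Quasitriangular

variable [FiniteDimensional k H]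

lemma tmul_one_mul_tmul_one (a b : HDual k H) :
    (tmul a 1 * tmul b 1 : DrinfeldDouble k H) = tmul (b * a) 1 := by
  have h1 : cross k H (1 ⊗ₜ[k] b) = b ⊗ₜ[k] 1 := by
    rw [cross_tmul, comul₃_one, Algebra.TensorProduct.one_def, Algebra.TensorProduct.one_def,
      crossAux_tmul]
    congr 1
    ext x
    simp [sandwich_apply]
  rw [tmul_mul_tmul, h1]
  simp
  rfl

lemma one_tmul_mul_one_tmul (h g : H) :
    (tmul 1 h * tmul 1 g : DrinfeldDouble k H) = tmul 1 (h * g) := by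
  rw [tmul_mul_tmul, cross_one_right]
  simp
  rfl

variable [Quasitriangular k H]

def inlDual : HDual k H →ₗ[k] DrinfeldDouble k H := (equiv k H).symm.toLinearMap ∘ₗ
    (TensorProduct.mk k (HDual k H) H).flip 1

def inrH : H →ₗ[k] DrinfeldDouble k H := (equiv k H).symm.toLinearMap ∘ₗ
    (TensorProduct.mk k (HDual k H) H) 1

lemma inlDual_apply (a : HDual k H) : inlDual a = tmul a 1 := rfl
lemma inrH_apply (h : H) : inrH h = tmul (1 : HDual k H) h := rfl

/-- `a ↦ a ∘ S⁻¹`. -/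
def dualAntipodeInv : HDual k H →ₗ[k] HDual k H :=
  (WithConv.linearEquiv k (H →ₗ[k] k)).symm.toLinearMap ∘ₗ
    (antipodeInv k H).dualMap ∘ₗ (WithConv.linearEquiv k (H →ₗ[k] k)).toLinearMap

lemma dualAntipodeInv_apply (a : HDual k H) (x : H) :
  dualAntipodeInv a x = a (antipodeInv k H x) := rfl

/-- `S(a ⊗ h) = (1 ⊗ S h)(a ∘ S⁻¹ ⊗ 1)`. -/
def antipodeMap : DrinfeldDouble k H →ₗ[k] DrinfeldDouble k H :=
  LinearMap.mul' k (DrinfeldDouble k H) ∘ₗ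
    TensorProduct.map (inrH ∘ₗ antipode k) (inlDual ∘ₗ dualAntipodeInv) ∘ₗ
    (TensorProduct.comm k (HDual k H) H).toLinearMap ∘ₗ (equiv k H).toLinearMap

lemma antipodeMap_tmul (a : HDual k H) (h : H) :
    antipodeMap (tmul a h) = tmul 1 (antipode k h) * tmul (dualAntipodeInv a) 1 := by
  have : equiv k H (tmul a h) = a ⊗ₜ[k] h := rfl
  simp [antipodeMap, this, inlDual_apply, inrH_apply]

lemma dualDistrib_comul (f g : H →ₗ[k] H) (a : HDual k H) (X : H ⊗[k] H) :
    TensorProduct.dualDistrib k H H (TensorProduct.map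
      (f.dualMap ∘ₗ (WithConv.linearEquiv k (H →ₗ[k] k)).toLinearMap)
      (g.dualMap ∘ₗ (WithConv.linearEquiv k (H →ₗ[k] k)).toLinearMap)
      (TensorProduct.comm k _ _ (comul (R := k) a))) X =
    a (LinearMap.mul' k H (TensorProduct.map g f (TensorProduct.comm k H H X))) := by
  induction X with
  | zero => simp
  | add X Y hX hY => simp only [map_add, hX, hY]
  | tmul p q =>
    have h1 : ∀ s : HDual k H ⊗[k] HDual k H, TensorProduct.dualDistrib k H H (TensorProduct.map
      (f.dualMap ∘ₗ (WithConv.linearEquiv k (H →ₗ[k] k)).toLinearMap)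
      (g.dualMap ∘ₗ (WithConv.linearEquiv k (H →ₗ[k] k)).toLinearMap)
      (TensorProduct.comm k _ _ s)) (p ⊗ₜ[k] q) = evalLeft (g q) s (f p) := by
      intro s
      induction s with
      | zero => simp
      | add X Y hX hY => simp only [map_add, LinearMap.add_apply, WithConv.ofConv_add, hX, hY]
      | tmul b c => simp [mul_comm]
    rw [h1, evalLeft_comul]
    simp

lemma dual_left (a : HDual k H) : LinearMap.mul' k (DrinfeldDouble k H)
    (TensorProduct.map (inlDual ∘ₗ dualAntipodeInv) inlDual (comul (R := k) a)) = a 1 • 1 := by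
  apply hom_injective
  ext x
  rw [map_smul, LinearMap.smul_apply, hom_one]
  have h1 : ∀ s : HDual k H ⊗[k] HDual k H, hom (LinearMap.mul' k (DrinfeldDouble k H)
      (TensorProduct.map (inlDual ∘ₗ dualAntipodeInv) inlDual s)) x =
      TensorProduct.dualDistrib k H H (TensorProduct.map
      ((LinearMap.id : H →ₗ[k] H).dualMap ∘ₗ (WithConv.linearEquiv k (H →ₗ[k] k)).toLinearMap)
      ((antipodeInv k H).dualMap ∘ₗ (WithConv.linearEquiv k (H →ₗ[k] k)).toLinearMap)
      (TensorProduct.comm k _ _ s)) (comul x) • 1 := by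
    intro s
    induction s with
    | zero => simp
    | add X Y hX hY => simp only [map_add, LinearMap.add_apply, hX, hY, add_smul]
    | tmul b c =>
      simp only [TensorProduct.map_tmul, LinearMap.comp_apply, inlDual_apply, LinearMap.mul'_apply,
        tmul_one_mul_tmul_one, hom_tmul, TensorProduct.comm_tmul, LinearMap.convMul_apply]
      rfl
  have h2 := antipodeInv_left k H x
  rw [h1, dualDistrib_comul, ← LinearMap.rTensor_def, h2, Algebra.algebraMap_eq_smul_one]
  simp [smul_smul, mul_comm]

lemma dual_right (a : HDual k H) : LinearMap.mul' k (DrinfeldDouble k H)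
    (TensorProduct.map inlDual (inlDual ∘ₗ dualAntipodeInv) (comul (R := k) a)) = a 1 • 1 := by
  apply hom_injective
  ext x
  rw [map_smul, LinearMap.smul_apply, hom_one]
  have h1 : ∀ s : HDual k H ⊗[k] HDual k H, hom (LinearMap.mul' k (DrinfeldDouble k H)
      (TensorProduct.map inlDual (inlDual ∘ₗ dualAntipodeInv) s)) x =
      TensorProduct.dualDistrib k H H (TensorProduct.map
      ((antipodeInv k H).dualMap ∘ₗ (WithConv.linearEquiv k (H →ₗ[k] k)).toLinearMap)
      ((LinearMap.id : H →ₗ[k] H).dualMap ∘ₗ (WithConv.linearEquiv k (H →ₗ[k] k)).toLinearMap)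
      (TensorProduct.comm k _ _ s)) (comul x) • 1 := by
    intro s
    induction s with
    | zero => simp
    | add X Y hX hY => simp only [map_add, LinearMap.add_apply, hX, hY, add_smul]
    | tmul b c =>
      simp only [TensorProduct.map_tmul, LinearMap.comp_apply, inlDual_apply, LinearMap.mul'_apply,
        tmul_one_mul_tmul_one, hom_tmul, TensorProduct.comm_tmul, LinearMap.convMul_apply]
      rfl
  have h2 := antipodeInv_right k H x
  rw [h1, dualDistrib_comul, ← LinearMap.lTensor_def, h2, Algebra.algebraMap_eq_smul_one]
  simp [smul_smul, mul_comm]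

lemma comul_tmul (a : HDual k H) (h : H) : comul (R := k) (tmul a h) =
    TensorProduct.map (equiv k H).symm.toLinearMap (equiv k H).symm.toLinearMap
      (TensorProduct.AlgebraTensorModule.tensorTensorTensorComm k k k k
        (HDual k H) (HDual k H) H H (comul a ⊗ₜ comul h)) := by
  rw [comul_eq]
  exact congrArg _ (TensorProduct.comul_tmul (R := k) (S := k) a h)

lemma counit_tmul (a : HDual k H) (h : H) : counit (R := k) (tmul a h) = a 1 * counit (R := k) h := by
  rw [counit_eq, hom_tmul, map_smul, smul_eq_mul]

lemma antipode_left (F : DrinfeldDouble k H) : LinearMap.mul' k (DrinfeldDouble k H)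
    (antipodeMap.rTensor _ (comul (R := k) F)) = counit (R := k) F • 1 := by
  induction F using induction_on with
  | zero => simp
  | add F G hF hG => simp only [map_add, add_smul, hF, hG]
  | tmul a h =>
    have h1 : ∀ (s : HDual k H ⊗[k] HDual k H) (t : H ⊗[k] H), LinearMap.mul' k (DrinfeldDouble k H)
        (antipodeMap.rTensor _ (TensorProduct.map (equiv k H).symm.toLinearMap (equiv k H).symm.toLinearMap
        (TensorProduct.AlgebraTensorModule.tensorTensorTensorComm k k k k
        (HDual k H) (HDual k H) H H (s ⊗ₜ t)))) =
        LinearMap.mul' k (DrinfeldDouble k H) (TensorProduct.map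
          (LinearMap.mulRight k (LinearMap.mul' k (DrinfeldDouble k H)
          (TensorProduct.map (inlDual ∘ₗ dualAntipodeInv) inlDual s)) ∘ₗ inrH ∘ₗ antipode k) inrH t) := by
      intro s t
      induction t with
      | zero => simp
      | add X Y hX hY => simp only [TensorProduct.tmul_add, map_add, hX, hY]
      | tmul g g' =>
        induction s with
        | zero => simp
        | add X Y hX hY =>
          simp only [TensorProduct.add_tmul, map_add, hX, hY]
          simp [mul_add, add_mul]
        | tmul b c =>
          have : (TensorProduct.map (equiv k H).symm.toLinearMap (equiv k H).symm.toLinearMap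
           (TensorProduct.AlgebraTensorModule.tensorTensorTensorComm k k k k
           (HDual k H) (HDual k H) H H ((b ⊗ₜ c) ⊗ₜ (g ⊗ₜ g')))) = tmul b g ⊗ₜ[k] tmul c g' := rfl
          rw [this]
          simp only [LinearMap.rTensor_tmul, antipodeMap_tmul, LinearMap.mul'_apply,
            TensorProduct.map_tmul, LinearMap.comp_apply, inlDual_apply, inrH_apply, LinearMap.mulRight_apply]
          rw [tmul_eq c g']
          simp only [mul_assoc]
    have h2 : ∀ t : H ⊗[k] H, LinearMap.mul' k (DrinfeldDouble k H) (TensorProduct.map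
          (LinearMap.mulRight k (a 1 • 1) ∘ₗ inrH ∘ₗ antipode k) inrH t) =
          a 1 • inrH (LinearMap.mul' k H ((antipode k).rTensor H t)) := by
      intro t
      induction t with
      | zero => simp
      | add X Y hX hY => simp only [map_add, smul_add, hX, hY]
      | tmul g g' =>
        simp [inrH_apply, one_tmul_mul_one_tmul]
    rw [comul_tmul, h1, dual_left, h2, mul_antipode_rTensor_comul_apply, counit_tmul,
      Algebra.algebraMap_eq_smul_one, map_smul, smul_smul]
    rfl

lemma antipode_right (F : DrinfeldDouble k H) : LinearMap.mul' k (DrinfeldDouble k H)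
    (antipodeMap.lTensor _ (comul (R := k) F)) = counit (R := k) F • 1 := by
  induction F using induction_on with
  | zero => simp
  | add F G hF hG => simp only [map_add, add_smul, hF, hG]
  | tmul a h =>
    have h1 : ∀ (s : HDual k H ⊗[k] HDual k H) (t : H ⊗[k] H), LinearMap.mul' k (DrinfeldDouble k H)
        (antipodeMap.lTensor _ (TensorProduct.map (equiv k H).symm.toLinearMap (equiv k H).symm.toLinearMap
        (TensorProduct.AlgebraTensorModule.tensorTensorTensorComm k k k k
        (HDual k H) (HDual k H) H H (s ⊗ₜ t)))) =
        LinearMap.mul' k (DrinfeldDouble k H) (TensorProduct.map inlDual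
          (LinearMap.mulLeft k (inrH (LinearMap.mul' k H ((antipode k).lTensor H t))) ∘ₗ
            inlDual ∘ₗ dualAntipodeInv) s) := by
      intro s t
      induction s with
      | zero => simp
      | add X Y hX hY => simp only [TensorProduct.add_tmul, map_add, hX, hY]
      | tmul b c =>
        induction t with
        | zero => simp
        | add X Y hX hY =>
          simp only [TensorProduct.tmul_add, map_add, hX, hY]
          simp [mul_add, add_mul]
        | tmul g g' =>
          have : (TensorProduct.map (equiv k H).symm.toLinearMap (equiv k H).symm.toLinearMap
           (TensorProduct.AlgebraTensorModule.tensorTensorTensorComm k k k k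
           (HDual k H) (HDual k H) H H ((b ⊗ₜ c) ⊗ₜ (g ⊗ₜ g')))) = tmul b g ⊗ₜ[k] tmul c g' := rfl
          rw [this]
          simp only [LinearMap.lTensor_tmul, antipodeMap_tmul, LinearMap.mul'_apply,
            TensorProduct.map_tmul, LinearMap.comp_apply, inlDual_apply, inrH_apply, LinearMap.mulLeft_apply]
          rw [tmul_eq b g, ← one_tmul_mul_one_tmul]
          simp only [mul_assoc]
    have h2 : (inrH (1 : H) : DrinfeldDouble k H) = 1 := rfl
    have h3 : ∀ s : HDual k H ⊗[k] HDual k H, LinearMap.mul' k (DrinfeldDouble k H) (TensorProduct.map inlDual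
          (LinearMap.mulLeft k (counit (R := k) h • 1) ∘ₗ inlDual ∘ₗ dualAntipodeInv) s) =
          counit (R := k) h • LinearMap.mul' k (DrinfeldDouble k H) (TensorProduct.map inlDual
          (inlDual ∘ₗ dualAntipodeInv) s) := by
      intro t
      induction t with
      | zero => simp
      | add X Y hX hY => simp only [map_add, smul_add, hX, hY]
      | tmul g g' => simp
    rw [comul_tmul, h1, mul_antipode_lTensor_comul_apply, Algebra.algebraMap_eq_smul_one, map_smul,
      h2, h3, dual_right, counit_tmul, smul_smul, mul_comm]

instance : HopfAlgebra k (DrinfeldDouble k H) where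
  antipode := antipodeMap
  mul_antipode_rTensor_comul := by
    ext1 F
    simp only [LinearMap.comp_apply, antipode_left, Algebra.linearMap_apply,
      Algebra.algebraMap_eq_smul_one]
  mul_antipode_lTensor_comul := by
    ext1 F
    simp only [LinearMap.comp_apply, antipode_right, Algebra.linearMap_apply,
      Algebra.algebraMap_eq_smul_one]

end DrinfeldDouble

end DoubleHopf

section Twist

variable {k A : Type*} [Field k] [Ring A]

/-- The coproduct of a bialgebra conjugated by a unit, `x ↦ F⁻¹ (Δ x) F`. -/
def twistComul [Bialgebra k A] (F : (A ⊗[k] A)ˣ) : A →ₐ[k] A ⊗[k] A :=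
  AlgHom.ofLinearMap
    (LinearMap.mulLeft k ((F⁻¹ : (A ⊗[k] A)ˣ) : A ⊗[k] A) ∘ₗ
      LinearMap.mulRight k (F : A ⊗[k] A) ∘ₗ comul)
    (by simp)
    (fun x y => by
      simp only [LinearMap.comp_apply, LinearMap.mulLeft_apply, LinearMap.mulRight_apply,
        Bialgebra.comul_mul, mul_assoc, Units.mul_inv_cancel_left])

lemma twistComul_apply [Bialgebra k A] (F : (A ⊗[k] A)ˣ) (x : A) :
    twistComul F x = ((F⁻¹ : (A ⊗[k] A)ˣ) : A ⊗[k] A) * (comul x * (F : A ⊗[k] A)) := rfl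

lemma twistComul_coassoc [Bialgebra k A] (F : (A ⊗[k] A)ˣ)
    (hF : Algebra.TensorProduct.assoc k k k A A A
        (Algebra.TensorProduct.map (Bialgebra.comulAlgHom k A) (AlgHom.id k A) (F : A ⊗[k] A) *
          Algebra.TensorProduct.includeLeft (S := k) (F : A ⊗[k] A)) =
      Algebra.TensorProduct.map (AlgHom.id k A) (Bialgebra.comulAlgHom k A) (F : A ⊗[k] A) *
        Algebra.TensorProduct.includeRight (F : A ⊗[k] A)) (x : A) :
    Algebra.TensorProduct.assoc k k k A A A
      (Algebra.TensorProduct.map (twistComul F) (AlgHom.id k A) (twistComul F x)) =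
    Algebra.TensorProduct.map (AlgHom.id k A) (twistComul F) (twistComul F x) := by
  let α := Algebra.TensorProduct.assoc k k k A A A
  let iL : A ⊗[k] A →ₐ[k] (A ⊗[k] A) ⊗[k] A := Algebra.TensorProduct.includeLeft
  let iR : A ⊗[k] A →ₐ[k] A ⊗[k] (A ⊗[k] A) := Algebra.TensorProduct.includeRight
  let dL : A ⊗[k] A →ₐ[k] (A ⊗[k] A) ⊗[k] A :=
    Algebra.TensorProduct.map (Bialgebra.comulAlgHom k A) (AlgHom.id k A)
  let dR : A ⊗[k] A →ₐ[k] A ⊗[k] (A ⊗[k] A) :=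
    Algebra.TensorProduct.map (AlgHom.id k A) (Bialgebra.comulAlgHom k A)
  let f : A ⊗[k] A := F
  let g : A ⊗[k] A := ((F⁻¹ : (A ⊗[k] A)ˣ) : A ⊗[k] A)
  have fg : f * g = 1 := F.mul_inv
  have gf : g * f = 1 := F.inv_mul
  have e1 : ∀ t : A ⊗[k] A, Algebra.TensorProduct.map (twistComul F) (AlgHom.id k A) t =
      iL g * (dL t * iL f) := by
    intro t
    induction t with
    | zero => simp
    | add s t hs ht => simp only [map_add, hs, ht, mul_add, add_mul]
    | tmul a b => simp [iL, dL, f, g, twistComul_apply]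
  have e2 : ∀ t : A ⊗[k] A, Algebra.TensorProduct.map (AlgHom.id k A) (twistComul F) t =
      iR g * (dR t * iR f) := by
    intro t
    induction t with
    | zero => simp
    | add s t hs ht => simp only [map_add, hs, ht, mul_add, add_mul]
    | tmul a b => simp [iR, dR, f, g, twistComul_apply]
  have e3 : α (dL (comul (R := k) x)) = dR (comul (R := k) x) :=
    Coalgebra.coassoc_apply x
  have hF' : α (dL f) * α (iL f) = dR f * iR f := by
    rw [← map_mul]; exact hF
  have hG : α (iL g) * α (dL g) = iR g * dR g := by
    have h1 : (α (iL g) * α (dL g)) * (α (dL f) * α (iL f)) = 1 := by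
      rw [← map_mul, ← map_mul, ← map_mul]
      have : iL g * dL g * (dL f * iL f) = 1 := by
        rw [mul_assoc, ← mul_assoc (dL g), ← map_mul, gf, map_one, one_mul, ← map_mul, gf, map_one]
      rw [this, map_one]
    have h2 : (dR f * iR f) * (iR g * dR g) = 1 := by
      rw [mul_assoc, ← mul_assoc (iR f), ← map_mul, fg, map_one, one_mul, ← map_mul, fg, map_one]
    rw [hF'] at h1
    exact left_inv_eq_right_inv h1 h2
  have h0 : twistComul F x = g * (comul x * f) := rfl
  rw [e1, e2, h0]
  change α _ = _
  simp only [map_mul]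
  rw [e3]
  calc α (iL g) * (α (dL g) * (dR (comul x) * α (dL f)) * α (iL f))
      = (α (iL g) * α (dL g)) * dR (comul x) * (α (dL f) * α (iL f)) := by
        simp only [mul_assoc]
    _ = iR g * (dR g * (dR (comul x) * dR f) * iR f) := by
        rw [hG, hF']; simp only [mul_assoc]

lemma twistComul_counit_left [Bialgebra k A] (F : (A ⊗[k] A)ˣ)
    (hF : Algebra.TensorProduct.map (Bialgebra.counitAlgHom k A) (AlgHom.id k A)
      (F : A ⊗[k] A) = 1) (x : A) :
    Algebra.TensorProduct.map (Bialgebra.counitAlgHom k A) (AlgHom.id k A) (twistComul F x) =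
      1 ⊗ₜ[k] x := by
  have hG : Algebra.TensorProduct.map (Bialgebra.counitAlgHom k A) (AlgHom.id k A)
      ((F⁻¹ : (A ⊗[k] A)ˣ) : A ⊗[k] A) = 1 := by
    have := congr(Algebra.TensorProduct.map (Bialgebra.counitAlgHom k A) (AlgHom.id k A)
      $(F.inv_mul))
    rwa [map_mul, hF, mul_one, map_one] at this
  rw [twistComul_apply, map_mul, map_mul, hF, hG, mul_one, one_mul]
  exact Coalgebra.rTensor_counit_comul x

lemma twistComul_counit_right [Bialgebra k A] (F : (A ⊗[k] A)ˣ)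
    (hF : Algebra.TensorProduct.map (AlgHom.id k A) (Bialgebra.counitAlgHom k A)
      (F : A ⊗[k] A) = 1) (x : A) :
    Algebra.TensorProduct.map (AlgHom.id k A) (Bialgebra.counitAlgHom k A) (twistComul F x) =
      x ⊗ₜ[k] 1 := by
  have hG : Algebra.TensorProduct.map (AlgHom.id k A) (Bialgebra.counitAlgHom k A)
      ((F⁻¹ : (A ⊗[k] A)ˣ) : A ⊗[k] A) = 1 := by
    have := congr(Algebra.TensorProduct.map (AlgHom.id k A) (Bialgebra.counitAlgHom k A)
      $(F.inv_mul))
    rwa [map_mul, hF, mul_one, map_one] at this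
  rw [twistComul_apply, map_mul, map_mul, hF, hG, mul_one, one_mul]
  exact Coalgebra.lTensor_counit_comul x

variable [HopfAlgebra k A]

/-- `x ↦ U (S x) U⁻¹`. -/
def twistAntipode (U : Aˣ) : A →ₗ[k] A :=
  LinearMap.mulLeft k (U : A) ∘ₗ LinearMap.mulRight k ((U⁻¹ : Aˣ) : A) ∘ₗ antipode k

lemma twistAntipode_apply (U : Aˣ) (x : A) :
    twistAntipode (k := k) U x = (U : A) * (antipode k x * ((U⁻¹ : Aˣ) : A)) := rfl

/-- `a ⊗ b ↦ S(a) V b` -/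
def innerLeft (V : A) : A ⊗[k] A →ₗ[k] A :=
  LinearMap.mul' k A ∘ₗ TensorProduct.map (antipode k) (LinearMap.mulLeft k V)

/-- `a ⊗ b ↦ a V S(b)` -/
def innerRight (V : A) : A ⊗[k] A →ₗ[k] A :=
  LinearMap.mul' k A ∘ₗ TensorProduct.map (LinearMap.mulRight k V) (antipode k)

lemma innerLeft_tmul (V a b : A) : innerLeft V (a ⊗ₜ[k] b) = antipode k a * (V * b) := by
  simp [innerLeft]

lemma innerRight_tmul (V a b : A) : innerRight V (a ⊗ₜ[k] b) = a * V * antipode k b := by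
  simp [innerRight]

lemma innerLeft_add (V W : A) (t : A ⊗[k] A) :
    innerLeft (V + W) t = innerLeft V t + innerLeft W t := by
  induction t with
  | zero => simp
  | add s t hs ht => simp only [map_add, hs, ht]; abel
  | tmul a b => simp [innerLeft_tmul, add_mul, mul_add]

lemma innerRight_add (V W : A) (t : A ⊗[k] A) :
    innerRight (V + W) t = innerRight V t + innerRight W t := by
  induction t with
  | zero => simp
  | add s t hs ht => simp only [map_add, hs, ht]; abel
  | tmul a b => simp [innerRight_tmul, add_mul, mul_add]

lemma innerLeft_zero (t : A ⊗[k] A) : innerLeft 0 t = 0 := by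
  have := innerLeft_add 0 0 t
  rwa [add_zero, left_eq_add] at this

lemma innerRight_zero (t : A ⊗[k] A) : innerRight 0 t = 0 := by
  have := innerRight_add 0 0 t
  rwa [add_zero, left_eq_add] at this

lemma innerLeft_smul (c : k) (t : A ⊗[k] A) : innerLeft (c • 1) t = c • innerLeft 1 t := by
  induction t with
  | zero => simp
  | add s t hs ht => simp only [map_add, hs, ht, smul_add]
  | tmul a b => simp [innerLeft_tmul]

lemma innerRight_smul (c : k) (t : A ⊗[k] A) : innerRight (c • 1) t = c • innerRight 1 t := by
  induction t with
  | zero => simp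
  | add s t hs ht => simp only [map_add, hs, ht, smul_add]
  | tmul a b => simp [innerRight_tmul]

lemma innerLeft_mul (V : A) (s t : A ⊗[k] A) :
    innerLeft V (s * t) = innerLeft (innerLeft V s) t := by
  induction s with
  | zero => simp [innerLeft_zero]
  | add s s' hs ht => simp only [add_mul, map_add, hs, ht, innerLeft_add]
  | tmul a b =>
    induction t with
    | zero => simp
    | add s s' hs ht => simp only [mul_add, map_add, hs, ht]
    | tmul c d => simp [innerLeft_tmul, antipode_mul_antidistrib, mul_assoc]

lemma innerRight_mul (V : A) (s t : A ⊗[k] A) :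
    innerRight V (s * t) = innerRight (innerRight V t) s := by
  induction t with
  | zero => simp [innerRight_zero]
  | add s s' hs ht => simp only [mul_add, map_add, hs, ht, innerRight_add]
  | tmul c d =>
    induction s with
    | zero => simp
    | add s s' hs ht => simp only [add_mul, map_add, hs, ht]
    | tmul a b => simp [innerRight_tmul, antipode_mul_antidistrib, mul_assoc]

lemma twistAntipode_left (F : (A ⊗[k] A)ˣ) (U : Aˣ)
    (h1 : innerLeft ((U⁻¹ : Aˣ) : A) ((F⁻¹ : (A ⊗[k] A)ˣ) : A ⊗[k] A) = 1)
    (h2 : innerLeft 1 (F : A ⊗[k] A) = ((U⁻¹ : Aˣ) : A)) (x : A) :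
    LinearMap.mul' k A ((twistAntipode U).rTensor A (twistComul F x)) =
      algebraMap k A (counit x) := by
  have e : ∀ t : A ⊗[k] A, LinearMap.mul' k A ((twistAntipode U).rTensor A t) =
      U * innerLeft ((U⁻¹ : Aˣ) : A) t := by
    intro t
    induction t with
    | zero => simp
    | add s t hs ht => simp only [map_add, hs, ht, mul_add]
    | tmul a b => simp [innerLeft_tmul, twistAntipode_apply, mul_assoc]
  have e2 : innerLeft 1 (comul (R := k) x) = counit (R := k) x • 1 := by
    rw [← Algebra.algebraMap_eq_smul_one, ← mul_antipode_rTensor_comul_apply (R := k) x]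
    generalize comul (R := k) x = t
    induction t with
    | zero => simp
    | add s t hs ht => simp only [map_add, hs, ht]
    | tmul a b => simp [innerLeft_tmul]
  rw [e, twistComul_apply, innerLeft_mul, innerLeft_mul, h1, e2, innerLeft_smul, h2,
    mul_smul_comm, Units.mul_inv, Algebra.algebraMap_eq_smul_one]

lemma twistAntipode_right (F : (A ⊗[k] A)ˣ) (U : Aˣ)
    (h1 : innerRight (U : A) (F : A ⊗[k] A) = 1)
    (h2 : innerRight 1 ((F⁻¹ : (A ⊗[k] A)ˣ) : A ⊗[k] A) = U) (x : A) :
    LinearMap.mul' k A ((twistAntipode U).lTensor A (twistComul F x)) =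
      algebraMap k A (counit x) := by
  have e : ∀ t : A ⊗[k] A, LinearMap.mul' k A ((twistAntipode U).lTensor A t) =
      innerRight (U : A) t * ((U⁻¹ : Aˣ) : A) := by
    intro t
    induction t with
    | zero => simp
    | add s t hs ht => simp only [map_add, hs, ht, add_mul]
    | tmul a b => simp [innerRight_tmul, twistAntipode_apply, mul_assoc]
  have e2 : innerRight 1 (comul (R := k) x) = counit (R := k) x • 1 := by
    rw [← Algebra.algebraMap_eq_smul_one, ← mul_antipode_lTensor_comul_apply (R := k) x]
    generalize comul (R := k) x = t
    induction t with
    | zero => simp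
    | add s t hs ht => simp only [map_add, hs, ht]
    | tmul a b => simp [innerRight_tmul]
  rw [e, twistComul_apply, ← mul_assoc, innerRight_mul, innerRight_mul, h1, e2, innerRight_smul,
    h2, smul_mul_assoc, Units.mul_inv, Algebra.algebraMap_eq_smul_one]

end Twist

section TwistedSquare

variable (k H : Type*) [Field k] [Ring H] [HopfAlgebra k H]

/-- `x ⊗ y ↦ 1 ⊗ x ⊗ y ⊗ 1`, the second and third places in `(H ⊗ H) ⊗ (H ⊗ H)`. -/
def middle : H ⊗[k] H →ₐ[k] (H ⊗[k] H) ⊗[k] (H ⊗[k] H) :=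
  Algebra.TensorProduct.map Algebra.TensorProduct.includeRight Algebra.TensorProduct.includeLeft

variable {k H} in
lemma middle_tmul (x y : H) : middle k H (x ⊗ₜ[k] y) = (1 ⊗ₜ x) ⊗ₜ (y ⊗ₜ 1) := rfl

open Quasitriangular

variable [Quasitriangular k H]

/-- `R₂₃` in `(H ⊗ H) ⊗ (H ⊗ H)`. -/
def twistUnit : ((H ⊗[k] H) ⊗[k] (H ⊗[k] H))ˣ := Units.map (middle k H) (R k H)

/-- `R₂₁` in `H ⊗ H`. -/
def flipUnit : (H ⊗[k] H)ˣ :=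
  Units.map (Algebra.TensorProduct.comm k H H : H ⊗[k] H →* H ⊗[k] H) (R k H)

lemma coe_twistUnit : (twistUnit k H : (H ⊗[k] H) ⊗[k] (H ⊗[k] H)) = middle k H (R k H) := rfl
lemma coe_inv_twistUnit : (((twistUnit k H)⁻¹ : ((H ⊗[k] H) ⊗[k] (H ⊗[k] H))ˣ) :
    (H ⊗[k] H) ⊗[k] (H ⊗[k] H)) = middle k H ((R k H)⁻¹ : (H ⊗[k] H)ˣ) := rfl
lemma coe_flipUnit : (flipUnit k H : H ⊗[k] H) = TensorProduct.comm k H H (R k H) := rfl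
lemma coe_inv_flipUnit : (((flipUnit k H)⁻¹ : (H ⊗[k] H)ˣ) : H ⊗[k] H) =
    TensorProduct.comm k H H ((R k H)⁻¹ : (H ⊗[k] H)ˣ) := rfl

lemma innerLeft_middle (r w : H ⊗[k] H) :
    innerLeft (TensorProduct.comm k H H ((antipode k).rTensor H r)) (middle k H w) =
      TensorProduct.comm k H H ((antipode k).rTensor H (r * w)) := by
  induction w with
  | zero => simp
  | add s s' hs ht => simp only [mul_add, map_add, hs, ht]
  | tmul x y =>
    induction r with
    | zero => simp [innerLeft_zero]
    | add s s' hs ht => simp only [add_mul, map_add, innerLeft_add, hs, ht]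
    | tmul p q => simp [middle_tmul, innerLeft_tmul, antipode_mul_antidistrib]

lemma innerRight_middle (r w : H ⊗[k] H) :
    innerRight (TensorProduct.comm k H H ((antipode k).lTensor H r)) (middle k H w) =
      TensorProduct.comm k H H ((antipode k).lTensor H (w * r)) := by
  induction w with
  | zero => simp
  | add s s' hs ht => simp only [add_mul, map_add, hs, ht]
  | tmul x y =>
    induction r with
    | zero => simp [innerRight_zero]
    | add s s' hs ht => simp only [mul_add, map_add, innerRight_add, hs, ht]
    | tmul p q => simp [middle_tmul, innerRight_tmul, antipode_mul_antidistrib]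

lemma twistUnit_cocycle :
    Algebra.TensorProduct.assoc k k k (H ⊗[k] H) (H ⊗[k] H) (H ⊗[k] H)
        (Algebra.TensorProduct.map (Bialgebra.comulAlgHom k (H ⊗[k] H)) (AlgHom.id k (H ⊗[k] H))
          (twistUnit k H : (H ⊗[k] H) ⊗[k] (H ⊗[k] H)) *
          Algebra.TensorProduct.includeLeft (S := k)
            (twistUnit k H : (H ⊗[k] H) ⊗[k] (H ⊗[k] H))) =
      Algebra.TensorProduct.map (AlgHom.id k (H ⊗[k] H)) (Bialgebra.comulAlgHom k (H ⊗[k] H))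
          (twistUnit k H : (H ⊗[k] H) ⊗[k] (H ⊗[k] H)) *
        Algebra.TensorProduct.includeRight (twistUnit k H : (H ⊗[k] H) ⊗[k] (H ⊗[k] H)) := by
  let iL : H →ₐ[k] H ⊗[k] H := Algebra.TensorProduct.includeLeft
  let iR : H →ₐ[k] H ⊗[k] H := Algebra.TensorProduct.includeRight
  let α := Algebra.TensorProduct.assoc k k k (H ⊗[k] H) (H ⊗[k] H) (H ⊗[k] H)
  let α₁ : (H ⊗[k] H) ⊗[k] H →ₐ[k] ((H ⊗[k] H) ⊗[k] (H ⊗[k] H)) ⊗[k] (H ⊗[k] H) :=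
    Algebra.TensorProduct.map (Algebra.TensorProduct.map iR iR) iL
  let α₂ : (H ⊗[k] H) ⊗[k] H →ₐ[k] ((H ⊗[k] H) ⊗[k] (H ⊗[k] H)) ⊗[k] (H ⊗[k] H) :=
    Algebra.TensorProduct.map (Algebra.TensorProduct.map iR iL) iL
  let κ : H ⊗[k] H →ₐ[k] ((H ⊗[k] H) ⊗[k] (H ⊗[k] H)) ⊗[k] (H ⊗[k] H) :=
    Algebra.TensorProduct.map (Algebra.TensorProduct.includeLeft.comp iR) iL
  have c1 : ∀ x : H, comul (R := k) (1 ⊗ₜ[k] x : H ⊗[k] H) =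
      Algebra.TensorProduct.map iR iR (comul (R := k) x) := by
    intro x
    rw [TensorProduct.comul_tmul, Bialgebra.comul_one]
    generalize comul (R := k) x = t
    induction t with
    | zero => simp
    | add s t hs ht => simp only [TensorProduct.tmul_add, map_add, hs, ht]
    | tmul a b => simp [iR, Algebra.TensorProduct.one_def]
  have c2 : ∀ x : H, comul (R := k) (x ⊗ₜ[k] 1 : H ⊗[k] H) =
      Algebra.TensorProduct.map iL iL (comul (R := k) x) := by
    intro x
    rw [TensorProduct.comul_tmul, Bialgebra.comul_one]
    generalize comul (R := k) x = t
    induction t with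
    | zero => simp
    | add s t hs ht => simp only [TensorProduct.add_tmul, map_add, hs, ht]
    | tmul a b => simp [iL, Algebra.TensorProduct.one_def]
  have d1 : ∀ w : H ⊗[k] H, Algebra.TensorProduct.map (Bialgebra.comulAlgHom k (H ⊗[k] H))
      (AlgHom.id k (H ⊗[k] H)) (middle k H w) =
      α₁ (TensorProduct.map comul LinearMap.id w) := by
    intro w
    induction w with
    | zero => simp
    | add s t hs ht => simp only [map_add, hs, ht]
    | tmul a b =>
      rw [middle_tmul, Algebra.TensorProduct.map_tmul, Bialgebra.comulAlgHom_apply, c1]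
      rfl
  have d2 : ∀ w : H ⊗[k] H, Algebra.TensorProduct.map (AlgHom.id k (H ⊗[k] H))
      (Bialgebra.comulAlgHom k (H ⊗[k] H)) (middle k H w) =
      α (α₂ ((TensorProduct.assoc k H H H).symm (TensorProduct.map LinearMap.id comul w))) := by
    intro w
    induction w with
    | zero => simp
    | add s t hs ht => simp only [map_add, hs, ht]
    | tmul a b =>
      rw [middle_tmul, Algebra.TensorProduct.map_tmul, Bialgebra.comulAlgHom_apply, c2,
        TensorProduct.map_tmul]
      generalize comul (R := k) b = t
      induction t with
      | zero => simp
      | add s t hs ht => simp only [TensorProduct.tmul_add, map_add, hs, ht]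
      | tmul c d => rfl
  have l1 : ∀ w, α₁ (leg₁₃ k H w) = κ w := by
    intro w
    induction w with
    | zero => simp
    | add s t hs ht => simp only [map_add, hs, ht]
    | tmul a b => simp [α₁, leg₁₃, κ, iR, iL, Algebra.TensorProduct.one_def]
  have l2 : ∀ w, α₂ (leg₁₃ k H w) = κ w := by
    intro w
    induction w with
    | zero => simp
    | add s t hs ht => simp only [map_add, hs, ht]
    | tmul a b => simp [α₂, leg₁₃, κ, iR, iL, Algebra.TensorProduct.one_def]
  have l3 : ∀ w, α₂ (leg₁₂ k H w) = Algebra.TensorProduct.includeLeft (S := k) (middle k H w) := by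
    intro w
    induction w with
    | zero => simp
    | add s t hs ht => simp only [map_add, hs, ht]
    | tmul a b => simp [α₂, leg₁₂, middle_tmul, iR, iL, Algebra.TensorProduct.one_def]
  have l4 : ∀ w, α (α₁ (leg₂₃ k H w)) = Algebra.TensorProduct.includeRight (middle k H w) := by
    intro w
    induction w with
    | zero => simp
    | add s t hs ht => simp only [map_add, hs, ht]
    | tmul a b => simp [α, α₁, leg₂₃, middle_tmul, iR, iL, Algebra.TensorProduct.one_def]
  have cc : ∀ v w : H ⊗[k] H, α (α₁ (leg₂₃ k H v)) * α (α₂ (leg₁₂ k H w)) =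
      α (α₂ (leg₁₂ k H w)) * α (α₁ (leg₂₃ k H v)) := by
    intro v w
    induction v with
    | zero => simp
    | add s t hs ht => simp only [map_add, add_mul, mul_add, hs, ht]
    | tmul a b =>
      induction w with
      | zero => simp
      | add s t hs ht => simp only [map_add, add_mul, mul_add, hs, ht]
      | tmul c d => simp [α, α₁, α₂, leg₁₂, leg₂₃, iR, iL]
  rw [coe_twistUnit, d1, d2, comul_left, comul_right, ← l3, ← l4]
  change α _ = _
  rw [map_mul, map_mul, map_mul, map_mul, map_mul, l1, l2, mul_assoc, mul_assoc, cc]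

lemma twistUnit_counit_left : Algebra.TensorProduct.map (Bialgebra.counitAlgHom k (H ⊗[k] H))
    (AlgHom.id k (H ⊗[k] H)) (twistUnit k H : (H ⊗[k] H) ⊗[k] (H ⊗[k] H)) = 1 := by
  have e : (Algebra.TensorProduct.map (Bialgebra.counitAlgHom k (H ⊗[k] H))
      (AlgHom.id k (H ⊗[k] H))).comp (middle k H) =
      (Algebra.TensorProduct.map (AlgHom.id k k) Algebra.TensorProduct.includeLeft).comp
      (Algebra.TensorProduct.map (Bialgebra.counitAlgHom k H) (AlgHom.id k H)) := by
    ext x <;> simp [middle]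
  have h := AlgHom.congr_fun e (R k H : H ⊗[k] H)
  simp only [AlgHom.comp_apply] at h
  rw [coe_twistUnit, h]
  have h2 : Algebra.TensorProduct.map (Bialgebra.counitAlgHom k H) (AlgHom.id k H)
     (R k H : H ⊗[k] H) = 1 := map_counit_left k H
  rw [h2, map_one]

lemma twistUnit_counit_right : Algebra.TensorProduct.map (AlgHom.id k (H ⊗[k] H))
    (Bialgebra.counitAlgHom k (H ⊗[k] H)) (twistUnit k H : (H ⊗[k] H) ⊗[k] (H ⊗[k] H)) = 1 := by
  have e : (Algebra.TensorProduct.map (AlgHom.id k (H ⊗[k] H))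
      (Bialgebra.counitAlgHom k (H ⊗[k] H))).comp (middle k H) =
      (Algebra.TensorProduct.map Algebra.TensorProduct.includeRight (AlgHom.id k k)).comp
      (Algebra.TensorProduct.map (AlgHom.id k H) (Bialgebra.counitAlgHom k H)) := by
    ext x <;> simp [middle]
  have h := AlgHom.congr_fun e (R k H : H ⊗[k] H)
  simp only [AlgHom.comp_apply] at h
  rw [coe_twistUnit, h]
  have h2 : Algebra.TensorProduct.map (AlgHom.id k H) (Bialgebra.counitAlgHom k H)
     (R k H : H ⊗[k] H) = 1 := map_counit_right k H
  rw [h2, map_one]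

/-- The twisted square of a quasitriangular Hopf algebra `(H, R)`: the algebra and counit of
`H ⊗ H`, with coproduct `x ↦ R₂₃⁻¹ (Δ_{H ⊗ H} x) R₂₃` and antipode
`x ↦ R₂₁ ((S ⊗ S) x) R₂₁⁻¹`. -/
def TwistedSquare (k H : Type*) [Field k] [Ring H] [HopfAlgebra k H] [Quasitriangular k H] :
    Type _ := H ⊗[k] H

namespace TwistedSquare

instance : Ring (TwistedSquare k H) := inferInstanceAs (Ring (H ⊗[k] H))
instance : Algebra k (TwistedSquare k H) := inferInstanceAs (Algebra k (H ⊗[k] H))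

/-- The identification of algebras with `H ⊗ H`. -/
def equiv : TwistedSquare k H ≃ₐ[k] H ⊗[k] H := AlgEquiv.refl (R := k) (A₁ := H ⊗[k] H)

variable {k H} in
/-- The element `h ⊗ g`. -/
def tmul (h g : H) : TwistedSquare k H := (equiv k H).symm (h ⊗ₜ[k] g)

/-- `equiv⁻¹ ⊗ equiv⁻¹`. -/
def equivSymm₂ : (H ⊗[k] H) ⊗[k] (H ⊗[k] H) →ₐ[k] TwistedSquare k H ⊗[k] TwistedSquare k H :=
  Algebra.TensorProduct.map (equiv k H).symm (equiv k H).symm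

instance : CoalgebraStruct k (TwistedSquare k H) where
  comul := (equivSymm₂ k H).toLinearMap ∘ₗ
    (twistComul (twistUnit k H)).toLinearMap ∘ₗ (equiv k H).toLinearMap
  counit := counit (A := H ⊗[k] H) ∘ₗ (equiv k H).toLinearMap

lemma comul_eq : (comul : TwistedSquare k H →ₗ[k] TwistedSquare k H ⊗[k] TwistedSquare k H) =
    (twistComul (twistUnit k H)).toLinearMap := by
  ext1 x
  exact LinearMap.congr_fun TensorProduct.map_id (twistComul (twistUnit k H) x)

instance : Bialgebra k (TwistedSquare k H) where
  coassoc := by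
    rw [comul_eq]
    ext1 x
    exact twistComul_coassoc (twistUnit k H) (twistUnit_cocycle k H) x
  rTensor_counit_comp_comul := by
    rw [comul_eq]
    ext1 x
    exact twistComul_counit_left (twistUnit k H) (twistUnit_counit_left k H) x
  lTensor_counit_comp_comul := by
    rw [comul_eq]
    ext1 x
    exact twistComul_counit_right (twistUnit k H) (twistUnit_counit_right k H) x
  counit_one := Bialgebra.counit_one (A := H ⊗[k] H)
  mul_compr₂_counit := Bialgebra.mul_compr₂_counit (A := H ⊗[k] H)
  comul_one := map_one ((equivSymm₂ k H).comp (twistComul (twistUnit k H)))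
  mul_compr₂_comul := by
    ext1 x
    ext1 y
    exact map_mul ((equivSymm₂ k H).comp (twistComul (twistUnit k H))) x y

instance : HopfAlgebra k (TwistedSquare k H) where
  antipode := (equiv k H).symm.toLinearMap ∘ₗ
    twistAntipode (flipUnit k H) ∘ₗ (equiv k H).toLinearMap
  mul_antipode_rTensor_comul := by
    rw [comul_eq]
    ext1 x
    refine twistAntipode_left (twistUnit k H) (flipUnit k H) ?_ ?_ x
    · rw [coe_inv_flipUnit, coe_inv_twistUnit, ← antipode_left, innerLeft_middle, antipode_left,
        Units.mul_inv, Algebra.TensorProduct.one_def]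
      simp
    · have := innerLeft_middle k H 1 (R k H)
      rw [Algebra.TensorProduct.one_def, LinearMap.rTensor_tmul, antipode_one,
        TensorProduct.comm_tmul, ← Algebra.TensorProduct.one_def, one_mul, antipode_left] at this
      exact this
  mul_antipode_lTensor_comul := by
    rw [comul_eq]
    ext1 x
    refine twistAntipode_right (twistUnit k H) (flipUnit k H) ?_ ?_ x
    · rw [coe_flipUnit, coe_twistUnit]
      have := innerRight_middle k H ((R k H)⁻¹ : (H ⊗[k] H)ˣ) (R k H)
      rw [antipode_right, Units.mul_inv, Algebra.TensorProduct.one_def] at this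
      rw [this]
      simp [Algebra.TensorProduct.one_def]
    · have := innerRight_middle k H 1 ((R k H)⁻¹ : (H ⊗[k] H)ˣ)
      rw [Algebra.TensorProduct.one_def, LinearMap.lTensor_tmul, antipode_one,
        TensorProduct.comm_tmul, ← Algebra.TensorProduct.one_def, mul_one, antipode_right] at this
      exact this

end TwistedSquare

end TwistedSquare

section Factorisable

variable (k H : Type*) [Field k] [Ring H] [HopfAlgebra k H] [Quasitriangular k H]

open Quasitriangular

/-- `Q = R⁻¹ R₂₁⁻¹` in `H ⊗ H`. -/
def factorElement : H ⊗[k] H :=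
  ((R k H)⁻¹ : (H ⊗[k] H)ˣ) * TensorProduct.comm k H H ((R k H)⁻¹ : (H ⊗[k] H)ˣ)

/-- `Q` as a map `H* → H`, by evaluation on the first tensor factor: `a ↦ (a ⊗ id) Q`. The pair
`(H, R)` is factorisable if this is a bijection. -/
def factorMap : HDual k H →ₗ[k] H :=
  (TensorProduct.lid k H).toLinearMap ∘ₗ
    ((LinearMap.rTensorHom H).flip (factorElement k H)) ∘ₗ
      (WithConv.linearEquiv k (H →ₗ[k] k)).toLinearMap

lemma factorMap_apply (a : HDual k H) :
    factorMap k H a = TensorProduct.lid k H (a.ofConv.rTensor H (factorElement k H)) := rfl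

/-- `c ↦ ⟨R⁻⁽²⁾, c⟩ R⁻⁽¹⁾`, where `R⁻¹ = R⁻⁽¹⁾ ⊗ R⁻⁽²⁾`. -/
def evalInvSnd : HDual k H →ₗ[k] H :=
  (TensorProduct.rid k H).toLinearMap ∘ₗ
    ((LinearMap.lTensorHom H).flip ((R k H)⁻¹ : (H ⊗[k] H)ˣ)) ∘ₗ
      (WithConv.linearEquiv k (H →ₗ[k] k)).toLinearMap

lemma evalInvSnd_apply (c : HDual k H) :
    evalInvSnd k H c = TensorProduct.rid k H (c.ofConv.lTensor H ((R k H)⁻¹ : (H ⊗[k] H)ˣ)) := rfl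

variable {k H}

/-- `(id ⊗ id ⊗ a)(R₃₁⁻¹ R₂₃)`. -/
def doubleElement (a : HDual k H) : H ⊗[k] H :=
  TensorProduct.rid k (H ⊗[k] H) (a.ofConv.lTensor (H ⊗[k] H)
    (leg₃₁ k H ((R k H)⁻¹ : (H ⊗[k] H)ˣ) * leg₂₃ k H (R k H)))

/-- The value `((id ⊗ id ⊗ a)(R₃₁⁻¹ R₂₃)) Δ(h)` on `a ⊗ h` of the map from the quantum double to the
twisted square, the product being that of `H ⊗ H`. -/
def doubleToSquare (a : HDual k H) (h : H) : TwistedSquare k H :=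
  (TwistedSquare.equiv k H).symm (doubleElement a * comul h)

/-- `h ⊗ g ↦ h S(g₁) ⊗ g₂`. -/
def antipodeShear : H ⊗[k] H →ₗ[k] H ⊗[k] H :=
  (LinearMap.mul' k H ∘ₗ (antipode k).lTensor H).rTensor H ∘ₗ
    (TensorProduct.assoc k H H H).symm.toLinearMap ∘ₗ (comul (R := k)).lTensor H

variable [FiniteDimensional k H]

/-- `b ⊗ g ↦ b₁ ⊗ ⟨R⁻⁽²⁾, b₂⟩ R⁻⁽¹⁾ g`. -/
def dualShear : HDual k H ⊗[k] H →ₗ[k] HDual k H ⊗[k] H :=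
  (LinearMap.mul' k H ∘ₗ (evalInvSnd k H).rTensor H).lTensor (HDual k H) ∘ₗ
    (TensorProduct.assoc k (HDual k H) (HDual k H) H).toLinearMap ∘ₗ (comul (R := k)).rTensor H

/-- The formula `h ⊗ g ↦ (Q⁻¹(h S(g₁)))₁ ⟨R⁻⁽²⁾, (Q⁻¹(h S(g₁)))₂⟩ ⊗ R⁻⁽¹⁾ g₂` in the factorisable
case. -/
def squareToDouble (hQ : Function.Bijective (factorMap k H)) (h g : H) : DrinfeldDouble k H :=
  (DrinfeldDouble.equiv k H).symm
    (dualShear ((LinearEquiv.ofBijective (factorMap k H) hQ).symm.toLinearMap.rTensor H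
      (antipodeShear (h ⊗ₜ[k] g))))

end Factorisable

end QuantumDouble

end

/-! Put E = R₃₁⁻¹ R₂₃ in H ⊗ H ⊗ H (`exchangeElement`), so that the map is φ(a ⊗ h) = (id ⊗ id ⊗
a)(E) Δ(h). Every property of φ reduces to an identity for E.

Multiplicativity. In D(H) one has a ⊗ h = (a ⊗ 1)(1 ⊗ h) and (a ⊗ 1)(b ⊗ 1) = ba ⊗ 1. On H the map
is Δ, an algebra map. On H* the hexagon axioms give (id ⊗ id ⊗ Δ)(E) = E₁₂₄ E₁₂₃
(`comul_exchangeElement`), which reverses products. The relation between H and H* comes from (h₂ ⊗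
h₃ ⊗ h₁) E = E (h₁ ⊗ h₂ ⊗ h₃) (`comul₃_exchangeElement`), two uses of Δᵒᵖ = R Δ R⁻¹: in φ((1 ⊗ h)(b
⊗ 1)) it brings S(h₁) next to h₂, and they cancel (`comul_mul_doubleElement`).

Coproducts. Conjugating Δ_{H⊗H}(Δh) = h₁ ⊗ h₃ ⊗ h₂ ⊗ h₄ by R₂₃ restores the order of the two middle
factors (`twistComul_comul`). The twisted coproduct sends E to E₁₂₅ E₃₄₅, by the hexagon axioms and
one use of the Yang–Baxter equation (`twistComul_exchangeElement`). Evaluating the shared fifth leg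
at a splits a into a₁ and a₂, so φ respects the coproducts. The counit uses (ε ⊗ id)R = 1 = (id ⊗
ε)R. Compatibility with antipodes is then automatic, antipodes being convolution inverses
(`map_antipode`).

Inverse. Since (Δ ⊗ id)(R⁻¹) = R₂₃⁻¹ R₁₃⁻¹, the factor R₂₃ of E cancels in E (Δ ⊗ id)(R⁻¹) = R₃₁⁻¹
R₁₃⁻¹, which is Q placed in legs 3 and 1. Hence φ(b₁ ⊗ ⟨R⁻⁽²⁾, b₂⟩ R⁻⁽¹⁾ g) = (Q(b) ⊗ 1) Δ(g)
(`doubleToSquareₗ_dualShear`). Taking b = Q⁻¹(h S(g₁)) and g₂ for g gives h S(g₁) g₂ ⊗ g₃ = h ⊗ g,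
so the stated formula is a right inverse of φ. Thus φ is onto, and equality of dimensions makes it
bijective and the right inverse its inverse. -/

noncomputable section

namespace QuantumDouble

attribute [local instance] linearMap_zeroHomClass linearMap_addHomClass linearEquiv_zeroHomClass
  linearEquiv_addHomClass algHom_zeroHomClass algHom_addHomClass

/-! ### Evaluating the last tensor leg at a functional -/

section Evaluation

variable {k H W : Type*} [Field k] [Ring H] [HopfAlgebra k H]

/-- Evaluation of the last leg: `w ⊗ x ↦ a(x) w`. -/
def evalLast [AddCommMonoid W] [Module k W] (a : HDual k H) : W ⊗[k] H →ₗ[k] W :=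
  (TensorProduct.rid k W).toLinearMap ∘ₗ a.ofConv.lTensor W

lemma evalLast_tmul [AddCommMonoid W] [Module k W] (a : HDual k H) (w : W) (x : H) :
    evalLast a (w ⊗ₜ[k] x) = a x • w := by
  simp [evalLast]

lemma evalLast_add [AddCommMonoid W] [Module k W] (a b : HDual k H) (t : W ⊗[k] H) :
    evalLast (a + b) t = evalLast a t + evalLast b t := by
  simp [evalLast]

lemma evalLast_smul [AddCommMonoid W] [Module k W] (c : k) (a : HDual k H) (t : W ⊗[k] H) :
    evalLast (c • a) t = c • evalLast a t := by
  simp [evalLast]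

/-- `evalLast a t` as a linear function of `a`. -/
def evalLastₗ [AddCommMonoid W] [Module k W] (t : W ⊗[k] H) : HDual k H →ₗ[k] W where
  toFun a := evalLast a t
  map_add' a b := evalLast_add a b t
  map_smul' c a := evalLast_smul c a t

lemma evalLastₗ_add [AddCommMonoid W] [Module k W] (s t : W ⊗[k] H) :
    evalLastₗ (s + t) = evalLastₗ s + evalLastₗ t := by
  ext1 a
  exact map_add (evalLast a) s t

lemma evalLastₗ_zero [AddCommMonoid W] [Module k W] :
    evalLastₗ (0 : W ⊗[k] H) = 0 := by
  ext1 a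
  exact map_zero (evalLast a)

lemma evalLastₗ_tmul [AddCommMonoid W] [Module k W] (w : W) (x : H) (a : HDual k H) :
    evalLastₗ (w ⊗ₜ[k] x) a = a x • w :=
  evalLast_tmul a w x

/-- The coproduct of H* is dual to the product of H, a(xy) = a₁(x) a₂(y), so a functional on the
last leg of a product distributes over the factors. Both the coproduct computation and the inverse
formula use this. -/
lemma evalLast_mul [Ring W] [Algebra k W] [FiniteDimensional k H] (a : HDual k H)
    (s t : W ⊗[k] H) : evalLast a (s * t) =
      LinearMap.mul' k W (TensorProduct.map (evalLastₗ s) (evalLastₗ t) (comul (R := k) a)) := by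
  induction s with
  | zero => simp [evalLastₗ_zero]
  | add s s' hs hs' =>
    simp only [map_add, add_mul, hs, hs', evalLastₗ_add, TensorProduct.map_add_left,
      LinearMap.add_apply]
  | tmul v x =>
    induction t with
    | zero => simp [evalLastₗ_zero]
    | add s s' hs hs' =>
      simp only [map_add, mul_add, hs, hs', evalLastₗ_add, TensorProduct.map_add_right,
        LinearMap.add_apply]
    | tmul w y =>
      have h1 : a (x * y) = evalLeft x (comul (R := k) a) y := by
        rw [evalLeft_comul]; rfl
      rw [Algebra.TensorProduct.tmul_mul_tmul, evalLast_tmul, h1]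
      generalize comul (R := k) a = X
      induction X with
      | zero => simp
      | add s s' hs hs' =>
        simp only [map_add, WithConv.ofConv_add, LinearMap.add_apply, add_smul, hs, hs']
      | tmul b c => simp [evalLastₗ_tmul, smul_smul, mul_comm]

/-- Evaluation of the last two legs: `w ⊗ x ⊗ y ↦ a(x) b(y) w`. -/
def evalLast₂ [AddCommMonoid W] [Module k W] (a b : HDual k H) : W ⊗[k] (H ⊗[k] H) →ₗ[k] W :=
  (TensorProduct.rid k W).toLinearMap ∘ₗ
    (LinearMap.mul' k k ∘ₗ TensorProduct.map a.ofConv b.ofConv).lTensor W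

lemma evalLast₂_tmul [AddCommMonoid W] [Module k W] (a b : HDual k H) (w : W) (x y : H) :
    evalLast₂ a b (w ⊗ₜ[k] (x ⊗ₜ[k] y)) = (a x * b y) • w := by
  simp [evalLast₂]

/-- The product of H* is dual to the coproduct of H; this is how products of functionals are read
off from Δ on the last leg. -/
lemma evalLast₂_comul [AddCommMonoid W] [Module k W] (a b : HDual k H) (t : W ⊗[k] H) :
    evalLast₂ a b ((comul (R := k)).lTensor W t) = evalLast (a * b) t := by
  induction t with
  | zero => simp
  | add s t hs ht => simp only [map_add, hs, ht]
  | tmul w x =>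
    rw [evalLast_tmul, LinearMap.convMul_apply]
    simp [evalLast₂]

/-- The factor s occupies the second of the two evaluated places, so it is evaluated at b although
it stands on the left. This is the source of the order reversal in `doubleElement_mul`. -/
lemma evalLast₂_mul [Ring W] [Algebra k W] (a b : HDual k H) (s t : W ⊗[k] H) :
    evalLast₂ a b (Algebra.TensorProduct.map (AlgHom.id k W) Algebra.TensorProduct.includeRight s *
      Algebra.TensorProduct.map (AlgHom.id k W) Algebra.TensorProduct.includeLeft t) =
      evalLast b s * evalLast a t := by
  induction s with
  | zero => simp
  | add s s' hs hs' => simp only [map_add, add_mul, hs, hs']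
  | tmul v x =>
    induction t with
    | zero => simp
    | add s s' hs hs' => simp only [map_add, mul_add, hs, hs']
    | tmul w y => simp [evalLast_tmul, evalLast₂_tmul, smul_smul]

lemma evalLast_includeLeft_mul [Ring W] [Algebra k W] (a : HDual k H) (w : W) (t : W ⊗[k] H) :
    evalLast a ((w ⊗ₜ[k] 1) * t) = w * evalLast a t := by
  induction t with
  | zero => simp
  | add s s' hs hs' => simp only [map_add, mul_add, hs, hs']
  | tmul v y => simp [evalLast_tmul]

lemma evalLast_mul_includeLeft [Ring W] [Algebra k W] (a : HDual k H) (w : W) (t : W ⊗[k] H) :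
    evalLast a (t * (w ⊗ₜ[k] 1)) = evalLast a t * w := by
  induction t with
  | zero => simp
  | add s s' hs hs' => simp only [map_add, add_mul, hs, hs']
  | tmul v y => simp [evalLast_tmul]

end Evaluation

/-! ### Identities for R₃₁⁻¹ R₂₃: coproduct, counit and commutation with H -/

section ExchangeElement

variable {k H : Type*} [Field k] [Ring H] [HopfAlgebra k H]

lemma leg₁₂_tmul (x y : H) : leg₁₂ k H (x ⊗ₜ[k] y) = (x ⊗ₜ y) ⊗ₜ 1 := rfl
lemma leg₁₃_tmul (x y : H) : leg₁₃ k H (x ⊗ₜ[k] y) = (x ⊗ₜ 1) ⊗ₜ y := rfl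
lemma leg₂₃_tmul (x y : H) : leg₂₃ k H (x ⊗ₜ[k] y) = (1 ⊗ₜ x) ⊗ₜ y := rfl
lemma leg₃₁_tmul (x y : H) : leg₃₁ k H (x ⊗ₜ[k] y) = (y ⊗ₜ 1) ⊗ₜ x := rfl

/-- Inversion in the unit group reverses products. Applied to a hexagon axiom for R, this gives the
axiom for R⁻¹ with the factors in the opposite order. -/
lemma map_inv_of_map_eq_mul {A B : Type*} [Semiring A] [Semiring B] [Algebra k A] [Algebra k B]
    (f g h : A →ₐ[k] B) (u : Aˣ) (e : f u = g u * h u) :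
    f (u⁻¹ : Aˣ) = h (u⁻¹ : Aˣ) * g (u⁻¹ : Aˣ) := by
  have hu : Units.map (f : A →* B) u = Units.map (g : A →* B) u * Units.map (h : A →* B) u :=
    Units.ext e
  have := congr((($hu)⁻¹ : Bˣ))
  rw [mul_inv_rev, ← map_inv, ← map_inv, ← map_inv] at this
  exact congr(($this : B))

/-- Serves copies of R on disjoint legs: that they commute need only be seen on pure tensors. -/
lemma mul_comm_of_tmul {A V : Type*} [Semiring A] [Algebra k A] [Semiring V] [Algebra k V]
    (f g : A ⊗[k] A →ₐ[k] V) (h : ∀ x y p q : A,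
      f (x ⊗ₜ y) * g (p ⊗ₜ q) = g (p ⊗ₜ q) * f (x ⊗ₜ y)) (s t : A ⊗[k] A) :
    f s * g t = g t * f s := by
  induction s with
  | zero => simp
  | add s s' hs hs' => simp only [map_add, add_mul, mul_add, hs, hs']
  | tmul x y =>
    induction t with
    | zero => simp
    | add s s' hs hs' => simp only [map_add, add_mul, mul_add, hs, hs']
    | tmul p q => exact h x y p q

open Quasitriangular

variable [Quasitriangular k H]

variable (k H) in
/-- `R₃₁⁻¹ R₂₃`. -/
def exchangeElement : (H ⊗[k] H) ⊗[k] H :=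
  leg₃₁ k H ((R k H)⁻¹ : (H ⊗[k] H)ˣ) * leg₂₃ k H (R k H)

lemma doubleElement_eq (a : HDual k H) : doubleElement a = evalLast a (exchangeElement k H) := rfl

/-- `(id ⊗ id ⊗ Δ)(R₃₁⁻¹ R₂₃) = (R₄₁⁻¹ R₂₄) (R₃₁⁻¹ R₂₃)`. -/
lemma comul_exchangeElement :
    (comul (R := k)).lTensor (H ⊗[k] H) (exchangeElement k H) =
      Algebra.TensorProduct.map (AlgHom.id k (H ⊗[k] H)) Algebra.TensorProduct.includeRight
        (exchangeElement k H) *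
      Algebra.TensorProduct.map (AlgHom.id k (H ⊗[k] H)) Algebra.TensorProduct.includeLeft
        (exchangeElement k H) := by
  let i₁ : (H ⊗[k] H) ⊗[k] H →ₐ[k] (H ⊗[k] H) ⊗[k] (H ⊗[k] H) :=
    Algebra.TensorProduct.map (AlgHom.id k (H ⊗[k] H)) Algebra.TensorProduct.includeLeft
  let i₂ : (H ⊗[k] H) ⊗[k] H →ₐ[k] (H ⊗[k] H) ⊗[k] (H ⊗[k] H) :=
    Algebra.TensorProduct.map (AlgHom.id k (H ⊗[k] H)) Algebra.TensorProduct.includeRight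
  let d : (H ⊗[k] H) ⊗[k] H →ₐ[k] (H ⊗[k] H) ⊗[k] (H ⊗[k] H) :=
    Algebra.TensorProduct.map (AlgHom.id k (H ⊗[k] H)) (Bialgebra.comulAlgHom k H)
  have hd : ∀ t, (comul (R := k)).lTensor (H ⊗[k] H) t = d t := fun _ => rfl
  -- `j` sends legs 1, 2, 3 to 2, 3, 4 and `j'` sends them to 3, 4, 1. They carry the two hexagon
  -- axioms, stated in three legs, to the four legs needed here.
  let j : (H ⊗[k] H) ⊗[k] H →ₐ[k] (H ⊗[k] H) ⊗[k] (H ⊗[k] H) :=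
    (Algebra.TensorProduct.map Algebra.TensorProduct.includeRight
      (AlgHom.id k (H ⊗[k] H))).comp (Algebra.TensorProduct.assoc k k k H H H).toAlgHom
  let j' : (H ⊗[k] H) ⊗[k] H →ₐ[k] (H ⊗[k] H) ⊗[k] (H ⊗[k] H) :=
    (Algebra.TensorProduct.map Algebra.TensorProduct.includeLeft
      (AlgHom.id k (H ⊗[k] H))).comp (Algebra.TensorProduct.comm k (H ⊗[k] H) H).toAlgHom
  have e1 : ∀ t, j (leg₁₃ k H t) = i₂ (leg₂₃ k H t) := by
    intro t
    induction t with
    | zero => simp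
    | add s s' hs hs' => simp only [map_add, hs, hs']
    | tmul x y => simp [j, i₂, leg₁₃_tmul, leg₂₃_tmul]
  have e2 : ∀ t, j (leg₁₂ k H t) = i₁ (leg₂₃ k H t) := by
    intro t
    induction t with
    | zero => simp
    | add s s' hs hs' => simp only [map_add, hs, hs']
    | tmul x y => simp [j, i₁, leg₁₂_tmul, leg₂₃_tmul]
  have e3 : ∀ t, j' (leg₁₃ k H t) = i₁ (leg₃₁ k H t) := by
    intro t
    induction t with
    | zero => simp
    | add s s' hs hs' => simp only [map_add, hs, hs']
    | tmul x y => simp [j', i₁, leg₁₃_tmul, leg₃₁_tmul]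
  have e4 : ∀ t, j' (leg₂₃ k H t) = i₂ (leg₃₁ k H t) := by
    intro t
    induction t with
    | zero => simp
    | add s s' hs hs' => simp only [map_add, hs, hs']
    | tmul x y => simp [j', i₂, leg₂₃_tmul, leg₃₁_tmul]
  have e5 : ∀ t, j ((TensorProduct.assoc k H H H).symm (TensorProduct.map LinearMap.id comul t)) =
      d (leg₂₃ k H t) := by
    intro t
    induction t with
    | zero => simp
    | add s s' hs hs' => simp only [map_add, hs, hs']
    | tmul x y =>
      have : d (leg₂₃ k H (x ⊗ₜ[k] y)) = (1 ⊗ₜ x) ⊗ₜ comul y := rfl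
      rw [this, TensorProduct.map_tmul]
      generalize comul (R := k) y = Y
      induction Y with
      | zero => simp
      | add s s' hs hs' => simp only [map_add, TensorProduct.tmul_add, hs, hs']
      | tmul y z => simp [j]
  have e6 : ∀ t, j' (TensorProduct.map comul LinearMap.id t) = d (leg₃₁ k H t) := by
    intro t
    induction t with
    | zero => simp
    | add s s' hs hs' => simp only [map_add, hs, hs']
    | tmul x y => simp [j', d, leg₃₁_tmul]
  -- Here R₂₃ becomes R₂₄ R₂₃ and, in `f2`, R₃₁ becomes R₃₁ R₄₁; the inverse in `f3` is R₄₁⁻¹ R₃₁⁻¹.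
  have f1 : d (leg₂₃ k H (R k H)) = i₂ (leg₂₃ k H (R k H)) * i₁ (leg₂₃ k H (R k H)) := by
    rw [← e5, comul_right, map_mul, e1, e2]
  have f2 : d (leg₃₁ k H (R k H)) = i₁ (leg₃₁ k H (R k H)) * i₂ (leg₃₁ k H (R k H)) := by
    rw [← e6, comul_left, map_mul, e3, e4]
  have f3 := map_inv_of_map_eq_mul (d.comp (leg₃₁ k H)) (i₁.comp (leg₃₁ k H))
    (i₂.comp (leg₃₁ k H)) (R k H) f2
  simp only [AlgHom.comp_apply] at f3
  -- The legs of R₃₁⁻¹ and R₂₄ are disjoint. Exchanging these two inner factors turns R₄₁⁻¹ R₃₁⁻¹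
  -- R₂₄ R₂₃ into the required product.
  have c : ∀ s t, i₁ (leg₃₁ k H s) * i₂ (leg₂₃ k H t) = i₂ (leg₂₃ k H t) * i₁ (leg₃₁ k H s) := by
    refine mul_comm_of_tmul (i₁.comp (leg₃₁ k H)) (i₂.comp (leg₂₃ k H)) fun x y p q => ?_
    simp [i₁, i₂, leg₂₃_tmul, leg₃₁_tmul]
  rw [hd]
  change d (exchangeElement k H) = i₂ (exchangeElement k H) * i₁ (exchangeElement k H)
  rw [exchangeElement, map_mul, map_mul, map_mul, f1, f3, mul_assoc, mul_assoc,
    ← mul_assoc (i₁ (leg₃₁ k H _)), c, mul_assoc]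

/-- The reversal matches (a ⊗ 1)(b ⊗ 1) = ba ⊗ 1 in the double. -/
lemma doubleElement_mul (a b : HDual k H) :
    doubleElement (b * a) = doubleElement a * doubleElement b := by
  rw [doubleElement_eq, ← evalLast₂_comul, comul_exchangeElement, evalLast₂_mul]
  rfl

/-- The counit on leg 2 hits the first factor of R, and on leg 1 the second factor of R⁻¹; the
normalisations (ε ⊗ id)R = 1 and (id ⊗ ε)R = 1 give the result. -/
lemma counit_exchangeElement :
    Algebra.TensorProduct.map (Bialgebra.counitAlgHom k (H ⊗[k] H)) (AlgHom.id k H)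
      (exchangeElement k H) = 1 := by
  let e := Algebra.TensorProduct.map (Bialgebra.counitAlgHom k (H ⊗[k] H)) (AlgHom.id k H)
  let e₁ := Algebra.TensorProduct.map (Bialgebra.counitAlgHom k H) (AlgHom.id k H)
  let e₂ := Algebra.TensorProduct.map (AlgHom.id k H) (Bialgebra.counitAlgHom k H)
  have h1 : ∀ t, e (leg₂₃ k H t) = e₁ t := by
    intro t
    induction t with
    | zero => simp
    | add s s' hs hs' => simp only [map_add, hs, hs']
    | tmul x y => simp [e, e₁, leg₂₃_tmul]
  have h2 : ∀ t, e (leg₃₁ k H t) = TensorProduct.comm k H k (e₂ t) := by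
    intro t
    induction t with
    | zero => simp
    | add s s' hs hs' => simp only [map_add, hs, hs']
    | tmul x y => simp [e, e₂, leg₃₁_tmul]
  -- `e₂` is an algebra map sending R to 1, hence also R⁻¹ to 1.
  have h3 : e₂ ((R k H)⁻¹ : (H ⊗[k] H)ˣ) = 1 := by
    have := congr(e₂ $(Units.mul_inv (R k H)))
    rwa [map_mul, map_one, show e₂ (R k H) = 1 from map_counit_right k H, one_mul] at this
  change e _ = 1
  rw [exchangeElement, map_mul, h1, h2, h3, show e₁ (R k H) = 1 from map_counit_left k H,
    Algebra.TensorProduct.one_def, Algebra.TensorProduct.one_def, TensorProduct.comm_tmul]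
  simp

lemma counit_doubleElement (a : HDual k H) :
    counit (R := k) (doubleElement a) = a 1 := by
  have h : ∀ t : (H ⊗[k] H) ⊗[k] H, counit (R := k) (evalLast a t) =
      evalLast a (Algebra.TensorProduct.map (Bialgebra.counitAlgHom k (H ⊗[k] H))
        (AlgHom.id k H) t) := by
    intro t
    induction t with
    | zero => simp
    | add s s' hs hs' => simp only [map_add, hs, hs']
    | tmul x y => simp [evalLast_tmul]
  rw [doubleElement_eq, h, counit_exchangeElement, Algebra.TensorProduct.one_def, evalLast_tmul]
  simp

/-- `(h₂ ⊗ h₃ ⊗ h₁) R₃₁⁻¹ R₂₃ = R₃₁⁻¹ R₂₃ (h₁ ⊗ h₂ ⊗ h₃)`. -/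
lemma comul₃_exchangeElement (h : H) :
    TensorProduct.comm k H (H ⊗[k] H) (comul₃ k H h) * exchangeElement k H =
      exchangeElement k H * (TensorProduct.assoc k H H H).symm (comul₃ k H h) := by
  let α := Algebra.TensorProduct.assoc k k k H H H
  -- R₂₃ exchanges the last two factors: R₂₃ (h₁ ⊗ h₂ ⊗ h₃) = (h₁ ⊗ h₃ ⊗ h₂) R₂₃.
  have h1 : leg₂₃ k H (R k H) * α.symm (comul₃ k H h) =
      α.symm ((TensorProduct.comm k H H).toLinearMap.lTensor H (comul₃ k H h)) *
        leg₂₃ k H (R k H) := by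
    have e1 : ∀ t, α (leg₂₃ k H t) = 1 ⊗ₜ t := by
      intro t
      induction t with
      | zero => simp
      | add s s' hs hs' => simp only [map_add, TensorProduct.tmul_add, hs, hs']
      | tmul x y => simp [α, leg₂₃_tmul]
    apply α.injective
    rw [map_mul, map_mul, e1, AlgEquiv.apply_symm_apply, AlgEquiv.apply_symm_apply]
    change _ * (comul (R := k)).lTensor H (comul h) = _
    have e2 : ∀ t : H ⊗[k] H, (1 ⊗ₜ (R k H : H ⊗[k] H)) * (comul (R := k)).lTensor H t =
        (TensorProduct.comm k H H).toLinearMap.lTensor H ((comul (R := k)).lTensor H t) *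
          (1 ⊗ₜ (R k H : H ⊗[k] H)) := by
      intro t
      induction t with
      | zero => simp
      | add s s' hs hs' => simp only [map_add, add_mul, mul_add, hs, hs']
      | tmul x y => simp [comul_op]
    exact e2 _
  -- R₃₁⁻¹ then exchanges the outer legs: (h₂ ⊗ h₃ ⊗ h₁) R₃₁⁻¹ = R₃₁⁻¹ (h₁ ⊗ h₃ ⊗ h₂).
  have h2 : TensorProduct.comm k H (H ⊗[k] H) (comul₃ k H h) *
      leg₃₁ k H ((R k H)⁻¹ : (H ⊗[k] H)ˣ) = leg₃₁ k H ((R k H)⁻¹ : (H ⊗[k] H)ˣ) *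
      α.symm ((TensorProduct.comm k H H).toLinearMap.lTensor H (comul₃ k H h)) := by
    -- `τ` swaps legs 2 and 3. Through it the outer legs become adjacent, and the identity is one
    -- about (Δ ⊗ id)Δ multiplied by R₂₁⁻¹ ⊗ 1.
    let τ : (H ⊗[k] H) ⊗[k] H →ₐ[k] (H ⊗[k] H) ⊗[k] H :=
      α.symm.toAlgHom.comp ((Algebra.TensorProduct.map (AlgHom.id k H)
        (Algebra.TensorProduct.comm k H H).toAlgHom).comp α.toAlgHom)
    let X : (H ⊗[k] H) ⊗[k] H := (comul (R := k)).rTensor H (comul h)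
    have x0 : comul₃ k H h = α X := (Coalgebra.coassoc_apply h).symm
    have x1 : TensorProduct.comm k H (H ⊗[k] H) (comul₃ k H h) =
      τ ((TensorProduct.comm k H H).toLinearMap.rTensor H X) := by
      rw [x0]
      generalize X = X
      induction X with
      | zero => simp
      | add s s' hs hs' => simp only [map_add, hs, hs']
      | tmul x y =>
        induction x with
        | zero => simp
        | add s s' hs hs' => simp only [map_add, TensorProduct.add_tmul, hs, hs']
        | tmul z x => simp [τ, α]
    have x2 : α.symm ((TensorProduct.comm k H H).toLinearMap.lTensor H (comul₃ k H h)) =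
      τ X := by
      rw [x0]; rfl
    have x3 : ∀ t, leg₃₁ k H t = τ (TensorProduct.comm k H H t ⊗ₜ 1) := by
      intro t
      induction t with
      | zero => simp
      | add s s' hs hs' => simp only [map_add, TensorProduct.add_tmul, hs, hs']
      | tmul x y => simp [τ, α, leg₃₁_tmul]
    -- The flip of Δ(x) R⁻¹ = R⁻¹ Δᵒᵖ(x): the element R₂₁⁻¹ also intertwines Δ and Δᵒᵖ.
    have x4 : ∀ x : H, TensorProduct.comm k H H (comul x) *
        TensorProduct.comm k H H ((R k H)⁻¹ : (H ⊗[k] H)ˣ) =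
        TensorProduct.comm k H H ((R k H)⁻¹ : (H ⊗[k] H)ˣ) * comul (R := k) x := by
      intro x
      let γ := Algebra.TensorProduct.comm k H H
      change γ _ * γ _ = γ _ * _
      apply γ.injective
      have e : ∀ t, γ (γ t) = t := fun t => TensorProduct.comm_comm k H H t
      rw [map_mul, map_mul, e, e, Units.mul_inv_eq_iff_eq_mul, mul_assoc]
      change _ = _ * (TensorProduct.comm k H H (comul x) * (R k H : H ⊗[k] H))
      rw [comul_op, Units.inv_mul_cancel_left]
    have x5 : ∀ t : H ⊗[k] H,
        (TensorProduct.comm k H H).toLinearMap.rTensor H ((comul (R := k)).rTensor H t) *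
          (TensorProduct.comm k H H ((R k H)⁻¹ : (H ⊗[k] H)ˣ) ⊗ₜ 1) =
        (TensorProduct.comm k H H ((R k H)⁻¹ : (H ⊗[k] H)ˣ) ⊗ₜ 1) *
          (comul (R := k)).rTensor H t := by
      intro t
      induction t with
      | zero => simp
      | add s s' hs hs' => simp only [map_add, add_mul, mul_add, hs, hs']
      | tmul x y => simp [x4]
    rw [x1, x2, x3, ← map_mul, ← map_mul]
    exact congrArg τ (x5 _)
  rw [exchangeElement, ← mul_assoc, h2, mul_assoc, mul_assoc]
  exact congrArg _ h1.symm

end ExchangeElement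

/-! ### The map is a homomorphism of algebras and respects the counits -/

section Multiplicative

open Quasitriangular

variable {k H : Type*} [Field k] [Ring H] [HopfAlgebra k H] [Quasitriangular k H]

section

variable {k H : Type*} [Field k] [Ring H] [HopfAlgebra k H]

/-- Two ways to reach h₁ ⊗ (h₂ ⊗ h₃) ⊗ h₄. The product of the double supplies the right-hand form,
and the commutation with E, which acts on the last three factors together, needs the left-hand one.
-/
lemma coassoc_comul₃ (h : H) :
    (TensorProduct.assoc k H H H).symm.toLinearMap.lTensor H ((comul₃ k H).lTensor H (comul h)) =
      ((comul (R := k)).rTensor H).lTensor H (comul₃ k H h) := by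
  have : (TensorProduct.assoc k H H H).symm.toLinearMap.lTensor H ∘ₗ (comul₃ k H).lTensor H ∘ₗ
      comul = ((comul (R := k)).rTensor H).lTensor H ∘ₗ comul₃ k H := by
    simp only [comul₃, coassoc_simps]
  exact LinearMap.congr_fun this h

/-- `p ⊗ w ⊗ x ↦ w ⊗ S(p) x`. -/
def antipodeLast : H ⊗[k] ((H ⊗[k] H) ⊗[k] H) →ₗ[k] (H ⊗[k] H) ⊗[k] H :=
  TensorProduct.lift (LinearMap.mul k ((H ⊗[k] H) ⊗[k] H) ∘ₗ
    TensorProduct.mk k (H ⊗[k] H) H 1 ∘ₗ antipode k)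

lemma antipodeLast_tmul (p : H) (t : (H ⊗[k] H) ⊗[k] H) :
    antipodeLast (p ⊗ₜ[k] t) = (1 ⊗ₜ antipode k p) * t := rfl

end

/-- The unit of H* is the counit ε, and ε on leg 3 sends both R₂₃ and R₃₁⁻¹ to 1. -/
lemma doubleElement_one : doubleElement (1 : HDual k H) = 1 := by
  let e₁ := Algebra.TensorProduct.map (Bialgebra.counitAlgHom k H) (AlgHom.id k H)
  let e₂ := Algebra.TensorProduct.map (AlgHom.id k H) (Bialgebra.counitAlgHom k H)
  let π : (H ⊗[k] H) ⊗[k] H →ₐ[k] H ⊗[k] H :=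
    (Algebra.TensorProduct.rid k k (H ⊗[k] H)).toAlgHom.comp
      (Algebra.TensorProduct.map (AlgHom.id k (H ⊗[k] H)) (Bialgebra.counitAlgHom k H))
  have h0 : ∀ t, evalLast (1 : HDual k H) t = π t := by
    intro t
    induction t with
    | zero => simp
    | add s s' hs hs' => simp only [map_add, hs, hs']
    | tmul x y => simp [π, evalLast_tmul]
  have h1 : ∀ t, π (leg₂₃ k H t) = 1 ⊗ₜ TensorProduct.rid k H (e₂ t) := by
    intro t
    induction t with
    | zero => simp
    | add s s' hs hs' => simp only [map_add, TensorProduct.tmul_add, hs, hs']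
    | tmul x y => simp [π, e₂, leg₂₃_tmul]
  have h2 : ∀ t, π (leg₃₁ k H t) = TensorProduct.lid k H (e₁ t) ⊗ₜ 1 := by
    intro t
    induction t with
    | zero => simp
    | add s s' hs hs' => simp only [map_add, TensorProduct.add_tmul, hs, hs']
    | tmul x y => simp [π, e₁, leg₃₁_tmul, TensorProduct.smul_tmul']
  have h3 : e₁ ((R k H)⁻¹ : (H ⊗[k] H)ˣ) = 1 := by
    have := congr(e₁ $(Units.mul_inv (R k H)))
    rwa [map_mul, map_one, show e₁ (R k H) = 1 from map_counit_left k H, one_mul] at this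
  rw [doubleElement_eq, h0, exchangeElement, map_mul, h1, h2, h3,
    show e₂ (R k H) = 1 from map_counit_right k H]
  simp [Algebra.TensorProduct.one_def]

variable (k H) in
/-- `a ⊗ h ↦ ((id ⊗ id ⊗ a)(R₃₁⁻¹ R₂₃)) Δ(h)`. -/
def doubleToSquareₗ : DrinfeldDouble k H →ₗ[k] H ⊗[k] H :=
  LinearMap.mul' k (H ⊗[k] H) ∘ₗ TensorProduct.map (evalLastₗ (exchangeElement k H)) comul ∘ₗ
    (DrinfeldDouble.equiv k H).toLinearMap

lemma doubleToSquareₗ_tmul (a : HDual k H) (h : H) :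
    doubleToSquareₗ k H (DrinfeldDouble.tmul a h) = doubleElement a * comul h := rfl

/-- The functional is x ↦ b(S(p) x r), so S(p) and r can be absorbed into the last leg of E, on its
left and on its right. -/
lemma doubleElement_sandwich (b : HDual k H) (p r : H) :
    doubleElement (sandwich b (p ⊗ₜ[k] r)) =
      evalLast b ((1 ⊗ₜ antipode k p) * (exchangeElement k H * (1 ⊗ₜ r))) := by
  rw [doubleElement_eq]
  generalize exchangeElement k H = t
  induction t with
  | zero => simp
  | add s s' hs hs' => simp only [map_add, add_mul, mul_add, hs, hs']
  | tmul x y => simp [evalLast_tmul, sandwich_apply]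

/-- The cross relation of the double. Its left side is b evaluated on the last leg of (1 ⊗ 1 ⊗
S(h₁)) E (h₂ ⊗ h₃ ⊗ h₄). Moving E to the right gives (h₃ ⊗ h₄ ⊗ S(h₁) h₂) E, and the antipode axiom
leaves (Δh ⊗ 1) E. -/
lemma comul_mul_doubleElement [FiniteDimensional k H] (h : H) (b : HDual k H) :
    doubleToSquareₗ k H (DrinfeldDouble.tmul 1 h * DrinfeldDouble.tmul b 1) =
      comul h * doubleElement b := by
  have e0 : (DrinfeldDouble.tmul 1 h * DrinfeldDouble.tmul b 1 : DrinfeldDouble k H) =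
      (DrinfeldDouble.equiv k H).symm (crossAux b (comul₃ k H h)) := by
    rw [DrinfeldDouble.tmul_mul_tmul, cross_tmul]
    have : TensorProduct.map (LinearMap.mulRight k (1 : HDual k H)) (LinearMap.mulRight k (1 : H)) =
        LinearMap.id := by
      ext; simp
    rw [this]; rfl
  -- Stated for an arbitrary tensor in place of `comul₃ k H h`, so that it can be checked on pure
  -- tensors.
  have e1 : ∀ t, doubleToSquareₗ k H ((DrinfeldDouble.equiv k H).symm (crossAux b t)) =
      evalLast b (antipodeLast ((LinearMap.mulLeft k (exchangeElement k H)).lTensor H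
        (((comul (R := k)).rTensor H).lTensor H t))) := by
    intro t
    induction t with
    | zero => simp
    | add s s' hs hs' => simp only [map_add, hs, hs']
    | tmul p t =>
      induction t with
      | zero => simp
      | add s s' hs hs' => simp only [map_add, TensorProduct.tmul_add, hs, hs']
      | tmul q r =>
        have : doubleToSquareₗ k H ((DrinfeldDouble.equiv k H).symm
            (crossAux b (p ⊗ₜ[k] (q ⊗ₜ[k] r)))) =
            doubleElement (sandwich b (p ⊗ₜ[k] r)) * comul q := rfl
        rw [this, doubleElement_sandwich, ← evalLast_mul_includeLeft]
        simp [antipodeLast_tmul, mul_assoc]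
  -- The commutation of E with h₁ ⊗ h₂ ⊗ h₃, applied to the last three of four Sweedler factors.
  have e2 : ∀ t : H ⊗[k] H, antipodeLast ((LinearMap.mulLeft k (exchangeElement k H)).lTensor H
        ((TensorProduct.assoc k H H H).symm.toLinearMap.lTensor H ((comul₃ k H).lTensor H t))) =
      antipodeLast (((TensorProduct.comm k H (H ⊗[k] H)).toLinearMap.lTensor H
        ((comul₃ k H).lTensor H t))) * exchangeElement k H := by
    intro t
    induction t with
    | zero => simp
    | add s s' hs hs' => simp only [map_add, add_mul, hs, hs']
    | tmul x y => simp [antipodeLast_tmul, mul_assoc, comul₃_exchangeElement]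
  -- The cancellation S(h₁) h₂ ⊗ h₃ = 1 ⊗ h, after coassociativity has put the first two factors
  -- together.
  have e3 : antipodeLast (((TensorProduct.comm k H (H ⊗[k] H)).toLinearMap.lTensor H
        ((comul₃ k H).lTensor H (comul h)))) = comul (R := k) h ⊗ₜ 1 := by
    have h1 : ∀ t : H ⊗[k] H, antipodeLast
        ((TensorProduct.comm k H (H ⊗[k] H)).toLinearMap.lTensor H
        (((comul (R := k)).lTensor H).lTensor H
          ((TensorProduct.assoc k H H H) ((comul (R := k)).rTensor H t)))) =
        TensorProduct.comm k H (H ⊗[k] H) (TensorProduct.map (Algebra.linearMap k H) comul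
          ((counit (R := k)).rTensor H t)) := by
      intro t
      induction t with
      | zero => simp
      | add s s' hs hs' => simp only [map_add, hs, hs']
      | tmul x y =>
        have h2 : ∀ X : H ⊗[k] H, antipodeLast
            ((TensorProduct.comm k H (H ⊗[k] H)).toLinearMap.lTensor H
            (((comul (R := k)).lTensor H).lTensor H
              ((TensorProduct.assoc k H H H) (X ⊗ₜ[k] y)))) =
            comul y ⊗ₜ LinearMap.mul' k H ((antipode k).rTensor H X) := by
          intro X
          induction X with
          | zero => simp
          | add s s' hs hs' =>
            simp only [map_add, TensorProduct.add_tmul, TensorProduct.tmul_add, hs, hs']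
          | tmul p q => simp [antipodeLast_tmul]
        rw [LinearMap.rTensor_tmul, h2, mul_antipode_rTensor_comul_apply]
        simp
    rw [comul₃, LinearMap.lTensor_comp, LinearMap.comp_apply, ← Coalgebra.coassoc_apply, h1,
      Coalgebra.rTensor_counit_comul]
    simp
  rw [e0, e1, ← coassoc_comul₃, e2, e3, evalLast_includeLeft_mul, doubleElement_eq]

lemma doubleToSquareₗ_one_tmul (h : H) :
    doubleToSquareₗ k H (DrinfeldDouble.tmul 1 h) = comul h := by
  rw [doubleToSquareₗ_tmul, doubleElement_one, one_mul]

variable [FiniteDimensional k H]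

lemma doubleToSquareₗ_dual_mul (a : HDual k H) (G : DrinfeldDouble k H) :
    doubleToSquareₗ k H (DrinfeldDouble.tmul a 1 * G) =
      doubleElement a * doubleToSquareₗ k H G := by
  induction G using DrinfeldDouble.induction_on with
  | zero => simp
  | add F G hF hG => simp only [mul_add, map_add, hF, hG]
  | tmul b g =>
    rw [DrinfeldDouble.tmul_eq b g, ← mul_assoc, DrinfeldDouble.tmul_one_mul_tmul_one,
      ← DrinfeldDouble.tmul_eq, ← DrinfeldDouble.tmul_eq, doubleToSquareₗ_tmul,
      doubleToSquareₗ_tmul, doubleElement_mul, mul_assoc]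

lemma doubleToSquareₗ_mul_one_tmul (F : DrinfeldDouble k H) (g : H) :
    doubleToSquareₗ k H (F * DrinfeldDouble.tmul 1 g) = doubleToSquareₗ k H F * comul g := by
  induction F using DrinfeldDouble.induction_on with
  | zero => simp
  | add F G hF hG => simp only [add_mul, map_add, hF, hG]
  | tmul b h =>
    rw [DrinfeldDouble.tmul_eq b h, mul_assoc, DrinfeldDouble.one_tmul_mul_one_tmul,
      ← DrinfeldDouble.tmul_eq, ← DrinfeldDouble.tmul_eq, doubleToSquareₗ_tmul,
      doubleToSquareₗ_tmul, Bialgebra.comul_mul, mul_assoc]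

/-- D(H) is spanned by the products (a ⊗ 1)(1 ⊗ h). Factors from H* can be peeled off on the left
and factors from H on the right, so what remains is the cross relation. -/
lemma doubleToSquareₗ_mul (F G : DrinfeldDouble k H) :
    doubleToSquareₗ k H (F * G) = doubleToSquareₗ k H F * doubleToSquareₗ k H G := by
  induction F using DrinfeldDouble.induction_on with
  | zero => simp
  | add F F' hF hG => simp only [add_mul, map_add, hF, hG]
  | tmul a h =>
    rw [DrinfeldDouble.tmul_eq a h, mul_assoc, doubleToSquareₗ_dual_mul, doubleToSquareₗ_dual_mul,
      doubleToSquareₗ_one_tmul, mul_assoc]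
    congr 1
    -- Only left multiplication by 1 ⊗ h remains. For G = (b ⊗ 1)(1 ⊗ g), the right factor 1 ⊗ g is
    -- split off and `comul_mul_doubleElement` applies.
    induction G using DrinfeldDouble.induction_on with
    | zero => simp
    | add F F' hF hG => simp only [mul_add, map_add, hF, hG]
    | tmul b g =>
      rw [DrinfeldDouble.tmul_eq b g, ← mul_assoc, doubleToSquareₗ_mul_one_tmul,
        comul_mul_doubleElement, ← DrinfeldDouble.tmul_eq, doubleToSquareₗ_tmul, mul_assoc]

variable (k H) in
/-- The map from the quantum double to the twisted square as a homomorphism of algebras. -/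
def doubleToSquareAlgHom : DrinfeldDouble k H →ₐ[k] TwistedSquare k H :=
  (TwistedSquare.equiv k H).symm.toAlgHom.comp (AlgHom.ofLinearMap (doubleToSquareₗ k H)
    ((doubleToSquareₗ_one_tmul 1).trans (Bialgebra.comul_one)) doubleToSquareₗ_mul)

lemma counit_doubleToSquareAlgHom :
    (Bialgebra.counitAlgHom k (TwistedSquare k H)).comp (doubleToSquareAlgHom k H) =
      Bialgebra.counitAlgHom k (DrinfeldDouble k H) := by
  ext F
  change counit (R := k) (doubleToSquareₗ k H F) = counit (R := k) F
  induction F using DrinfeldDouble.induction_on with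
  | zero => simp
  | add F F' hF hG => simp only [map_add, hF, hG]
  | tmul a h =>
    rw [doubleToSquareₗ_tmul, Bialgebra.counit_mul, counit_doubleElement,
      DrinfeldDouble.counit_tmul]
    congr 1
    -- The counit ε ⊗ ε of H ⊗ H, written as ε after ε ⊗ id, so that the counit axiom gives ε(h) on
    -- Δ(h).
    have e : ∀ t : H ⊗[k] H, counit (R := k) t =
        counit (R := k) (TensorProduct.lid k H ((counit (R := k)).rTensor H t)) := by
      intro t
      induction t with
      | zero => simp
      | add F F' hF hG => simp only [map_add, hF, hG]
      | tmul x y => simp [mul_comm]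
    rw [e, Coalgebra.rTensor_counit_comul]
    simp

end Multiplicative

/-! ### The Yang–Baxter equation and the twisted coproduct -/

section Twist

open Quasitriangular

variable {k H : Type*} [Field k] [Ring H] [HopfAlgebra k H]

/-- Allows the twisted coproduct, which is Δ conjugated by R₂₃, to be applied to E, with the
evaluated leg carried along unchanged. -/
lemma map_eq_conj {A W : Type*} [Ring A] [Algebra k A] [Ring W] [Algebra k W] (f g : A →ₐ[k] W)
    (u v : W) (h : ∀ x, f x = u * (g x * v)) (t : A ⊗[k] H) :
    Algebra.TensorProduct.map f (AlgHom.id k H) t =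
      (u ⊗ₜ 1) * (Algebra.TensorProduct.map g (AlgHom.id k H) t * (v ⊗ₜ 1)) := by
  induction t with
  | zero => simp
  | add s s' hs hs' => simp only [map_add, add_mul, mul_add, hs, hs']
  | tmul w z => simp [h]

/-- The algebra behind `twistComul_exchangeElement`: `m`, `f₁`, `f₂`, `g₁`, `g₂` stand for R placed
in legs 23, 51, 53, 25, 45. The Yang–Baxter hypothesis amounts to R₂₃⁻¹ R₅₃⁻¹ R₂₅ R₂₃ = R₂₅ R₅₃⁻¹,
while R₅₁ and R₄₅ have no leg in common with R₂₃ and pass through it. -/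
lemma conj_mul_eq_of_yangBaxter {A V : Type*} [Semiring A] [Algebra k A] [Semiring V] [Algebra k V]
    (u : Aˣ) (m f₁ f₂ g₁ g₂ : A →ₐ[k] V) (h : g₁ u * (m u * f₂ u) = f₂ u * (m u * g₁ u))
    (c₁ : ∀ s t, m s * f₁ t = f₁ t * m s) (c₂ : ∀ s t, g₂ s * m t = m t * g₂ s) :
    m (u⁻¹ : Aˣ) * (f₁ (u⁻¹ : Aˣ) * f₂ (u⁻¹ : Aˣ) * (g₁ u * g₂ u) * m u) =
      f₁ (u⁻¹ : Aˣ) * g₁ u * (f₂ (u⁻¹ : Aˣ) * g₂ u) := by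
  have inv : ∀ f : A →ₐ[k] V, f (u⁻¹ : Aˣ) * f u = 1 ∧ f u * f (u⁻¹ : Aˣ) = 1 := by
    intro f
    rw [← map_mul, ← map_mul, Units.inv_mul, Units.mul_inv, map_one]
    exact ⟨rfl, rfl⟩
  have e : g₁ u * m u = f₂ u * (m u * (g₁ u * f₂ (u⁻¹ : Aˣ))) := by
    have := congr($h * f₂ (u⁻¹ : Aˣ))
    simpa only [mul_assoc, (inv f₂).2, mul_one] using this
  have h' : m (u⁻¹ : Aˣ) * (f₂ (u⁻¹ : Aˣ) * (g₁ u * m u)) = g₁ u * f₂ (u⁻¹ : Aˣ) := by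
    rw [e, ← mul_assoc (f₂ (u⁻¹ : Aˣ)), (inv f₂).1, one_mul, ← mul_assoc, (inv m).1, one_mul]
  calc m (u⁻¹ : Aˣ) * (f₁ (u⁻¹ : Aˣ) * f₂ (u⁻¹ : Aˣ) * (g₁ u * g₂ u) * m u)
      = (m (u⁻¹ : Aˣ) * f₁ (u⁻¹ : Aˣ)) * (f₂ (u⁻¹ : Aˣ) * (g₁ u * (g₂ u * m u))) := by
        simp only [mul_assoc]
    _ = f₁ (u⁻¹ : Aˣ) * ((m (u⁻¹ : Aˣ) * (f₂ (u⁻¹ : Aˣ) * (g₁ u * m u))) * g₂ u) := by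
        rw [c₁, c₂]; simp only [mul_assoc]
    _ = _ := by rw [h']; simp only [mul_assoc]

/-- Together with `comul_tmul_one`, this reduces the coproduct of H ⊗ H on a single leg to that of
H, which is where the hexagon axioms apply: each factor of E touches only one of the first two legs.
-/
lemma comul_one_tmul (x : H) : comul (R := k) (1 ⊗ₜ[k] x : H ⊗[k] H) =
    Algebra.TensorProduct.map Algebra.TensorProduct.includeRight
      Algebra.TensorProduct.includeRight (comul (R := k) x) := by
  rw [TensorProduct.comul_tmul, Bialgebra.comul_one]
  generalize comul (R := k) x = t
  induction t with
  | zero => simp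
  | add s t hs ht => simp only [TensorProduct.tmul_add, map_add, hs, ht]
  | tmul a b => simp [Algebra.TensorProduct.one_def]

lemma comul_tmul_one (x : H) : comul (R := k) (x ⊗ₜ[k] 1 : H ⊗[k] H) =
    Algebra.TensorProduct.map (Algebra.TensorProduct.includeLeft (R := k) (S := k))
      (Algebra.TensorProduct.includeLeft (R := k) (S := k)) (comul (R := k) x) := by
  rw [TensorProduct.comul_tmul, Bialgebra.comul_one]
  generalize comul (R := k) x = t
  induction t with
  | zero => simp
  | add s t hs ht => simp only [TensorProduct.add_tmul, map_add, hs, ht]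
  | tmul a b => simp [Algebra.TensorProduct.one_def]

/-- `x ⊗ y ⊗ z ↦ x ⊗ y ⊗ 1 ⊗ 1 ⊗ z`. -/
def outerLeft : (H ⊗[k] H) ⊗[k] H →ₐ[k] ((H ⊗[k] H) ⊗[k] (H ⊗[k] H)) ⊗[k] H :=
  Algebra.TensorProduct.map Algebra.TensorProduct.includeLeft (AlgHom.id k H)

/-- `x ⊗ y ⊗ z ↦ 1 ⊗ 1 ⊗ x ⊗ y ⊗ z`. -/
def outerRight : (H ⊗[k] H) ⊗[k] H →ₐ[k] ((H ⊗[k] H) ⊗[k] (H ⊗[k] H)) ⊗[k] H :=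
  Algebra.TensorProduct.map Algebra.TensorProduct.includeRight (AlgHom.id k H)

lemma outerLeft_tmul (w : H ⊗[k] H) (z : H) : outerLeft (w ⊗ₜ[k] z) = (w ⊗ₜ 1) ⊗ₜ z := rfl
lemma outerRight_tmul (w : H ⊗[k] H) (z : H) : outerRight (w ⊗ₜ[k] z) = (1 ⊗ₜ w) ⊗ₜ z := rfl

lemma evalLastₗ_outerLeft (t : (H ⊗[k] H) ⊗[k] H) : evalLastₗ (outerLeft t) =
    (TensorProduct.mk k (H ⊗[k] H) (H ⊗[k] H)).flip 1 ∘ₗ evalLastₗ t := by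
  induction t with
  | zero => simp [evalLastₗ_zero]
  | add s s' hs hs' => simp only [map_add, evalLastₗ_add, LinearMap.comp_add, hs, hs']
  | tmul w z =>
    ext1 a
    simp [outerLeft_tmul, evalLastₗ_tmul, TensorProduct.smul_tmul']

lemma evalLastₗ_outerRight (t : (H ⊗[k] H) ⊗[k] H) : evalLastₗ (outerRight t) =
    TensorProduct.mk k (H ⊗[k] H) (H ⊗[k] H) 1 ∘ₗ evalLastₗ t := by
  induction t with
  | zero => simp [evalLastₗ_zero]
  | add s s' hs hs' => simp only [map_add, evalLastₗ_add, LinearMap.comp_add, hs, hs']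
  | tmul w z =>
    ext1 a
    simp [outerRight_tmul, evalLastₗ_tmul]

/-- The two factors share only the evaluated leg, so by `evalLast_mul` evaluation gives the tensor
product of the evaluation of s at a₁ and of t at a₂. -/
lemma evalLast_outer [FiniteDimensional k H] (a : HDual k H) (s t : (H ⊗[k] H) ⊗[k] H) :
    evalLast a (outerLeft s * outerRight t) =
      TensorProduct.map (evalLastₗ s) (evalLastₗ t) (comul (R := k) a) := by
  rw [evalLast_mul, evalLastₗ_outerLeft, evalLastₗ_outerRight]
  generalize comul (R := k) a = X
  induction X with
  | zero => simp
  | add s s' hs hs' => simp only [map_add, hs, hs']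
  | tmul b c => simp

variable [Quasitriangular k H]

variable (k H) in
/-- `R₁₂ R₁₃ R₂₃ = R₂₃ R₁₃ R₁₂`. -/
lemma yangBaxter : leg₁₂ k H (R k H) * (leg₁₃ k H (R k H) * leg₂₃ k H (R k H)) =
    leg₂₃ k H (R k H) * (leg₁₃ k H (R k H) * leg₁₂ k H (R k H)) := by
  let α := Algebra.TensorProduct.assoc k k k H H H
  -- `ν` swaps legs 2 and 3, so it turns id ⊗ Δ into id ⊗ Δᵒᵖ.
  let ν : (H ⊗[k] H) ⊗[k] H →ₐ[k] (H ⊗[k] H) ⊗[k] H :=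
    α.symm.toAlgHom.comp ((Algebra.TensorProduct.map (AlgHom.id k H)
      (Algebra.TensorProduct.comm k H H).toAlgHom).comp α.toAlgHom)
  have h1 : ∀ t, ν (leg₁₃ k H t) = leg₁₂ k H t := by
    intro t
    induction t with
    | zero => simp
    | add s t hs ht => simp only [map_add, hs, ht]
    | tmul a b => simp [ν, α, leg₁₂_tmul, leg₁₃_tmul]
  have h2 : ∀ t, ν (leg₁₂ k H t) = leg₁₃ k H t := by
    intro t
    induction t with
    | zero => simp
    | add s t hs ht => simp only [map_add, hs, ht]
    | tmul a b => simp [ν, α, leg₁₂_tmul, leg₁₃_tmul]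
  have h3 : ∀ t, leg₂₃ k H (R k H) * α.symm (TensorProduct.map LinearMap.id comul t) =
      ν (α.symm (TensorProduct.map LinearMap.id comul t)) * leg₂₃ k H (R k H) := by
    have e1 : ∀ t, leg₂₃ k H t = α.symm (1 ⊗ₜ t) := by
      intro t
      induction t with
      | zero => simp
      | add s s' hs hs' => simp only [map_add, TensorProduct.tmul_add, hs, hs']
      | tmul x y => simp [α, leg₂₃_tmul]
    intro t
    rw [e1, show ν (α.symm (TensorProduct.map LinearMap.id comul t)) =
      α.symm ((TensorProduct.comm k H H).toLinearMap.lTensor H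
        (TensorProduct.map LinearMap.id comul t)) by
        change α.symm ((TensorProduct.comm k H H).toLinearMap.lTensor H (α (α.symm _))) = _
        rw [AlgEquiv.apply_symm_apply], ← map_mul, ← map_mul]
    congr 1
    induction t with
    | zero => simp
    | add s s' hs hs' => simp only [map_add, add_mul, mul_add, hs, hs']
    | tmul x y => simp [comul_op]
  have h4 : α.symm (TensorProduct.map LinearMap.id comul (R k H)) =
    leg₁₃ k H (R k H) * leg₁₂ k H (R k H) := comul_right
  -- R₂₃ (id ⊗ Δ)(R) = (id ⊗ Δᵒᵖ)(R) R₂₃, where the hexagon axiom gives (id ⊗ Δ)(R) = R₁₃ R₁₂ and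
  -- hence (id ⊗ Δᵒᵖ)(R) = R₁₂ R₁₃.
  have := h3 (R k H)
  rw [h4, map_mul, h1, h2] at this
  rw [this, mul_assoc]

/-- The coproduct of H ⊗ H sends Δh to h₁ ⊗ h₃ ⊗ h₂ ⊗ h₄. Its middle pair is Δᵒᵖ of a Sweedler
factor, and R⁻¹ Δᵒᵖ R = Δ. Thus Δ is a coalgebra map into the twisted square. -/
lemma twistComul_comul (h : H) : twistComul (twistUnit k H) (comul (R := k) h) =
    TensorProduct.map comul comul (comul (R := k) h) := by
  -- `J` only regroups: in its source the two middle legs form one factor, on which R₂₃ acts.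
  let J : H ⊗[k] ((H ⊗[k] H) ⊗[k] H) →ₗ[k] (H ⊗[k] H) ⊗[k] (H ⊗[k] H) :=
    (TensorProduct.assoc k H H (H ⊗[k] H)).symm.toLinearMap ∘ₗ
      LinearMap.lTensor H (TensorProduct.assoc k H H H).toLinearMap
  have hJ : ∀ x y z w : H, J (x ⊗ₜ ((y ⊗ₜ z) ⊗ₜ w)) = (x ⊗ₜ y) ⊗ₜ (z ⊗ₜ w) := by
    intros; rfl
  have e1 : TensorProduct.map comul comul (comul (R := k) h) =
      J (((comul (R := k)).rTensor H).lTensor H (comul₃ k H h)) :=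
    LinearMap.congr_fun (comul_comul k H) h
  have e2 : comul (R := k) (comul (R := k) h) =
      TensorProduct.AlgebraTensorModule.tensorTensorTensorComm k k k k H H H H
        (TensorProduct.map comul comul (comul (R := k) h)) := by
    generalize comul (R := k) h = t
    induction t with
    | zero => simp
    | add s s' hs hs' => simp only [map_add, hs, hs']
    | tmul x y => rw [TensorProduct.comul_tmul]; rfl
  have e3 : ∀ t, TensorProduct.AlgebraTensorModule.tensorTensorTensorComm k k k k H H H H (J t) =
      J (((TensorProduct.comm k H H).toLinearMap.rTensor H).lTensor H t) := by
    intro t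
    induction t with
    | zero => simp
    | add s s' hs hs' => simp only [map_add, hs, hs']
    | tmul x t =>
      induction t with
      | zero => simp
      | add s s' hs hs' => simp only [map_add, TensorProduct.tmul_add, hs, hs']
      | tmul t w =>
        induction t with
        | zero => simp
        | add s s' hs hs' =>
          simp only [map_add, TensorProduct.tmul_add, TensorProduct.add_tmul, hs, hs']
        | tmul y z => simp [hJ]
  have e4 : ∀ (s X : H ⊗[k] H) (x w : H), middle k H s * J (x ⊗ₜ (X ⊗ₜ w)) =
      J (x ⊗ₜ ((s * X) ⊗ₜ w)) := by
    intro s X x w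
    induction s with
    | zero => simp
    | add s s' hs hs' =>
      simp only [map_add, add_mul, TensorProduct.tmul_add, TensorProduct.add_tmul, hs, hs']
    | tmul p q =>
      induction X with
      | zero => simp
      | add s s' hs hs' =>
        simp only [map_add, mul_add, TensorProduct.tmul_add, TensorProduct.add_tmul, hs, hs']
      | tmul y z => simp [hJ, middle_tmul]
  have e5 : ∀ (s X : H ⊗[k] H) (x w : H), J (x ⊗ₜ (X ⊗ₜ w)) * middle k H s =
      J (x ⊗ₜ ((X * s) ⊗ₜ w)) := by
    intro s X x w
    induction s with
    | zero => simp
    | add s s' hs hs' =>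
      simp only [map_add, mul_add, TensorProduct.tmul_add, TensorProduct.add_tmul, hs, hs']
    | tmul p q =>
      induction X with
      | zero => simp
      | add s s' hs hs' =>
        simp only [map_add, add_mul, TensorProduct.tmul_add, TensorProduct.add_tmul, hs, hs']
      | tmul y z => simp [hJ, middle_tmul]
  -- Δᵒᵖ R = R Δ in the middle pair.
  have e6 : ∀ t : H ⊗[k] (H ⊗[k] H), J (((TensorProduct.comm k H H).toLinearMap.rTensor H).lTensor H
      (((comul (R := k)).rTensor H).lTensor H t)) * middle k H (R k H) =
      middle k H (R k H) * J (((comul (R := k)).rTensor H).lTensor H t) := by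
    intro t
    induction t with
    | zero => simp
    | add s s' hs hs' => simp only [map_add, add_mul, mul_add, hs, hs']
    | tmul x t =>
      induction t with
      | zero => simp
      | add s s' hs hs' =>
        simp only [map_add, TensorProduct.tmul_add, add_mul, mul_add, hs, hs']
      | tmul y z =>
        simp only [LinearMap.lTensor_tmul, LinearMap.rTensor_tmul, LinearEquiv.coe_coe]
        rw [e4, e5, comul_op]
  rw [twistComul_apply, e2, e1, e3, coe_twistUnit, e6, ← coe_twistUnit, Units.inv_mul_cancel_left]

variable (k H) in
/-- `R₂₃⁻¹ (Δ ⊗ id)(R₃₁⁻¹ R₂₃) R₂₃ = (R₅₁⁻¹ R₂₅) (R₅₃⁻¹ R₄₅)`. -/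
lemma twistComul_exchangeElement :
    Algebra.TensorProduct.map (twistComul (twistUnit k H)) (AlgHom.id k H) (exchangeElement k H) =
      outerLeft (exchangeElement k H) * outerRight (exchangeElement k H) := by
  let r : H ⊗[k] H := ((R k H)⁻¹ : (H ⊗[k] H)ˣ)
  let iL : H →ₐ[k] H ⊗[k] H := Algebra.TensorProduct.includeLeft
  let iR : H →ₐ[k] H ⊗[k] H := Algebra.TensorProduct.includeRight
  let d : (H ⊗[k] H) ⊗[k] H →ₐ[k] ((H ⊗[k] H) ⊗[k] (H ⊗[k] H)) ⊗[k] H :=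
    Algebra.TensorProduct.map (Bialgebra.comulAlgHom k (H ⊗[k] H)) (AlgHom.id k H)
  let m : H ⊗[k] H →ₐ[k] ((H ⊗[k] H) ⊗[k] (H ⊗[k] H)) ⊗[k] H := Algebra.TensorProduct.includeLeft.comp (middle k H)
  let L₅₁ : H ⊗[k] H →ₐ[k] ((H ⊗[k] H) ⊗[k] (H ⊗[k] H)) ⊗[k] H := outerLeft.comp (leg₃₁ k H)
  let L₅₃ : H ⊗[k] H →ₐ[k] ((H ⊗[k] H) ⊗[k] (H ⊗[k] H)) ⊗[k] H := outerRight.comp (leg₃₁ k H)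
  let L₂₅ : H ⊗[k] H →ₐ[k] ((H ⊗[k] H) ⊗[k] (H ⊗[k] H)) ⊗[k] H := outerLeft.comp (leg₂₃ k H)
  let L₄₅ : H ⊗[k] H →ₐ[k] ((H ⊗[k] H) ⊗[k] (H ⊗[k] H)) ⊗[k] H := outerRight.comp (leg₂₃ k H)
  have h0 : ∀ t, Algebra.TensorProduct.map (twistComul (twistUnit k H)) (AlgHom.id k H) t =
      m r * (d t * m (R k H)) := by
    exact map_eq_conj (twistComul (twistUnit k H)) (Bialgebra.comulAlgHom k (H ⊗[k] H))
      (middle k H r) (middle k H (R k H)) (fun _ => rfl)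
  -- The coproduct of H ⊗ H duplicates leg 2 into legs 2 and 4, and leg 1 into legs 1 and 3. So R₂₃
  -- becomes R₂₅ R₄₅ by (Δ ⊗ id)R = R₁₃ R₂₃, and in `h2` R₃₁ becomes R₅₃ R₅₁ by (id ⊗ Δ)R = R₁₃ R₁₂.
  have h1 : d (leg₂₃ k H (R k H)) = L₂₅ (R k H) * L₄₅ (R k H) := by
    let j : (H ⊗[k] H) ⊗[k] H →ₐ[k] ((H ⊗[k] H) ⊗[k] (H ⊗[k] H)) ⊗[k] H :=
      Algebra.TensorProduct.map (Algebra.TensorProduct.map iR iR) (AlgHom.id k H)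
    have e1 : ∀ t, d (leg₂₃ k H t) = j (TensorProduct.map comul LinearMap.id t) := by
      intro t
      induction t with
      | zero => simp
      | add s s' hs hs' => simp only [map_add, hs, hs']
      | tmul x y =>
        have : d (leg₂₃ k H (x ⊗ₜ[k] y)) = comul (R := k) (1 ⊗ₜ[k] x : H ⊗[k] H) ⊗ₜ y := rfl
        rw [this, comul_one_tmul]
        rfl
    have e2 : ∀ t, j (leg₁₃ k H t) = L₂₅ t := by
      intro t
      induction t with
      | zero => simp
      | add s s' hs hs' => simp only [map_add, hs, hs']
      | tmul x y => simp [L₂₅, j, iR, leg₁₃_tmul, leg₂₃_tmul, outerLeft_tmul,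
          Algebra.TensorProduct.one_def]
    have e3 : ∀ t, j (leg₂₃ k H t) = L₄₅ t := by
      intro t
      induction t with
      | zero => simp
      | add s s' hs hs' => simp only [map_add, hs, hs']
      | tmul x y => simp [L₄₅, j, iR, leg₂₃_tmul, outerRight_tmul,
          Algebra.TensorProduct.one_def]
    rw [e1, comul_left, map_mul, e2, e3]
  have h2 : d (leg₃₁ k H (R k H)) = L₅₃ (R k H) * L₅₁ (R k H) := by
    let j : (H ⊗[k] H) ⊗[k] H →ₐ[k] ((H ⊗[k] H) ⊗[k] (H ⊗[k] H)) ⊗[k] H :=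
      (Algebra.TensorProduct.comm k H ((H ⊗[k] H) ⊗[k] (H ⊗[k] H))).toAlgHom.comp
        ((Algebra.TensorProduct.map (AlgHom.id k H) (Algebra.TensorProduct.map iL iL)).comp
          (Algebra.TensorProduct.assoc k k k H H H).toAlgHom)
    have e1 : ∀ t, d (leg₃₁ k H t) = j ((TensorProduct.assoc k H H H).symm
        (TensorProduct.map LinearMap.id comul t)) := by
      intro t
      induction t with
      | zero => simp
      | add s s' hs hs' => simp only [map_add, hs, hs']
      | tmul x y =>
        have : d (leg₃₁ k H (x ⊗ₜ[k] y)) = comul (R := k) (y ⊗ₜ[k] 1 : H ⊗[k] H) ⊗ₜ x := rfl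
        rw [this, comul_tmul_one, TensorProduct.map_tmul]
        generalize comul (R := k) y = Y
        induction Y with
        | zero => simp
        | add s s' hs hs' =>
          simp only [map_add, TensorProduct.add_tmul, TensorProduct.tmul_add, hs, hs']
        | tmul y z => simp [j, iL]
    have e2 : ∀ t, j (leg₁₃ k H t) = L₅₃ t := by
      intro t
      induction t with
      | zero => simp
      | add s s' hs hs' => simp only [map_add, hs, hs']
      | tmul x y => simp [L₅₃, j, iL, leg₁₃_tmul, leg₃₁_tmul, outerRight_tmul,
          Algebra.TensorProduct.one_def]
    have e3 : ∀ t, j (leg₁₂ k H t) = L₅₁ t := by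
      intro t
      induction t with
      | zero => simp
      | add s s' hs hs' => simp only [map_add, hs, hs']
      | tmul x y => simp [L₅₁, j, iL, leg₁₂_tmul, leg₃₁_tmul, outerLeft_tmul,
          Algebra.TensorProduct.one_def]
    rw [e1, comul_right, map_mul, e2, e3]
  have h3 :=
    map_inv_of_map_eq_mul (d.comp (leg₃₁ k H)) L₅₃ L₅₁ (R k H) h2
  change d (leg₃₁ k H r) = L₅₁ r * L₅₃ r at h3
  -- The Yang–Baxter equation in legs 2, 5, 3, in this order; `y` performs the relabelling 1, 2, 3 ↦
  -- 2, 5, 3.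
  have h4 : L₂₅ (R k H) * (m (R k H) * L₅₃ (R k H)) =
      L₅₃ (R k H) * (m (R k H) * L₂₅ (R k H)) := by
    let α := Algebra.TensorProduct.assoc k k k H H H
    let y : (H ⊗[k] H) ⊗[k] H →ₐ[k] ((H ⊗[k] H) ⊗[k] (H ⊗[k] H)) ⊗[k] H :=
      (Algebra.TensorProduct.map (middle k H) (AlgHom.id k H)).comp
      (α.symm.toAlgHom.comp ((Algebra.TensorProduct.map (AlgHom.id k H)
        (Algebra.TensorProduct.comm k H H).toAlgHom).comp α.toAlgHom))
    have e1 : ∀ t, y (leg₁₂ k H t) = L₂₅ t := by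
      intro t
      induction t with
      | zero => simp
      | add s s' hs hs' => simp only [map_add, hs, hs']
      | tmul p q => simp [y, α, L₂₅, leg₁₂_tmul, leg₂₃_tmul, outerLeft_tmul, middle_tmul,
          Algebra.TensorProduct.one_def]
    have e2 : ∀ t, y (leg₁₃ k H t) = m t := by
      intro t
      induction t with
      | zero => simp
      | add s s' hs hs' => simp only [map_add, hs, hs']
      | tmul p q => simp [y, α, m, leg₁₃_tmul, middle_tmul]
    have e3 : ∀ t, y (leg₂₃ k H t) = L₅₃ t := by
      intro t
      induction t with
      | zero => simp
      | add s s' hs hs' => simp only [map_add, hs, hs']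
      | tmul p q => simp [y, α, L₅₃, leg₂₃_tmul, leg₃₁_tmul, outerRight_tmul, middle_tmul,
          Algebra.TensorProduct.one_def]
    have := congrArg y (yangBaxter k H)
    simpa only [map_mul, e1, e2, e3] using this
  -- Legs 2, 3 are disjoint from 5, 1, and in `c2` from 4, 5.
  have c1 : ∀ s t, m s * L₅₁ t = L₅₁ t * m s := by
    refine mul_comm_of_tmul m L₅₁ fun x y p q => ?_
    simp [m, L₅₁, middle_tmul, leg₃₁_tmul, outerLeft_tmul]
  have c2 : ∀ s t, L₄₅ s * m t = m t * L₄₅ s := by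
    refine mul_comm_of_tmul L₄₅ m fun x y p q => ?_
    simp [m, L₄₅, middle_tmul, leg₂₃_tmul, outerRight_tmul]
  rw [h0, exchangeElement, map_mul, map_mul, map_mul, h1]
  change m r * (d (leg₃₁ k H r) * _ * _) = L₅₁ r * L₂₅ (R k H) * (L₅₃ r * L₄₅ (R k H))
  rw [h3]
  exact conj_mul_eq_of_yangBaxter (R k H) m L₅₁ L₅₃ L₂₅ L₄₅ h4 c1 c2

/-- a ↦ (id ⊗ id ⊗ a)(E) is a coalgebra map into the twisted square, because the twisted coproduct
of E is a product of two copies of E sharing only the last leg. -/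
lemma twistComul_doubleElement [FiniteDimensional k H] (a : HDual k H) :
    twistComul (twistUnit k H) (doubleElement a) =
      TensorProduct.map (evalLastₗ (exchangeElement k H)) (evalLastₗ (exchangeElement k H))
        (comul (R := k) a) := by
  rw [← evalLast_outer, ← twistComul_exchangeElement, doubleElement_eq]
  generalize exchangeElement k H = t
  induction t with
  | zero => simp
  | add s s' hs hs' => simp only [map_add, hs, hs']
  | tmul w x => simp [evalLast_tmul]

end Twist

section HopfStructure

/-! ### Bialgebra homomorphisms and antipodes -/

section Antipode

open LinearMap WithConv

/-- A homomorphism of bialgebras between Hopf algebras commutes with the antipodes. -/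
lemma map_antipode {k A B : Type*} [Field k] [Ring A] [Ring B] [HopfAlgebra k A] [HopfAlgebra k B]
    (f : A →ₐc[k] B) (x : A) : f (antipode k x) = antipode k (f x) := by
  -- In the convolution algebra of maps A → B, f ∘ S is a left inverse of f because f is
  -- multiplicative, and S ∘ f is a right inverse because f is comultiplicative. The two inverses
  -- therefore agree.
  have h1 : (toConv ((f : A →ₗ[k] B) ∘ₗ antipode k) * toConv (f : A →ₗ[k] B) :
      WithConv (A →ₗ[k] B)) = 1 := by
    have h := algHom_comp_convMul_distrib (f : A →ₐ[k] B) (toConv (antipode k)) (toConv .id)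
    rw [antipode_mul_id, algHom_comp_convOne] at h
    exact ofConv_injective h.symm
  have h2 : (toConv (f : A →ₗ[k] B) * toConv (antipode k ∘ₗ (f : A →ₗ[k] B)) :
      WithConv (A →ₗ[k] B)) = 1 := by
    have h := convMul_comp_coalgHom_distrib (toConv .id) (toConv (antipode k)) (f : A →ₗc[k] B)
    rw [id_mul_antipode, convOne_comp_coalgHom] at h
    exact ofConv_injective h.symm
  exact congr(($(left_inv_eq_right_inv h1 h2)).ofConv x)

end Antipode

open Quasitriangular

variable {k H : Type*} [Field k] [Ring H] [HopfAlgebra k H]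

/-! ### The map is a homomorphism of bialgebras -/

section Coproduct

variable [Quasitriangular k H] [FiniteDimensional k H]

/-- The twisted coproduct is an algebra map, so it can be computed separately on the factors (id ⊗
id ⊗ a)(E) and Δh. The tensor product coproduct of the double then pairs a₁ with h₁ and a₂ with h₂.
-/
lemma comul_doubleToSquareₗ (F : DrinfeldDouble k H) :
    twistComul (twistUnit k H) (doubleToSquareₗ k H F) =
      TensorProduct.map (doubleToSquareₗ k H) (doubleToSquareₗ k H) (comul (R := k) F) := by
  induction F using DrinfeldDouble.induction_on with
  | zero => simp
  | add F F' hF hG => simp only [map_add, hF, hG]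
  | tmul a h =>
    rw [doubleToSquareₗ_tmul, map_mul, twistComul_doubleElement, twistComul_comul,
      DrinfeldDouble.comul_tmul]
    generalize comul (R := k) a = s
    generalize comul (R := k) h = t
    induction s with
    | zero => simp
    | add s s' hs hs' => simp only [map_add, add_mul, TensorProduct.add_tmul, hs, hs']
    | tmul b c =>
      induction t with
      | zero => simp
      | add s s' hs hs' => simp only [map_add, mul_add, TensorProduct.tmul_add, hs, hs']
      | tmul x y =>
        rw [TensorProduct.map_tmul, TensorProduct.map_tmul, Algebra.TensorProduct.tmul_mul_tmul]
        rfl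

lemma comul_doubleToSquareAlgHom :
    (Algebra.TensorProduct.map (doubleToSquareAlgHom k H) (doubleToSquareAlgHom k H)).comp
      (Bialgebra.comulAlgHom k (DrinfeldDouble k H)) =
      (Bialgebra.comulAlgHom k (TwistedSquare k H)).comp (doubleToSquareAlgHom k H) := by
  ext F
  have h := comul_doubleToSquareₗ F
  -- The coproduct of the twisted square is built through identifications that are identities;
  -- `comul_eq` removes them.
  have e := LinearMap.congr_fun (TwistedSquare.comul_eq k H) (doubleToSquareAlgHom k H F)
  exact (e.trans h).symm

variable (k H) in
/-- The map from the quantum double to the twisted square as a homomorphism of bialgebras. -/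
def doubleToSquareBialgHom : DrinfeldDouble k H →ₐc[k] TwistedSquare k H :=
  BialgHom.ofAlgHom (doubleToSquareAlgHom k H) counit_doubleToSquareAlgHom
    comul_doubleToSquareAlgHom

end Coproduct

/-! ### Factorisability and the inverse map -/

section Inverse

variable (k H) in
/-- `x ⊗ g ↦ x g₁ ⊗ g₂`. -/
def comulShear : H ⊗[k] H →ₗ[k] H ⊗[k] H :=
  LinearMap.mul' k (H ⊗[k] H) ∘ₗ
    TensorProduct.map ((TensorProduct.mk k H H).flip 1) comul

lemma comulShear_tmul (x g : H) : comulShear k H (x ⊗ₜ[k] g) = (x ⊗ₜ 1) * comul g := rfl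

/-- h ⊗ g goes to h S(g₁) g₂ ⊗ g₃ = h ⊗ g. Only this composite is needed, since a right inverse of
the whole map is enough. -/
lemma comulShear_antipodeShear (t : H ⊗[k] H) : comulShear k H (antipodeShear t) = t := by
  induction t with
  | zero => simp
  | add s s' hs hs' => simp only [map_add, hs, hs']
  | tmul h g =>
    have h1 : ∀ t : H ⊗[k] H, comulShear k H ((LinearMap.mul' k H ∘ₗ
        (antipode k).lTensor H).rTensor H ((TensorProduct.assoc k H H H).symm (h ⊗ₜ t))) =
        (h ⊗ₜ 1) * (LinearMap.mul' k H ∘ₗ (antipode k).rTensor H).rTensor H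
          ((TensorProduct.assoc k H H H).symm ((comul (R := k)).lTensor H t)) := by
      intro t
      induction t with
      | zero => simp
      | add s s' hs hs' => simp only [map_add, TensorProduct.tmul_add, mul_add, hs, hs']
      | tmul x y =>
        rw [LinearMap.lTensor_tmul, TensorProduct.assoc_symm_tmul, LinearMap.rTensor_tmul,
          comulShear_tmul]
        generalize comul (R := k) y = Y
        induction Y with
        | zero => simp
        | add s s' hs hs' => simp only [map_add, TensorProduct.tmul_add, mul_add, hs, hs']
        | tmul y z => simp [mul_assoc]
    have h2 : antipodeShear (h ⊗ₜ[k] g) = (LinearMap.mul' k H ∘ₗ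
        (antipode k).lTensor H).rTensor H
          ((TensorProduct.assoc k H H H).symm (h ⊗ₜ comul (R := k) g)) := rfl
    -- Coassociativity brings g₁ and g₂ under one coproduct, where S(g₁) g₂ collapses to the counit.
    rw [h2, h1, Coalgebra.coassoc_symm_apply]
    have h3 : ∀ t : H ⊗[k] H, (LinearMap.mul' k H ∘ₗ (antipode k).rTensor H).rTensor H
        ((comul (R := k)).rTensor H t) =
        (Algebra.linearMap k H).rTensor H ((counit (R := k)).rTensor H t) := by
      intro t
      induction t with
      | zero => simp
      | add s s' hs hs' => simp only [map_add, hs, hs']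
      | tmul x y => simp
    rw [h3, Coalgebra.rTensor_counit_comul]
    simp

/-- Neither factor touches leg 2. In legs 3 and 1, in this order, the product is s times the flip of
t, so evaluating leg 3 evaluates its first factor. For s = t = R⁻¹ this is Q evaluated on its first
factor. -/
lemma evalLast_leg₃₁_mul_leg₁₃ (b : HDual k H) (s t : H ⊗[k] H) :
    evalLast b (leg₃₁ k H s * leg₁₃ k H t) =
      TensorProduct.lid k H (b.ofConv.rTensor H (s * TensorProduct.comm k H H t)) ⊗ₜ 1 := by
  induction s with
  | zero => simp
  | add s s' hs hs' => simp only [map_add, add_mul, TensorProduct.add_tmul, hs, hs']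
  | tmul x y =>
    induction t with
    | zero => simp
    | add s s' hs hs' => simp only [map_add, mul_add, TensorProduct.add_tmul, hs, hs']
    | tmul p q =>
      simp [leg₃₁_tmul, leg₁₃_tmul, evalLast_tmul, TensorProduct.smul_tmul']

lemma comul_evalLast (d : HDual k H) (t : H ⊗[k] H) :
    comul (R := k) (evalLast d t) = evalLast d ((comul (R := k)).rTensor H t) := by
  induction t with
  | zero => simp
  | add s s' hs hs' => simp only [map_add, hs, hs']
  | tmul x y => simp [evalLast_tmul]

variable [Quasitriangular k H]

/-- `R₃₁⁻¹ R₂₃ (Δ ⊗ id)(R⁻¹) = R₃₁⁻¹ R₁₃⁻¹`. -/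
lemma exchangeElement_mul_comul : exchangeElement k H *
    (comul (R := k)).rTensor H (((R k H)⁻¹ : (H ⊗[k] H)ˣ) : H ⊗[k] H) =
      leg₃₁ k H ((R k H)⁻¹ : (H ⊗[k] H)ˣ) * leg₁₃ k H ((R k H)⁻¹ : (H ⊗[k] H)ˣ) := by
  -- The inverse reverses the hexagon axiom, which puts R₂₃⁻¹ directly beside the factor R₂₃ of E.
  have h : (comul (R := k)).rTensor H (((R k H)⁻¹ : (H ⊗[k] H)ˣ) : H ⊗[k] H) =
      leg₂₃ k H ((R k H)⁻¹ : (H ⊗[k] H)ˣ) * leg₁₃ k H ((R k H)⁻¹ : (H ⊗[k] H)ˣ) :=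
    map_inv_of_map_eq_mul (Algebra.TensorProduct.map (Bialgebra.comulAlgHom k H) (AlgHom.id k H))
      (leg₁₃ k H) (leg₂₃ k H) (R k H) comul_left
  rw [h, exchangeElement, mul_assoc, ← mul_assoc (leg₂₃ k H _), ← map_mul, Units.mul_inv,
    map_one, one_mul]

variable [FiniteDimensional k H]

/-- On b ⊗ g, splitting b over a product of last legs gives b evaluated on E (Δ ⊗ id)(R⁻¹) = R₃₁⁻¹
R₁₃⁻¹, that is Q(b) ⊗ 1, times Δg. So `dualShear` brings the map to the form x ⊗ g ↦ x g₁ ⊗ g₂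
composed with Q, which can be inverted by hand. -/
lemma doubleToSquareₗ_dualShear (t : HDual k H ⊗[k] H) :
    doubleToSquareₗ k H ((DrinfeldDouble.equiv k H).symm (dualShear t)) =
      comulShear k H ((factorMap k H).rTensor H t) := by
  induction t with
  | zero => simp
  | add s s' hs hs' => simp only [map_add, hs, hs']
  | tmul b g =>
    -- `X` replaces the coproduct of b, so that pure tensors suffice.
    have h1 : ∀ X : HDual k H ⊗[k] HDual k H, doubleToSquareₗ k H ((DrinfeldDouble.equiv k H).symm
        ((LinearMap.mul' k H ∘ₗ (evalInvSnd k H).rTensor H).lTensor (HDual k H)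
          (TensorProduct.assoc k (HDual k H) (HDual k H) H (X ⊗ₜ g)))) =
        LinearMap.mul' k (H ⊗[k] H) (TensorProduct.map (evalLastₗ (exchangeElement k H))
          (evalLastₗ ((comul (R := k)).rTensor H (((R k H)⁻¹ : (H ⊗[k] H)ˣ) : H ⊗[k] H))) X) *
          comul (R := k) g := by
      intro X
      induction X with
      | zero => simp
      | add s s' hs hs' => simp only [map_add, TensorProduct.add_tmul, add_mul, hs, hs']
      | tmul c d =>
        have : doubleToSquareₗ k H ((DrinfeldDouble.equiv k H).symm
          ((LinearMap.mul' k H ∘ₗ (evalInvSnd k H).rTensor H).lTensor (HDual k H)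
          (TensorProduct.assoc k (HDual k H) (HDual k H) H ((c ⊗ₜ[k] d) ⊗ₜ g)))) =
          evalLast c (exchangeElement k H) *
            comul (evalLast d (((R k H)⁻¹ : (H ⊗[k] H)ˣ) : H ⊗[k] H) * g) := rfl
        rw [this, Bialgebra.comul_mul, comul_evalLast, ← mul_assoc]
        rfl
    refine (h1 (comul (R := k) b)).trans ?_
    rw [← evalLast_mul, exchangeElement_mul_comul, evalLast_leg₃₁_mul_leg₁₃,
      LinearMap.rTensor_tmul, comulShear_tmul, factorMap_apply, factorElement]

/-- After `dualShear` the map is `comulShear` composed with Q; Q⁻¹ cancels Q and `antipodeShear` is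
undone by `comulShear`. -/
lemma doubleToSquareBialgHom_squareToDouble (hQ : Function.Bijective (factorMap k H)) (h g : H) :
    doubleToSquareBialgHom k H (squareToDouble hQ h g) = TwistedSquare.tmul h g := by
  change doubleToSquareₗ k H (squareToDouble hQ h g) = h ⊗ₜ g
  rw [squareToDouble, doubleToSquareₗ_dualShear, ← LinearMap.rTensor_comp_apply]
  have : factorMap k H ∘ₗ (LinearEquiv.ofBijective (factorMap k H) hQ).symm.toLinearMap =
      LinearMap.id := by
    ext1 x
    exact LinearEquiv.apply_symm_apply (LinearEquiv.ofBijective (factorMap k H) hQ) x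
  rw [this, LinearMap.rTensor_id, LinearMap.id_apply, comulShear_antipodeShear]

/-- Surjectivity comes from the explicit right inverse, and injectivity from equality of finite
dimensions. -/
lemma doubleToSquareₗ_bijective (hQ : Function.Bijective (factorMap k H)) :
    Function.Bijective (doubleToSquareₗ k H) := by
  have hs : Function.Surjective (doubleToSquareₗ k H) := by
    intro t
    induction t with
    | zero => exact ⟨0, map_zero _⟩
    | add s s' hs hs' =>
      obtain ⟨F, rfl⟩ := hs
      obtain ⟨G, rfl⟩ := hs'
      exact ⟨F + G, map_add _ _ _⟩
    | tmul h g => exact ⟨_, doubleToSquareBialgHom_squareToDouble hQ h g⟩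
  -- Any linear isomorphism would do. It turns the map into an endomorphism of H ⊗ H, for which
  -- surjective implies injective.
  let e : HDual k H ⊗[k] H ≃ₗ[k] H ⊗[k] H :=
    TensorProduct.congr (LinearEquiv.ofBijective (factorMap k H) hQ) (LinearEquiv.refl k H)
  have hi : Function.Injective (doubleToSquareₗ k H ∘ₗ
      ((DrinfeldDouble.equiv k H).trans e).symm.toLinearMap) :=
    LinearMap.injective_iff_surjective.mpr
      (hs.comp ((DrinfeldDouble.equiv k H).trans e).symm.surjective)
  refine ⟨fun F G h => ((DrinfeldDouble.equiv k H).trans e).injective (hi ?_), hs⟩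
  simpa only [LinearMap.comp_apply, LinearEquiv.coe_coe, LinearEquiv.symm_apply_apply] using h

end Inverse

end HopfStructure

end QuantumDouble

end

theorem mainTheorem2 (k H : Type*) [Field k] [Ring H] [HopfAlgebra k H]
    [FiniteDimensional k H] [QuantumDouble.Quasitriangular k H]
    (hQ : Function.Bijective (QuantumDouble.factorMap k H)) :
    ∃ e : QuantumDouble.DrinfeldDouble k H ≃ₐc[k] QuantumDouble.TwistedSquare k H,
      (∀ (a : QuantumDouble.HDual k H) (h : H),
        e (QuantumDouble.DrinfeldDouble.tmul a h) = QuantumDouble.doubleToSquare a h) ∧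
      (∀ x : QuantumDouble.DrinfeldDouble k H, e (antipode k x) = antipode k (e x)) ∧
      (∀ h g : H,
        e.symm (QuantumDouble.TwistedSquare.tmul h g) = QuantumDouble.squareToDouble hQ h g) := by
  refine ⟨BialgEquiv.ofBijective (QuantumDouble.doubleToSquareBialgHom k H)
    (QuantumDouble.doubleToSquareₗ_bijective hQ), fun _ _ => rfl,
    QuantumDouble.map_antipode (QuantumDouble.doubleToSquareBialgHom k H), fun h g => ?_⟩
  -- A right inverse of a bijection is its inverse.
  rw [← QuantumDouble.doubleToSquareBialgHom_squareToDouble hQ h g]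
  exact BialgEquiv.symm_apply_apply _ _
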